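/- **Setting.** Let $\mathbb k$ be an algebraically closed field of characteristic $0$, $i\in\mathbb k$ with $i^2=-1$, and $q^{1/2}=e^{i\hbar/2}\in\mathbb k[\![\hbar]\!]$. Let $r\ge 3$ and $D_j\in\mathbb Z$ for $j\in\mathbb Z/r$ (for a Looijenga pair $(Y,D)$ whose boundary is a cycle of $r$ components, the self-intersection numbers of these components). Let $(B,\Sigma)$ be the cone complex with two-dimensional cones $\sigma_j=\mathbb R_{\ge0}v_j+\mathbb R_{\ge0}v_{j+1}$ in anticlockwise order, with the integral linear structure on $B_0=B\setminus\{0\}$ given across $\rho_j=\mathbb R_{\ge 0}v_j$ by $v_{j-1}+v_{j+1}=-D_jv_j$, with integral points $B(\mathbb Z)$, local system $\Lambda$ of integral tangent vectors, and skew form $\langle v_j,v_{j+1}\rangle=1$. Let $P$ be a toric monoid, $J\subset P$ a radical monoid ideal, $\varphi$ a multivalued $\Sigma$-piecewise linear function on $B$ whose kinks $\kappa_j$ along $\rho_j$ all lie in $J$, $I\subset P$ an ideal with radical $J$, $R_I=\mathbb k[P]/I$ and $R_I^\hbar=R_I[\![\hbar]\!]$. For a two-dimensional cone $\sigma$ let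 $R^\hbar_{\sigma,I}$ be the quantum torus over $R_I^\hbar$ with basis $\hat z^{\varphi_\sigma(m)}$, $m\in\Lambda_\sigma$, and $\hat z^{s}\hat z^{s'}=q^{\frac12\langle s,s'\rangle}\hat z^{s+s'}$. A *quantum scattering diagram* $\hat{\mathfrak D}$ is a set of rays $\mathfrak d\subset B$ of rational slope from $0$, with primitive generators $m_{\mathfrak d}$, together with Hamiltonians $\hat H_{\mathfrak d}=\sum_{\ell\ge1,\,u\in P}H_{\ell,u}\,\hat z^{u\mp\varphi(\ell m_{\mathfrak d})}$ (sign $-$: outgoing, sign $+$: ingoing), $H_{\ell,u}\in\hbar^{-1}\mathbb k[\![\hbar]\!]$, each homogeneous part $\sum_u H_{\ell,u}z^u$ converging $J$-adically, such that for every ideal $I$ of radical $J$ the function $\hat f_{\mathfrak d}=\exp\big(\sum_{\ell,u}(q^{-\ell}-1)H_{\ell,u}\hat z^{u\mp\varphi(\ell m_{\mathfrak d})}\big)$ is modulo $I$ a polynomial in $\hat z^{\mp\varphi(m_{\mathfrak d})}$ over $R_I^\hbar$ and only finitely many rays are nontrivial modulo $I$, and such that $\hat H_{\mathfrak d}\equiv0$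 modulo $J$ unless $\mathfrak d=\rho_j$ with $\kappa_j\in J$. Put $\hat f_{\mathfrak d}(q^t\hat z)=\sum q^{-\ell t}f_{\ell,u}\hat z^{u\mp\varphi(\ell m_{\mathfrak d})}$ if $\hat f_{\mathfrak d}=\sum f_{\ell,u}\hat z^{u\mp\varphi(\ell m_{\mathfrak d})}$, and $m(\hat H_{\mathfrak d})=\pm m_{\mathfrak d}$ ($+$ for outgoing). A *quantum broken line* of charge $p\in B(\mathbb Z)\setminus\{0\}$ with endpoint $z$ is a continuous piecewise affine map $\gamma:(-\infty,0]\to B_0$ with finitely many domains of linearity $L$, carrying nonzero monomials $c_L\hat z^{p_L}$ with $\gamma'|_L=-\mathfrak r(p_L)$ (the tangent part), such that $\gamma(0)=z$; the unbounded domain comes from infinity in a cone $\sigma\ni p$ with monomial $\hat z^{\varphi_\sigma(p)}$; and at each point of non-linearity $\gamma$ crosses rays $\mathfrak d_1,\dots,\mathfrak d_N$ of $\hat{\mathfrak D}$, and the monomial is multiplied on the right by a term of $$\prod_{k:\,n_k>0}\ \prod_{t=0}^{n_k-1}\hat f_{\mathfrak d_k}(q^t\hat z)\ \prod_{k:\,n_k<0}\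 \prod_{t=0}^{|n_k|-1}\hat f_{\mathfrak d_k}(q^{-t-1}\hat z),\qquad n_k=\langle m(\hat H_{\mathfrak d_k}),\mathfrak r(p_L)\rangle .$$ For charge $0$ the only broken line ending at $z$ is the constant one with monomial $1$. For $z$ in the interior of $\sigma$, the final monomial of $\gamma$ is written $c(\gamma)\hat z^{\varphi_\sigma(s(\gamma))}$ with $s(\gamma)\in\Lambda_\sigma$ and $c(\gamma)\in R_I^\hbar$, and $\mathrm{Lift}_z(p)\in R^\hbar_{\sigma,I}$ is the sum of the final monomials of all broken lines of charge $p$ ending at $z$. Let $R^\hbar_{\rho_j,I}$ be the $R^\hbar_I$-algebra generated by $X^{\pm1},X_+,X_-$ with relations $XX_\pm=q^{\pm1}X_\pm X$, $X_+X_-=q^{\frac12D_j}z^{\kappa_j}\hat f_{\mathrm{out}}(q^{-1}X)\hat f_{\mathrm{in}}(X)X^{-D_j}$, $X_-X_+=q^{-\frac12D_j}z^{\kappa_j}\hat f_{\mathrm{out}}(X)\hat f_{\mathrm{in}}(qX)X^{-D_j}$, where $\hat f_{\mathrm{out}}$, $\hat f_{\mathrm{in}}$ are the products of the $\hat f_{\mathfrak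 d}$ over the outgoing and ingoing rays with support $\rho_j$ and $X=\hat z^{\varphi(v_j)}$. It maps by $\hat\psi_{j,-}$ to $R^\hbar_{\sigma_{j-1},I}$, with $X_-\mapsto\hat z^{\varphi_{\rho_j}(v_{j-1})}$, $X_+\mapsto\hat f_{\mathrm{in}}\,\hat z^{\varphi_{\rho_j}(v_{j+1})}\hat f_{\mathrm{out}}$, and by $\hat\psi_{j,+}$ to $R^\hbar_{\sigma_j,I}$, with $X_+\mapsto\hat z^{\varphi_{\rho_j}(v_{j+1})}$, $X_-\mapsto\hat f_{\mathrm{out}}\,\hat z^{\varphi_{\rho_j}(v_{j-1})}\hat f_{\mathrm{in}}$; both send $X$ to $\hat z^{\varphi(v_j)}$. Let $\hat\theta_{\sigma_j}$ be the automorphism of $R^\hbar_{\sigma_j,I}$ obtained by crossing anticlockwise all rays in the interior of $\sigma_j$ (conjugation by $\exp(\mp\hat H_{\mathfrak d})$ for each outgoing/ingoing ray). Let $A^\hbar_I$ be the algebra of global sections of the sheaf glued from these pieces, i.e. of families $(a_j)\in\prod_jR^\hbar_{\rho_j,I}$ with $\hat\theta_{\sigma_j}(\hat\psi_{j,+}(a_j))=\hat\psi_{j+1,-}(a_{j+1})$.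 Call $z$ *generic* if the line joining $0$ and $z$ has irrational slope. Assume that $\hat{\mathfrak D}$ is *consistent*: for all ideals $I$ of radical $J$ and all $p\ne0$, $\mathrm{Lift}_z(p)$ at generic $z$ is carried to $\mathrm{Lift}_{z'}(p)$ by the path automorphism inside each two-dimensional cone, and for generic $z_\pm$ in the chambers modulo $I$ adjacent to $\rho_j$ on its two sides, $\mathrm{Lift}_{z_-}(p)$ and $\mathrm{Lift}_{z_+}(p)$ are the images under $\hat\psi_{j,-}$ and $\hat\psi_{j,+}$ of one element $\mathrm{Lift}_{\rho_j}(p)$ of $R^\hbar_{\rho_j,I}$. **Theorem.** There are unique quantum theta functions $\hat\vartheta_p\in A^\hbar_I$, $p\in B(\mathbb Z)$, with $\hat\vartheta_0=1$ and $\hat\vartheta_p=(\mathrm{Lift}_{\rho_j}(p))_j$ for $p\neq0$. For all $p_1,p_2\in B(\mathbb Z)$ there is a unique finite expansion $$\hat\vartheta_{p_1}\hat\vartheta_{p_2}=\sum_{p\in B(\mathbb Z)}C^p_{p_1,p_2}\hat\vartheta_p,\qquad C^p_{p_1,p_2}\in R_I^\hbar .$$ For every $p\in B(\mathbb Z)$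 there is a neighbourhood of $p$, independent of $p_1,p_2$, such that for every generic $z$ in it, lying in the interior of a two-dimensional cone $\sigma\ni p$, and all $p_1,p_2\in B(\mathbb Z)$, $$C^p_{p_1,p_2}=\sum_{\gamma_1,\gamma_2}c(\gamma_1)c(\gamma_2)\,q^{\frac12\langle s(\gamma_1),s(\gamma_2)\rangle},$$ where the ($\hbar$-adically convergent) sum is over all pairs of quantum broken lines $\gamma_1,\gamma_2$ of charges $p_1,p_2$ ending at $z$ with $s(\gamma_1)+s(\gamma_2)=p$. -/

import Mathlib

open scoped LaurentPolynomial

noncomputable section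

namespace QuantumTheta

/-! ### Quantum tori -/

/-- The standard skew-symmetric form on `ℤ²`, with `⟨(1,0),(0,1)⟩ = 1`. -/
def pairing (m n : ℤ × ℤ) : ℤ := m.1 * n.2 - n.1 * m.2

/-- The rank two quantum torus over a commutative ring `T` in which `v = q^{1/2}` is a unit: the
free `T`-module with basis the monomials `z^m`, `m ∈ ℤ²`, and the product
`z^m z^n = v^{⟨m,n⟩} z^{m+n}`. -/
def QTorus (T : Type*) [CommRing T] (_v : Tˣ) : Type _ := (ℤ × ℤ) →₀ T

namespace QTorus

variable {T : Type*} [CommRing T] {v : Tˣ}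

instance : AddCommGroup (QTorus T v) := inferInstanceAs (AddCommGroup ((ℤ × ℤ) →₀ T))

instance : Module T (QTorus T v) := inferInstanceAs (Module T ((ℤ × ℤ) →₀ T))

/-- The term `c z^m`. -/
def term (m : ℤ × ℤ) (c : T) : QTorus T v := Finsupp.single m c

/-- The coefficient of `z^m`. -/
def coeff (x : QTorus T v) (m : ℤ × ℤ) : T := (show (ℤ × ℤ) →₀ T from x) m

/-- The product as a bilinear map. -/
def mulF (v : Tˣ) : ((ℤ × ℤ) →₀ T) →ₗ[T] ((ℤ × ℤ) →₀ T) →ₗ[T] ((ℤ × ℤ) →₀ T) :=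
  Finsupp.linearCombination T fun m : ℤ × ℤ =>
    Finsupp.linearCombination T fun n : ℤ × ℤ =>
      Finsupp.single (m + n) ((v ^ pairing m n : Tˣ) : T)

/-- The product as a bilinear map on the quantum torus. -/
def mulL (v : Tˣ) : QTorus T v →ₗ[T] QTorus T v →ₗ[T] QTorus T v := mulF v

instance : Mul (QTorus T v) := ⟨fun x y => mulL v x y⟩

instance : One (QTorus T v) := ⟨term 0 1⟩

theorem induct {p : QTorus T v → Prop} (x : QTorus T v) (h0 : p 0)
    (ha : ∀ a b, p a → p b → p (a + b)) (ht : ∀ m c, p (term m c)) : p x :=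
  Finsupp.induction_linear x h0 (fun a b => ha a b) ht

theorem smul_term (c d : T) (m : ℤ × ℤ) :
    c • (term m d : QTorus T v) = term m (c * d) := Finsupp.smul_single _ _ _

theorem mulF_single (v : Tˣ) (m n : ℤ × ℤ) (c d : T) :
    mulF v (Finsupp.single m c) (Finsupp.single n d)
      = Finsupp.single (m + n) (c * d * ((v ^ pairing m n : Tˣ) : T)) := by
  unfold mulF
  rw [Finsupp.linearCombination_single, LinearMap.smul_apply,
    Finsupp.linearCombination_single, Finsupp.smul_single, Finsupp.smul_single]
  congr 1
  simp only [smul_eq_mul]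
  ring

theorem term_mul_term (m n : ℤ × ℤ) (c d : T) :
    (term m c * term n d : QTorus T v)
      = term (m + n) (c * d * ((v ^ pairing m n : Tˣ) : T)) := mulF_single v m n c d

theorem mul_def' (x y : QTorus T v) : x * y = mulL v x y := rfl

theorem add_mul' (x y z : QTorus T v) : (x + y) * z = x * z + y * z := by
  simp [mul_def']

theorem mul_add' (x y z : QTorus T v) : x * (y + z) = x * y + x * z := by
  simp [mul_def']

theorem zero_mul' (x : QTorus T v) : 0 * x = 0 := by simp [mul_def']

theorem mul_zero' (x : QTorus T v) : x * 0 = 0 := by simp [mul_def']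

theorem mul_assoc' (x y z : QTorus T v) : x * y * z = x * (y * z) := by
  induction x using induct with
  | h0 => simp [zero_mul']
  | ha a b ha hb => simp [add_mul', ha, hb]
  | ht m c =>
    induction y using induct with
    | h0 => simp [zero_mul', mul_zero']
    | ha a b ha hb => simp [add_mul', mul_add', ha, hb]
    | ht n d =>
      induction z using induct with
      | h0 => simp [mul_zero']
      | ha a b ha hb => simp [mul_add', ha, hb]
      | ht l e =>
        simp only [term_mul_term]
        rw [add_assoc]
        congr 1
        have h1 : pairing (m + n) l = pairing m l + pairing n l := by
          simp [pairing]; ring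
        have h2 : pairing m (n + l) = pairing m n + pairing m l := by
          simp [pairing]; ring
        rw [h1, h2, zpow_add, zpow_add]
        push_cast
        ring

theorem one_mul' (x : QTorus T v) : 1 * x = x := by
  induction x using induct with
  | h0 => simp [mul_zero']
  | ha a b ha hb => simp [mul_add', ha, hb]
  | ht m c =>
    change term 0 1 * term m c = _
    simp [term_mul_term, pairing]

theorem mul_one' (x : QTorus T v) : x * 1 = x := by
  induction x using induct with
  | h0 => simp [zero_mul']
  | ha a b ha hb => simp [add_mul', ha, hb]
  | ht m c =>
    change term m c * term 0 1 = _
    simp [term_mul_term, pairing]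

instance : Ring (QTorus T v) where
  __ := (inferInstance : AddCommGroup (QTorus T v))
  left_distrib := mul_add'
  right_distrib := add_mul'
  zero_mul := zero_mul'
  mul_zero := mul_zero'
  mul_assoc := mul_assoc'
  one_mul := one_mul'
  mul_one := mul_one'

instance : Algebra T (QTorus T v) :=
  Algebra.ofModule (fun c x y => by simp [mul_def']) (fun c x y => by simp [mul_def'])

/-- The value `g(z^m) = ∑ g_a z^{a m}` of a Laurent polynomial `g` at a monomial. -/
def eval (m : ℤ × ℤ) (g : T[T;T⁻¹]) : QTorus T v :=
  g.coeff.sum fun a c => term (a • m) c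

end QTorus

/-- The Laurent polynomial `g(q^n X)`, where `q = v²`. -/
def qScale {T : Type*} [CommRing T] (v : Tˣ) (n : ℤ) (g : T[T;T⁻¹]) : T[T;T⁻¹] :=
  g.coeff.sum fun a c => AddMonoidAlgebra.single a (((v ^ (2 * n * a) : Tˣ) : T) * c)

namespace QTorus

variable {T : Type*} [CommRing T] {v : Tˣ}

theorem term_add (m : ℤ × ℤ) (c d : T) :
    (term m (c + d) : QTorus T v) = term m c + term m d := Finsupp.single_add _ _ _

theorem term_zero (m : ℤ × ℤ) : (term m 0 : QTorus T v) = 0 := Finsupp.single_zero _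

theorem eval_add (m : ℤ × ℤ) (g h : T[T;T⁻¹]) :
    (eval m (g + h) : QTorus T v) = eval m g + eval m h := by
  unfold eval
  rw [AddMonoidAlgebra.coeff_add]
  exact Finsupp.sum_add_index' (fun a => term_zero _) (fun a c d => term_add _ _ _)

theorem eval_single (m : ℤ × ℤ) (a : ℤ) (c : T) :
    (eval m (AddMonoidAlgebra.single a c) : QTorus T v) = term (a • m) c := by
  unfold eval
  rw [AddMonoidAlgebra.coeff_single]
  exact Finsupp.sum_single_index (term_zero _)

theorem eval_zero (m : ℤ × ℤ) : (eval m 0 : QTorus T v) = 0 := by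
  simp [eval]

theorem pairing_self (m : ℤ × ℤ) (a b : ℤ) : pairing (a • m) (b • m) = 0 := by
  simp [pairing]; ring

theorem eval_mul (m : ℤ × ℤ) (g h : T[T;T⁻¹]) :
    (eval m (g * h) : QTorus T v) = eval m g * eval m h := by
  induction g using AddMonoidAlgebra.induction_linear with
  | zero => simp [eval_zero]
  | add a b ha hb => simp [add_mul, eval_add, ha, hb]
  | single a c =>
    induction h using AddMonoidAlgebra.induction_linear with
    | zero => simp [eval_zero]
    | add a b ha hb => simp only [mul_add, eval_add, ha, hb]
    | single b d =>
      rw [AddMonoidAlgebra.single_mul_single]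
      simp only [eval_single, term_mul_term, pairing_self, add_smul]
      simp

theorem qScale_add (n : ℤ) (g h : T[T;T⁻¹]) :
    qScale v n (g + h) = qScale v n g + qScale v n h := by
  unfold qScale
  rw [AddMonoidAlgebra.coeff_add]
  exact Finsupp.sum_add_index' (by simp) (by intros; simp [mul_add])

theorem qScale_single (n a : ℤ) (c : T) :
    qScale v n (AddMonoidAlgebra.single a c)
      = AddMonoidAlgebra.single a (((v ^ (2 * n * a) : Tˣ) : T) * c) := by
  unfold qScale
  rw [AddMonoidAlgebra.coeff_single]
  exact Finsupp.sum_single_index (by simp)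

theorem eval_mul_term (m n : ℤ × ℤ) (g : T[T;T⁻¹]) (c : T) :
    (eval m g * term n c : QTorus T v) = term n c * eval m (qScale v (pairing m n) g) := by
  induction g using AddMonoidAlgebra.induction_linear with
  | zero => simp [eval_zero, qScale]
  | add a b ha hb => simp [add_mul, mul_add, eval_add, qScale_add, ha, hb]
  | single a d =>
    rw [qScale_single, eval_single, eval_single, term_mul_term, term_mul_term, add_comm]
    congr 1
    have h1 : pairing (a • m) n = a * pairing m n := by simp [pairing]; ring
    have h2 : pairing n (a • m) = -(a * pairing m n) := by simp [pairing]; ring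
    rw [h1, h2]
    have h3 : (2 * pairing m n * a) = a * pairing m n + a * pairing m n := by ring
    rw [h3, zpow_add]
    have h4 : ((v ^ (a * pairing m n) : Tˣ) : T) * ((v ^ (-(a * pairing m n)) : Tˣ) : T) = 1 := by
      rw [← Units.val_mul, ← zpow_add]; simp
    push_cast
    linear_combination (-(d * c * ((v ^ (a * pairing m n) : Tˣ) : T))) * h4

theorem eval_comm (m : ℤ × ℤ) (g h : T[T;T⁻¹]) :
    (eval m g * eval m h : QTorus T v) = eval m h * eval m g := by
  rw [← eval_mul, mul_comm, eval_mul]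

theorem rel_right (m n n' : ℤ × ℤ) (b : ℤ) (h : n + n' = b • m) (κ : T) (f g : T[T;T⁻¹]) :
    (eval m f * term n κ * eval m g * term n' 1 : QTorus T v)
      = (((v ^ pairing n n' : Tˣ) : T) * κ) •
        eval m (qScale v (pairing m n') g * f * LaurentPolynomial.T b) := by
  have hT : (term (n + n') (κ * 1 * ((v ^ pairing n n' : Tˣ) : T)) : QTorus T v)
      = (((v ^ pairing n n' : Tˣ) : T) * κ) • eval m (LaurentPolynomial.T b) := by
    rw [LaurentPolynomial.T, eval_single, smul_term, h]
    congr 1; ring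
  have h1 : (eval m g * term n' 1 : QTorus T v)
      = term n' 1 * eval m (qScale v (pairing m n') g) := eval_mul_term m n' g 1
  rw [mul_assoc, h1, ← mul_assoc, mul_assoc (eval m f), term_mul_term, hT, mul_smul_comm,
    smul_mul_assoc, ← eval_mul, ← eval_mul]
  congr 2
  ring

theorem term_comm (m n : ℤ × ℤ) (c d : T) :
    (term m c * term n d : QTorus T v)
      = ((v ^ (2 * pairing m n) : Tˣ) : T) • (term n d * term m c) := by
  rw [term_mul_term, term_mul_term, smul_term, add_comm]
  congr 1
  have h2 : pairing n m = - pairing m n := by simp [pairing]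
  have h4 : ((v ^ (pairing m n) : Tˣ) : T) * ((v ^ (-(pairing m n)) : Tˣ) : T) = 1 := by
    rw [← Units.val_mul, ← zpow_add]; simp
  rw [h2, two_mul, zpow_add]
  push_cast
  linear_combination (-(d * c * ((v ^ pairing m n : Tˣ) : T))) * h4

theorem rel_comm (m n : ℤ × ℤ) (κ : T) (f g : T[T;T⁻¹]) :
    (term m 1 * (eval m f * term n κ * eval m g) : QTorus T v)
      = ((v ^ (2 * pairing m n) : Tˣ) : T) •
        (eval m f * term n κ * eval m g * term m 1) := by
  have hm : (term m 1 : QTorus T v) = eval m (LaurentPolynomial.T 1) := by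
    rw [LaurentPolynomial.T, eval_single, one_smul]
  have h1 : (term m 1 * eval m f : QTorus T v) = eval m f * term m 1 := by
    rw [hm, eval_comm]
  have h2 : (eval m g * term m 1 : QTorus T v) = term m 1 * eval m g := by
    rw [hm, eval_comm]
  rw [← mul_assoc, ← mul_assoc, h1, mul_assoc (eval m f), term_comm, mul_smul_comm,
    smul_mul_assoc, mul_assoc _ (eval m g), h2]
  simp only [mul_assoc]

theorem rel_left (m n n' : ℤ × ℤ) (b : ℤ) (h : n' + n = b • m) (κ : T) (f g : T[T;T⁻¹]) :
    (term n' 1 * (eval m f * term n κ * eval m g) : QTorus T v)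
      = (((v ^ pairing n' n : Tˣ) : T) * κ) •
        eval m (qScale v (pairing m n) f * g * LaurentPolynomial.T b) := by
  have hT : (term (n' + n) (1 * κ * ((v ^ pairing n' n : Tˣ) : T)) : QTorus T v)
      = (((v ^ pairing n' n : Tˣ) : T) * κ) • eval m (LaurentPolynomial.T b) := by
    rw [LaurentPolynomial.T, eval_single, smul_term, h]
    congr 1; ring
  rw [eval_mul_term, mul_assoc (term n κ), ← mul_assoc, term_mul_term, hT, eval_mul,
    eval_mul, smul_mul_assoc, ← eval_mul, eval_comm]

end QTorus

/-! ### The algebra attached to a ray of the fan -/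

/-- Generators `X`, `X⁻¹`, `X₊`, `X₋`. -/
inductive RayGen
  | X
  | Xinv
  | Xp
  | Xm

/-- The value `∑ g_a x^a` of a Laurent polynomial, where `y` plays the role of `x⁻¹`. -/
def laurentAt {T A : Type*} [CommRing T] [Semiring A] [Algebra T A] (x y : A)
    (g : T[T;T⁻¹]) : A :=
  g.coeff.sum fun a c => c • (if 0 ≤ a then x ^ a.toNat else y ^ (-a).toNat)

section RayAlgebra

variable {T : Type*} [CommRing T] (v : Tˣ) (κ : T) (D : ℤ) (fo fi : T[T;T⁻¹])

open FreeAlgebra in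
/-- The defining relations: `X` is invertible, `X X₊ = q X₊ X`, `X X₋ = q⁻¹ X₋ X`,
`X₊ X₋ = q^{D/2} κ fo(q⁻¹ X) fi(X) X^{-D}` and `X₋ X₊ = q^{-D/2} κ fo(X) fi(q X) X^{-D}`. -/
inductive RayRel : FreeAlgebra T RayGen → FreeAlgebra T RayGen → Prop
  | inv_right : RayRel (ι T .X * ι T .Xinv) 1
  | inv_left : RayRel (ι T .Xinv * ι T .X) 1
  | comm_plus : RayRel (ι T .X * ι T .Xp) (((v ^ (2 : ℤ) : Tˣ) : T) • (ι T .Xp * ι T .X))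
  | comm_minus : RayRel (ι T .X * ι T .Xm) (((v ^ (-2 : ℤ) : Tˣ) : T) • (ι T .Xm * ι T .X))
  | plus_minus : RayRel (ι T .Xp * ι T .Xm)
      ((((v ^ D : Tˣ) : T) * κ) •
        laurentAt (ι T .X) (ι T .Xinv) (qScale v (-1) fo * fi * LaurentPolynomial.T (-D)))
  | minus_plus : RayRel (ι T .Xm * ι T .Xp)
      ((((v ^ (-D) : Tˣ) : T) * κ) •
        laurentAt (ι T .X) (ι T .Xinv) (fo * qScale v 1 fi * LaurentPolynomial.T (-D)))

/-- The `T`-algebra with generators `X^{±1}, X₊, X₋` and the relations `RayRel`. -/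
abbrev RayAlgebra : Type _ := RingQuot (RayRel v κ D fo fi)

/-- The images of the generators under `ψ₋`, in the cone `σ₋` with basis `(m_{ρ₋}, m_ρ)`. There
`m_{ρ₊} = -m_{ρ₋} - D m_ρ` and `φ_ρ(m_{ρ₊}) = κ + φ_{σ₋}(m_{ρ₊})`. -/
def psiMinusGen : RayGen → QTorus T v
  | .X => QTorus.term (0, 1) 1
  | .Xinv => QTorus.term (0, -1) 1
  | .Xm => QTorus.term (1, 0) 1
  | .Xp => QTorus.eval (0, 1) fi * QTorus.term (-1, -D) κ * QTorus.eval (0, 1) fo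

/-- The images of the generators under `ψ₊`, in the cone `σ₊` with basis `(m_ρ, m_{ρ₊})`. There
`m_{ρ₋} = -m_{ρ₊} - D m_ρ` and `φ_ρ(m_{ρ₋}) = κ + φ_{σ₊}(m_{ρ₋})`. -/
def psiPlusGen : RayGen → QTorus T v
  | .X => QTorus.term (1, 0) 1
  | .Xinv => QTorus.term (-1, 0) 1
  | .Xm => QTorus.eval (1, 0) fo * QTorus.term (-D, -1) κ * QTorus.eval (1, 0) fi
  | .Xp => QTorus.term (0, 1) 1

variable {v κ D fo fi}

theorem lift_laurentAt (p : RayGen → QTorus T v) (m : ℤ × ℤ) (hX : p .X = QTorus.term m 1)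
    (hY : p .Xinv = QTorus.term (-m) 1) (g : T[T;T⁻¹]) :
    FreeAlgebra.lift T p (laurentAt (FreeAlgebra.ι T .X) (FreeAlgebra.ι T .Xinv) g)
      = QTorus.eval m g := by
  have hpow : ∀ (l : ℤ × ℤ) (k : ℕ),
      (QTorus.term l 1 : QTorus T v) ^ k = QTorus.term ((k : ℤ) • l) 1 := by
    intro l k
    induction k with
    | zero => simp; rfl
    | succ k ih =>
      rw [pow_succ, ih, QTorus.term_mul_term]
      have : pairing ((k : ℤ) • l) l = 0 := by simp [pairing]; ring
      rw [this]
      simp [add_smul]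
  unfold laurentAt QTorus.eval
  rw [Finsupp.sum, map_sum, Finsupp.sum]
  refine Finset.sum_congr rfl fun a _ => ?_
  rw [map_smul]
  split_ifs with h
  · rw [map_pow, FreeAlgebra.lift_ι_apply, hX, hpow, QTorus.smul_term, mul_one,
      Int.toNat_of_nonneg h]
  · rw [map_pow, FreeAlgebra.lift_ι_apply, hY, hpow, QTorus.smul_term, mul_one,
      Int.toNat_of_nonneg (by omega)]
    simp

theorem psiMinus_rel ⦃x y : FreeAlgebra T RayGen⦄ (h : RayRel v κ D fo fi x y) :
    FreeAlgebra.lift T (psiMinusGen v κ D fo fi) x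
      = FreeAlgebra.lift T (psiMinusGen v κ D fo fi) y := by
  have hl := lift_laurentAt (psiMinusGen v κ D fo fi) (0, 1) rfl (by simp [psiMinusGen])
  induction h with
  | inv_right =>
    simp only [map_mul, FreeAlgebra.lift_ι_apply, psiMinusGen, QTorus.term_mul_term, map_one]
    simp [pairing]; rfl
  | inv_left =>
    simp only [map_mul, FreeAlgebra.lift_ι_apply, psiMinusGen, QTorus.term_mul_term, map_one]
    simp [pairing]; rfl
  | comm_plus =>
    simp only [map_mul, map_smul, FreeAlgebra.lift_ι_apply, psiMinusGen]
    rw [QTorus.rel_comm]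
    simp [pairing]
  | comm_minus =>
    simp only [map_mul, map_smul, FreeAlgebra.lift_ι_apply, psiMinusGen]
    rw [QTorus.term_comm]
    simp [pairing]
  | plus_minus =>
    rw [map_smul, hl, map_mul]
    simp only [FreeAlgebra.lift_ι_apply, psiMinusGen]
    rw [QTorus.rel_right (b := -D) (h := by simp)]
    simp only [pairing]
    congr 2
    norm_num
  | minus_plus =>
    rw [map_smul, hl, map_mul]
    simp only [FreeAlgebra.lift_ι_apply, psiMinusGen]
    rw [QTorus.rel_left (b := -D) (h := by simp)]
    simp only [pairing]
    congr 2
    · norm_num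
    · norm_num
      ring

theorem psiPlus_rel ⦃x y : FreeAlgebra T RayGen⦄ (h : RayRel v κ D fo fi x y) :
    FreeAlgebra.lift T (psiPlusGen v κ D fo fi) x
      = FreeAlgebra.lift T (psiPlusGen v κ D fo fi) y := by
  have hl := lift_laurentAt (psiPlusGen v κ D fo fi) (1, 0) rfl (by simp [psiPlusGen])
  induction h with
  | inv_right =>
    simp only [map_mul, FreeAlgebra.lift_ι_apply, psiPlusGen, QTorus.term_mul_term, map_one]
    simp [pairing]; rfl
  | inv_left =>
    simp only [map_mul, FreeAlgebra.lift_ι_apply, psiPlusGen, QTorus.term_mul_term, map_one]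
    simp [pairing]; rfl
  | comm_plus =>
    simp only [map_mul, map_smul, FreeAlgebra.lift_ι_apply, psiPlusGen]
    rw [QTorus.term_comm]
    simp [pairing]
  | comm_minus =>
    simp only [map_mul, map_smul, FreeAlgebra.lift_ι_apply, psiPlusGen]
    rw [QTorus.rel_comm]
    simp [pairing]
  | plus_minus =>
    rw [map_smul, hl, map_mul]
    simp only [FreeAlgebra.lift_ι_apply, psiPlusGen]
    rw [QTorus.rel_left (b := -D) (h := by simp)]
    simp only [pairing]
    congr 2
    · norm_num
    · norm_num
  | minus_plus =>
    rw [map_smul, hl, map_mul]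
    simp only [FreeAlgebra.lift_ι_apply, psiPlusGen]
    rw [QTorus.rel_right (b := -D) (h := by simp)]
    simp only [pairing]
    congr 2
    · norm_num
    · norm_num
      ring

variable (v κ D fo fi)

/-- The homomorphism `ψ₋` to the quantum torus of `σ₋`. -/
def psiMinus : RayAlgebra v κ D fo fi →ₐ[T] QTorus T v :=
  RingQuot.liftAlgHom T ⟨FreeAlgebra.lift T (psiMinusGen v κ D fo fi), psiMinus_rel⟩

/-- The homomorphism `ψ₊` to the quantum torus of `σ₊`. -/
def psiPlus : RayAlgebra v κ D fo fi →ₐ[T] QTorus T v :=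
  RingQuot.liftAlgHom T ⟨FreeAlgebra.lift T (psiPlusGen v κ D fo fi), psiPlus_rel⟩

end RayAlgebra

/-! ### Coefficient rings -/

/-- Toric monoids: finitely generated, cancellative, saturated, with torsion free group
completion. -/
class IsToricMonoid (P : Type*) [AddCommMonoid P] : Prop where
  fg : AddMonoid.FG P
  cancel : ∀ a b c : P, a + b = a + c → b = c
  torsionFree : ∀ n : ℕ, 0 < n → ∀ a b : P, n • a = n • b → a = b
  saturated : ∀ n : ℕ, 0 < n → ∀ a b c : P, n • a = n • b + c → ∃ d, a = b + d

/-- `J` is the radical of the monoid ideal `I`. -/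
def IsRadicalOf {P : Type*} [AddCommMonoid P] (J I : AddSemigroupIdeal P) : Prop :=
  ∀ p : P, p ∈ J ↔ ∃ n : ℕ, 0 < n ∧ n • p ∈ I

section Coefficients

variable {k : Type*} [Field k] {P : Type*} [AddCommMonoid P]

variable (k) in
/-- The ideal of `k[P]` spanned by the monomials with exponent in `I`. -/
def monomialIdeal (I : AddSemigroupIdeal P) : Ideal (AddMonoidAlgebra k P) :=
  Ideal.span {x | ∃ u ∈ I, x = AddMonoidAlgebra.single u 1}

variable (k) in
/-- `R_I = k[P]/I`. -/
abbrev RI (I : AddSemigroupIdeal P) : Type _ := AddMonoidAlgebra k P ⧸ monomialIdeal k I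

variable (k) in
/-- `R_I^ħ = R_I⟦ħ⟧`; the variable of the power series is `ħ`. -/
abbrev RIh (I : AddSemigroupIdeal P) : Type _ := PowerSeries (RI k I)

/-- The inclusion of `k⟦ħ⟧` in `R_I⟦ħ⟧`. -/
def toRIh (I : AddSemigroupIdeal P) : PowerSeries k →+* RIh k I :=
  PowerSeries.map (algebraMap k (RI k I))

variable (k) in
/-- The class of `z^u` in `R_I⟦ħ⟧`. -/
def zP (I : AddSemigroupIdeal P) (u : P) : RIh k I :=
  PowerSeries.C (Ideal.Quotient.mk (monomialIdeal k I) (AddMonoidAlgebra.single u 1))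

theorem coeff_eq_zero_of_mem (I : AddSemigroupIdeal P) {u : P} (hu : u ∉ I)
    {x : AddMonoidAlgebra k P} (hx : x ∈ monomialIdeal k I) : x.coeff u = 0 := by
  classical
  refine Submodule.span_induction (p := fun x _ => ∀ u, u ∉ I → x.coeff u = 0)
    ?_ ?_ ?_ ?_ hx u hu
  · rintro _ ⟨w, hw, rfl⟩ u hu
    rw [AddMonoidAlgebra.coeff_single, Finsupp.single_apply, if_neg]
    rintro rfl
    exact hu hw
  · intro u _
    simp
  · intro x y _ _ hx hy u hu
    simp [hx u hu, hy u hu]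
  · intro a x _ hx u hu
    rw [smul_eq_mul, AddMonoidAlgebra.coeff_mul]
    refine Finset.sum_eq_zero fun b _ => ?_
    refine Finset.sum_eq_zero fun c _ => ?_
    dsimp only
    split_ifs with h
    · rw [hx c, mul_zero]
      intro hc
      exact hu (h ▸ AddSemigroupIdeal.add_mem I b hc)
    · rfl

open Classical in
/-- The coefficient of `z^u` in an element of `R_I`, for `u ∉ I` (and `0` for `u ∈ I`). -/
def coeffRI (I : AddSemigroupIdeal P) (u : P) : RI k I →+ k :=
  if hu : u ∈ I then 0 else
    QuotientAddGroup.lift (Submodule.toAddSubgroup (monomialIdeal k I))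
      { toFun := fun x => x.coeff u, map_zero' := by simp, map_add' := by simp }
      (fun _ hx => coeff_eq_zero_of_mem I hu hx)

/-- The coefficient in `k⟦ħ⟧` of `z^u` in an element of `R_I⟦ħ⟧`. -/
def coeffRIh (I : AddSemigroupIdeal P) (u : P) (x : RIh k I) : PowerSeries k :=
  PowerSeries.mk fun n => coeffRI I u (PowerSeries.coeff n x)

/-- An `ħ`-adically convergent sum in `R⟦ħ⟧`: each power of `ħ` occurs in finitely many terms only,
and `s` is the sum. -/
def HasHSum {R ι : Type*} [CommRing R] (f : ι → PowerSeries R) (s : PowerSeries R) : Prop :=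
  ∀ n, {x | PowerSeries.coeff n (f x) ≠ 0}.Finite ∧
    PowerSeries.coeff n s = ∑ᶠ x, PowerSeries.coeff n (f x)

/-- The sum of an `ħ`-adically convergent family. -/
def hSum {R ι : Type*} [CommRing R] (f : ι → PowerSeries R) : PowerSeries R :=
  PowerSeries.mk fun n => ∑ᶠ x, PowerSeries.coeff n (f x)

variable [CharZero k]

/-- `q^{n/2} = exp(n i ħ / 2)`, where `q = exp(i ħ)`. -/
def qHalf (i : k) (n : ℤ) : PowerSeries k :=
  PowerSeries.rescale ((n : k) * (i / 2)) (PowerSeries.exp k)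

theorem qHalf_mul (i : k) (m n : ℤ) : qHalf i m * qHalf i n = qHalf i (m + n) := by
  unfold qHalf
  rw [PowerSeries.exp_mul_exp_eq_exp_add]
  congr 2
  push_cast
  ring

theorem qHalf_zero (i : k) : qHalf i 0 = 1 := by
  simp [qHalf]

/-- `q^{1/2}` as a unit of `k⟦ħ⟧`. -/
def qUnit (i : k) : (PowerSeries k)ˣ where
  val := qHalf i 1
  inv := qHalf i (-1)
  val_inv := by rw [qHalf_mul]; exact qHalf_zero i
  inv_val := by rw [qHalf_mul]; exact qHalf_zero i

/-- `q^{1/2}` as a unit of `R_I⟦ħ⟧`. -/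
def vI (i : k) (I : AddSemigroupIdeal P) : (RIh k I)ˣ :=
  Units.map (toRIh I).toMonoidHom (qUnit i)

/-- The ring `R_{σ,I}^ħ` of a two-dimensional cone: as `P_{φ_σ} = P ⊕ Λ_σ`, it is the quantum torus
over `R_I⟦ħ⟧`. The monomial `z^{φ_σ(m)}` is `QTorus.term m 1`, where `m ∈ Λ_σ` is written in the
basis of the primitive generators of the two rays of `σ`, in anticlockwise order. -/
abbrev RSigma (i : k) (I : AddSemigroupIdeal P) : Type _ := QTorus (RIh k I) (vI i I)

end Coefficients

/-! ### Quantum scattering diagrams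

The tropicalization has rays `ρ_j` with primitive generators `v_j` and two-dimensional cones `σ_j`,
spanned by `v_j` and `v_{j+1}`, for `j ∈ ℤ/r`, in anticlockwise order. The integral linear structure
is given across `ρ_j` by `v_{j-1} + v_{j+1} = - D_j v_j`. Tangent vectors and points in `σ_j` are
written in the basis `(v_j, v_{j+1})`. -/

/-- The integral points of the tropicalization: a point `a v_j + b v_{j+1}` of the cone `σ_j` is
recorded by its coefficients on all generators of rays. -/
def IntPoint (r : ℕ) : Type :=
  {x : ZMod r → ℕ // ∃ j, ∀ l, l ≠ j → l ≠ j + 1 → x l = 0}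

namespace IntPoint

variable {r : ℕ}

/-- `p` lies in the closed cone `σ_j`. -/
def InCone (p : IntPoint r) (j : ZMod r) : Prop := ∀ l, l ≠ j → l ≠ j + 1 → p.1 l = 0

/-- Coordinates of `p` in the cone `σ_j`. -/
def coords (p : IntPoint r) (j : ZMod r) : ℤ × ℤ := (p.1 j, p.1 (j + 1))

/-- `p` is the origin. -/
def IsOrigin (p : IntPoint r) : Prop := ∀ l, p.1 l = 0

end IntPoint

/-- The primitive generator of the ray of slope `s ≥ 0` in a cone. -/
def primGen (s : ℚ) : ℤ × ℤ := ((s.den : ℤ), s.num)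

/-- A ray `𝔡` of rational slope with a Hamiltonian. The support is the ray of slope `slope` in the
cone `σ_j`, `j = cone`; slope `0` is the ray `ρ_j`. The Hamiltonian is
`Ĥ = ∑_{l ≥ 1, u ∈ P} ħ⁻¹ (ham l u) z^{u ∓ φ(l m_𝔡)}`, with sign `-` if the ray is outgoing and `+`
if it is ingoing. -/
structure QuantumRay (k : Type*) [Field k] (P : Type*) (r : ℕ) where
  cone : ZMod r
  slope : ℚ
  slope_nonneg : 0 ≤ slope
  outgoing : Bool
  ham : ℕ → P → PowerSeries k
  ham_zero : ham 0 = 0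

section Scattering

variable {k : Type*} [Field k] [CharZero k] {P : Type*} [AddCommMonoid P] {r : ℕ}

namespace QuantumRay

/-- `Ĥ = 0` modulo `I`. -/
def IsZeroMod (d : QuantumRay k P r) (I : AddSemigroupIdeal P) : Prop :=
  ∀ l u, u ∉ I → d.ham l u = 0

/-- `(q^{-l} - 1)/ħ`. -/
def qDiff (i : k) (l : ℕ) : PowerSeries k :=
  PowerSeries.mk fun n => PowerSeries.coeff (n + 1) (qHalf i (-2 * (l : ℤ)))

/-- `∑_l (q^{-l} - 1) Ĥ_l` modulo `I`, as a power series in `Y = z^{∓φ(m_𝔡)}`. -/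
def logF (i : k) (d : QuantumRay k P r) (I : AddSemigroupIdeal P) : PowerSeries (RIh k I) :=
  PowerSeries.mk fun l => toRIh I (qDiff i l) *
    PowerSeries.mk fun n => ∑ᶠ u : P, Ideal.Quotient.mk (monomialIdeal k I)
      (AddMonoidAlgebra.single u (PowerSeries.coeff n (d.ham l u)))

/-- `f̂_𝔡 = exp (∑_l (q^{-l} - 1) Ĥ_l)` modulo `I`, as a power series in `Y = z^{∓φ(m_𝔡)}`. -/
def fHat (i : k) (d : QuantumRay k P r) (I : AddSemigroupIdeal P) : PowerSeries (RIh k I) :=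
  PowerSeries.mk fun l => ∑ n ∈ Finset.range (l + 1),
    algebraMap k (RIh k I) ((n.factorial : k)⁻¹) * PowerSeries.coeff l (d.logF i I ^ n)

end QuantumRay

/-- Quantum scattering diagrams for the tropicalization with `r` rays, the monoid `P`, the radical
ideal `J` and a multivalued piecewise linear function with kinks `κ_j` along `ρ_j`.
The field `complete` says that the homogeneous parts of Hamiltonians lie in the `J`-adic completion
(up to the factor `ħ⁻¹`), and `polynomial` that each `f̂_𝔡` modulo `I` is a polynomial in
`z^{∓φ(m_𝔡)}` over `R_I⟦ħ⟧`. -/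
structure QuantumScattering (i : k) (κ : ZMod r → P) (J : AddSemigroupIdeal P) where
  rays : Set (QuantumRay k P r)
  complete : ∀ d ∈ rays, ∀ I, IsRadicalOf J I → ∀ l n,
    {u | u ∉ I ∧ PowerSeries.coeff n (d.ham l u) ≠ 0}.Finite
  polynomial : ∀ d ∈ rays, ∀ I, IsRadicalOf J I →
    ∃ N, ∀ l > N, PowerSeries.coeff l (d.fHat i I) = 0
  zero_mod : ∀ d ∈ rays, (d.slope ≠ 0 ∨ κ d.cone ∉ J) → d.IsZeroMod J
  finite : ∀ I, IsRadicalOf J I → {d ∈ rays | ¬ d.IsZeroMod I}.Finite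

namespace QuantumScattering

variable {i : k} {κ : ZMod r → P} {J : AddSemigroupIdeal P}
  (S : QuantumScattering i κ J) (D : ZMod r → ℤ) (I : AddSemigroupIdeal P)

/-- The product of the `f̂_𝔡`, modulo `I`, over the outgoing (ingoing) rays `𝔡` with support of
slope `s` in `σ_j`. -/
def wallSeries (j : ZMod r) (s : ℚ) (out : Bool) : PowerSeries (RIh k I) :=
  ∏ᶠ d ∈ {d | d ∈ S.rays ∧ d.cone = j ∧ d.slope = s ∧ d.outgoing = out}, QuantumRay.fHat i d I

/-- The product over outgoing rays, as a Laurent polynomial in `X = z^{φ(m_𝔡)}`. -/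
def fOut (j : ZMod r) (s : ℚ) : (RIh k I)[T;T⁻¹] :=
  ∑ᶠ l : ℕ, AddMonoidAlgebra.single (-(l : ℤ)) (PowerSeries.coeff l (S.wallSeries I j s true))

/-- The product over ingoing rays, as a Laurent polynomial in `X = z^{φ(m_𝔡)}`. -/
def fIn (j : ZMod r) (s : ℚ) : (RIh k I)[T;T⁻¹] :=
  ∑ᶠ l : ℕ, AddMonoidAlgebra.single (l : ℤ) (PowerSeries.coeff l (S.wallSeries I j s false))

/-- The product of the functions `f̂_𝔡(q^t ẑ)` picked up by a monomial `z^m` with `⟨m_𝔡, m⟩ = n`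
when it crosses the rays of slope `s` in `σ_j`, as a Laurent polynomial in `X = z^{φ(m_𝔡)}`.
For outgoing rays `f̂(q^t ẑ)` is `f(q^t X)`, and for ingoing rays it is `f(q^{-t} X)`. -/
def crossing (j : ZMod r) (s : ℚ) (n : ℤ) : (RIh k I)[T;T⁻¹] :=
  if 0 ≤ n then
    (∏ t ∈ Finset.range n.natAbs, qScale (vI i I) (t : ℤ) (S.fOut I j s)) *
      ∏ t ∈ Finset.range n.natAbs, qScale (vI i I) ((t : ℤ) + 1) (S.fIn I j s)
  else
    (∏ t ∈ Finset.range n.natAbs, qScale (vI i I) (-(t : ℤ) - 1) (S.fOut I j s)) *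
      ∏ t ∈ Finset.range n.natAbs, qScale (vI i I) (-(t : ℤ)) (S.fIn I j s)

/-- `Θ` is the automorphism of `R_{σ_j,I}^ħ` attached to a path which crosses the rays of slope `s`
anticlockwise, i.e. the composition of `Φ_𝔡^{-1}` for outgoing and `Φ_𝔡` for ingoing rays, where
`Φ_𝔡` is the conjugation by `exp Ĥ_𝔡`. -/
def IsWallAut (j : ZMod r) (s : ℚ) (Θ : RSigma i I →ₐ[RIh k I] RSigma i I) : Prop :=
  ∀ m : ℤ × ℤ,
    (pairing (primGen s) m ≤ 0 →
      Θ (QTorus.term m 1) = QTorus.term m 1 *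
        QTorus.eval (primGen s) (S.crossing I j s (pairing (primGen s) m))) ∧
    (0 < pairing (primGen s) m →
      Θ (QTorus.term m 1) *
        QTorus.eval (primGen s) (S.crossing I j s (pairing (primGen s) m)) = QTorus.term m 1)

open Classical in
/-- The automorphism attached to crossing the rays of slope `s` in `σ_j` anticlockwise. -/
def wallAut (j : ZMod r) (s : ℚ) : RSigma i I →ₐ[RIh k I] RSigma i I :=
  if h : ∃ Θ, S.IsWallAut I j s Θ then h.choose else AlgHom.id _ _

/-- The slopes of the rays in the interior of `σ_j` that are nontrivial modulo `I`. -/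
def walls (j : ZMod r) : Set ℚ :=
  {s | 0 < s ∧ ∃ d ∈ S.rays, d.cone = j ∧ d.slope = s ∧ ¬ d.IsZeroMod I}

open Classical in
/-- The automorphism `θ_γ` of a path `γ` in the interior of `σ_j` that crosses, anticlockwise and
once each, the walls with slope in `A`; the walls are crossed in the order of their slopes. -/
def pathAut (j : ZMod r) (A : Set ℚ) : RSigma i I →ₐ[RIh k I] RSigma i I :=
  if h : (S.walls I j ∩ A).Finite then
    (h.toFinset.sort (· ≤ ·)).foldl (fun Θ s => (S.wallAut I j s).comp Θ) (AlgHom.id _ _)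
  else AlgHom.id _ _

/-- The algebra `R_{ρ_j,I}^ħ`. -/
abbrev RRho (j : ZMod r) : Type _ :=
  RayAlgebra (vI i I) (zP k I (κ j)) (D j) (S.fOut I j 0) (S.fIn I j 0)

/-- `ψ_{ρ_j,-} : R_{ρ_j,I}^ħ → R_{σ_{j-1},I}^ħ`. -/
def psiM (j : ZMod r) : S.RRho D I j →ₐ[RIh k I] RSigma i I :=
  psiMinus (vI i I) (zP k I (κ j)) (D j) (S.fOut I j 0) (S.fIn I j 0)

/-- `ψ_{ρ_j,+} : R_{ρ_j,I}^ħ → R_{σ_j,I}^ħ`. -/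
def psiP (j : ZMod r) : S.RRho D I j →ₐ[RIh k I] RSigma i I :=
  psiPlus (vI i I) (zP k I (κ j)) (D j) (S.fOut I j 0) (S.fIn I j 0)

/-- The algebra `A_I^ħ` of global sections of the sheaf obtained by gluing the sheaves attached to
the `R_{ρ_j,I}^ħ` along `R_{σ_j,I}^ħ` by means of the automorphisms `θ_{γ_{σ_j}}`. -/
def globalSections : Subalgebra (RIh k I) (∀ j, S.RRho D I j) where
  carrier := {a | ∀ j, S.pathAut I j Set.univ (S.psiP D I j (a j)) =
    S.psiM D I (j + 1) (a (j + 1))}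
  mul_mem' := by
    intro a b ha hb j
    simp only [Pi.mul_apply, map_mul, ha j, hb j]
  add_mem' := by
    intro a b ha hb j
    simp only [Pi.add_apply, map_add, ha j, hb j]
  algebraMap_mem' := by
    intro c j
    simp only [Pi.algebraMap_apply, AlgHom.commutes]

end QuantumScattering

/-! ### Quantum broken lines -/

/-- A monomial `coeff · z^{deg + φ_σ(dir)}` in a cone `σ`. -/
structure Mono (k : Type*) [Field k] (P : Type*) where
  dir : ℤ × ℤ
  deg : P
  coeff : PowerSeries k

/-- A piece of a quantum broken line: a segment in the closed cone `σ_j`, `j = cone`, with endpoint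
`endPt` and velocity `-dir`, where `dir` is the direction of the attached monomial. -/
structure Piece (k : Type*) [Field k] (P : Type*) (r : ℕ) where
  cone : ZMod r
  mono : Mono k P
  endPt : ℝ × ℝ

namespace Piece

/-- The point at which the piece is at time `t` before it reaches its endpoint. -/
def pos (A : Piece k P r) (t : ℝ) : ℝ × ℝ :=
  (A.endPt.1 + t * A.mono.dir.1, A.endPt.2 + t * A.mono.dir.2)

/-- The piece starts at the point `x`, and runs in the interior of its cone. -/
def StartsAt (A : Piece k P r) (x : ℝ × ℝ) : Prop :=
  ∃ τ : ℝ, 0 < τ ∧ A.pos τ = x ∧ ∀ t, 0 < t → t < τ → 0 < (A.pos t).1 ∧ 0 < (A.pos t).2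

/-- The unbounded piece of a broken line of charge `p`: it comes from infinity in a cone `σ`
that contains `p`, with the monomial `z^{φ_σ(p)}`. -/
def IsInitial (A : Piece k P r) (p : IntPoint r) : Prop :=
  p.InCone A.cone ∧ A.mono = ⟨p.coords A.cone, 0, 1⟩ ∧
    ∀ t, 0 < t → 0 < (A.pos t).1 ∧ 0 < (A.pos t).2

end Piece

namespace QuantumScattering

variable {i : k} {κ : ZMod r → P} {J : AddSemigroupIdeal P}
  (S : QuantumScattering i κ J) (D : ZMod r → ℤ) (I : AddSemigroupIdeal P)

/-- The monomial `B` is `A · (c z^s)`, where `c z^s`, `s = w + φ(a m_𝔡)` with `a ≠ 0`, is a term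
modulo `I` in the expansion of the product of functions for crossing the rays of slope `s` in the
cone `σ_j`. The vector `m` is `m_𝔡` in the coordinates used for `A` and `B`. -/
def Bends (j : ZMod r) (s : ℚ) (m : ℤ × ℤ) (A B : Mono k P) : Prop :=
  ∃ a : ℤ, ∃ w : P, ∃ c : PowerSeries k, a ≠ 0 ∧ w ∉ I ∧ c ≠ 0 ∧
    c = coeffRIh I w ((S.crossing I j s (pairing m A.dir)).coeff a) ∧
    B = ⟨A.dir + a • m, A.deg + w,
      A.coeff * c * ((qUnit i ^ pairing A.dir (a • m) : (PowerSeries k)ˣ) : PowerSeries k)⟩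

/-- The passage from a piece of a quantum broken line to the next one: a bend at a ray in the
interior of a cone, or a crossing, with or without a bend, of one of the rays of the fan. When a
monomial is carried across `ρ_l` in the direction `-dir`, the class `deg` changes by the kink of `φ`:
from `σ_{l-1}` to `σ_l`, one has `φ_{σ_{l-1}}(m) = φ_{σ_l}(m) - δ_l(m) κ_l`. -/
inductive Step (A B : Piece k P r) : Prop
  | interior (s : ℚ) (hs : 0 < s) (h1 : 0 < A.endPt.1) (h2 : A.endPt.2 = s * A.endPt.1)
      (hc : B.cone = A.cone) (hm : S.Bends I A.cone s (primGen s) A.mono B.mono)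
      (hB : B.StartsAt A.endPt)
  | anticlockwise (h1 : A.endPt.1 = 0) (h2 : 0 < A.endPt.2) (hc : B.cone = A.cone + 1)
      (M : Mono k P) (hM : M = A.mono ∨ S.Bends I (A.cone + 1) 0 (0, 1) A.mono M)
      (hdir : 0 < M.dir.1)
      (hm : B.mono = ⟨(M.dir.2 - D (A.cone + 1) * M.dir.1, -M.dir.1),
        M.deg + M.dir.1.toNat • κ (A.cone + 1), M.coeff⟩)
      (hB : B.StartsAt (A.endPt.2, 0))
  | clockwise (h1 : 0 < A.endPt.1) (h2 : A.endPt.2 = 0) (hc : B.cone = A.cone - 1)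
      (M : Mono k P) (hM : M = A.mono ∨ S.Bends I A.cone 0 (1, 0) A.mono M)
      (hdir : 0 < M.dir.2)
      (hm : B.mono = ⟨(-M.dir.2, M.dir.1 - D A.cone * M.dir.2),
        M.deg + M.dir.2.toNat • κ A.cone, M.coeff⟩)
      (hB : B.StartsAt (0, A.endPt.1))

/-- A quantum broken line (modulo `I`) of charge `p` with endpoint the point `z` in the interior of
`σ_j`, given by its successive pieces `init ++ [last]`. For `p = 0` the only one is the constant one
with monomial `1`. -/
structure BrokenLine (p : IntPoint r) (j : ZMod r) (z : ℝ × ℝ) where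
  init : List (Piece k P r)
  last : Piece k P r
  start : (p.IsOrigin ∧ init = [] ∧ last.mono = ⟨0, 0, 1⟩) ∨
    (¬ p.IsOrigin ∧ ∀ A ∈ (init ++ [last]).head?, A.IsInitial p)
  chain : (init ++ [last]).IsChain (S.Step D I)
  last_cone : last.cone = j
  last_endPt : last.endPt = z

namespace BrokenLine

variable {S D I} {p : IntPoint r} {j : ZMod r} {z : ℝ × ℝ}

/-- `s(γ)`, in the coordinates of the cone that contains the endpoint. -/
def s (γ : S.BrokenLine D I p j z) : ℤ × ℤ := γ.last.mono.dir

/-- `c(γ)`, as an element of `R_I⟦ħ⟧`; the final monomial of `γ` is `c(γ) z^{φ_σ(s(γ))}`. -/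
def c (γ : S.BrokenLine D I p j z) : RIh k I :=
  toRIh I γ.last.mono.coeff * zP k I γ.last.mono.deg

end BrokenLine

/-- `Lift_z(p)`, the sum of the final monomials of the broken lines of charge `p` with
endpoint `z`. -/
def lift (p : IntPoint r) (j : ZMod r) (z : ℝ × ℝ) : RSigma i I :=
  ∑ᶠ m : ℤ × ℤ, QTorus.term m (hSum fun γ : {γ : S.BrokenLine D I p j z // γ.s = m} => γ.1.c)

end QuantumScattering

/-- A point in the interior of a cone such that the line joining it to the origin has irrational
slope. -/
def IsGeneric (z : ℝ × ℝ) : Prop := 0 < z.1 ∧ 0 < z.2 ∧ Irrational (z.2 / z.1)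

namespace QuantumScattering

variable {i : k} {κ : ZMod r → P} {J : AddSemigroupIdeal P}
  (S : QuantumScattering i κ J) (D : ZMod r → ℤ) (I : AddSemigroupIdeal P)

/-- `z` is a generic point of `σ_j` in the chamber modulo `I` adjacent to `ρ_j`. -/
def NearFirst (j : ZMod r) (z : ℝ × ℝ) : Prop :=
  IsGeneric z ∧ ∀ s ∈ S.walls I j, z.2 < s * z.1

/-- `z` is a generic point of `σ_j` in the chamber modulo `I` adjacent to `ρ_{j+1}`. -/
def NearSecond (j : ZMod r) (z : ℝ × ℝ) : Prop :=
  IsGeneric z ∧ ∀ s ∈ S.walls I j, s * z.1 < z.2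

/-- Consistency of a quantum scattering diagram. -/
def IsConsistent : Prop :=
  ∀ I : AddSemigroupIdeal P, IsRadicalOf J I → ∀ p : IntPoint r, ¬ p.IsOrigin →
    (∀ j z z', IsGeneric z → IsGeneric z' → z.2 / z.1 ≤ z'.2 / z'.1 →
      S.lift D I p j z' =
        S.pathAut I j {s | z.2 / z.1 < (s : ℝ) ∧ (s : ℝ) < z'.2 / z'.1} (S.lift D I p j z)) ∧
    (∀ j z z', S.NearSecond I (j - 1) z → S.NearFirst I j z' →
      ∃ a : S.RRho D I j, S.psiM D I j a = S.lift D I p (j - 1) z ∧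
        S.psiP D I j a = S.lift D I p j z')

/-- `a` is the quantum theta function of `p`. It is `1` for `p = 0`; for `p ≠ 0` its restriction to
the chart of `ρ_j` is the element of `R_{ρ_j,I}^ħ` with images `Lift_z(p)` for generic `z` on the two
sides of `ρ_j`. -/
def IsTheta (p : IntPoint r) (a : S.globalSections D I) : Prop :=
  (p.IsOrigin ∧ a = 1) ∨ (¬ p.IsOrigin ∧ ∀ j,
    (∀ z, S.NearSecond I (j - 1) z → S.psiM D I j (a.1 j) = S.lift D I p (j - 1) z) ∧
    (∀ z, S.NearFirst I j z → S.psiP D I j (a.1 j) = S.lift D I p j z))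

end QuantumScattering

end Scattering

end QuantumTheta

end

/-! Everything is controlled by the filtration of R_I⟦ħ⟧ by powers of the ideal `adicIdeal k J I` of
series whose coefficients lie in the ideal of R_I spanned by the monomials of J. It is nilpotent:
k[P] is Noetherian, and every monomial of J has a power in I. Each step of a broken line costs one
factor in this ideal, because the functions on rays in the interior of a cone are 1 modulo J and a
crossing of ρ_j contributes a positive multiple of the kink κ_j ∈ J. So the number of pieces is
bounded. Modulo a power of ħ only finitely many bends are available at each step, and the lifts are
well-defined sums (`finite_coeff_c_ne_zero`, `finite_s`, `coeff_lift`).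

The algebra of ρ_j is spanned by the monomials X₊^b Xⁿ and X₋^b Xⁿ. Up to units, ψ₊ reads off the
coefficients of the former and ψ₋ those of the latter, so an element is determined by its two images
(`eq_zero_of_psi_eq_zero`). Hence the two lifts near each ρ_j determine at most one global section,
and consistency says that they do glue to one.

Theta functions span: on the n-th graded piece of the filtration the path automorphisms are the
identity, coefficients at exponents outside the cone vanish because they carry a factor κ, and the
coefficients in adjacent cones agree along the common ray. The leading part of a section is
therefore a finitely supported function on B(ℤ). As the lift of p is z^p modulo J in the cones
containing p, and 0 in the others, subtracting the corresponding combination of theta functions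
gains one order (`exists_approx`), and nilpotence ends the process (`exists_expansion`).

Coefficients are read off at a generic z near p. A broken line that ends at z with exponent p
arrives along z + t p, t ≥ 0. This half-line meets no wall on which a bend is possible and stays in
the open cone, so the broken line is straight and its charge is p (`exists_near`). Thus z^p has
coefficient 1 in the lift of p at z and 0 in every other lift. Restriction to the chamber of z is an
algebra homomorphism; comparing coefficients of z^p gives the uniqueness of the expansion and, after
multiplying out two lifts, the formula for the structure constants. -/

noncomputable section

namespace QuantumTheta

/-! ### Coefficients in quantum tori -/

namespace QTorus

variable {T : Type*} [CommRing T] {v : Tˣ}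

/-- The coefficient of `z^m` as a linear form. -/
def coeffL (m : ℤ × ℤ) : QTorus T v →ₗ[T] T := Finsupp.lapply m

theorem coeff_term (m n : ℤ × ℤ) (c : T) :
    coeff (term m c : QTorus T v) n = if m = n then c else 0 := by
  classical
  exact Finsupp.single_apply

@[simp] theorem coeff_add (x y : QTorus T v) (m : ℤ × ℤ) :
    coeff (x + y) m = coeff x m + coeff y m := map_add (coeffL m) x y

@[simp] theorem coeff_sub (x y : QTorus T v) (m : ℤ × ℤ) :
    coeff (x - y) m = coeff x m - coeff y m := map_sub (coeffL m) x y

@[simp] theorem coeff_zero (m : ℤ × ℤ) : coeff (0 : QTorus T v) m = 0 := rfl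

@[simp] theorem coeff_smul (c : T) (x : QTorus T v) (m : ℤ × ℤ) :
    coeff (c • x) m = c * coeff x m := map_smul (coeffL m) c x

theorem coeff_sum {ι : Type*} (s : Finset ι) (f : ι → QTorus T v) (m : ℤ × ℤ) :
    coeff (∑ a ∈ s, f a) m = ∑ a ∈ s, coeff (f a) m := map_sum (coeffL m) f s

theorem ext {x y : QTorus T v} (h : ∀ m, coeff x m = coeff y m) : x = y :=
  Finsupp.ext h

theorem finite_coeff_ne_zero (x : QTorus T v) : {m | coeff x m ≠ 0}.Finite :=
  Finsupp.hasFiniteSupport (show (ℤ × ℤ) →₀ T from x)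

theorem eq_sum_term (x : QTorus T v) (M : Finset (ℤ × ℤ)) (hM : ∀ m, m ∉ M → coeff x m = 0) :
    x = ∑ m ∈ M, coeff x m • term m 1 := by
  classical
  refine ext fun m => ?_
  rw [coeff_sum]
  simp only [coeff_smul, coeff_term, mul_ite, mul_one, mul_zero, Finset.sum_ite_eq']
  split_ifs with h
  · rfl
  · exact hM m h

theorem coeff_term_mul (a m : ℤ × ℤ) (c : T) (y : QTorus T v) :
    coeff (term a c * y) m = c * coeff y (m - a) * ((v ^ pairing a (m - a) : Tˣ) : T) := by
  induction y using induct with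
  | h0 => simp
  | ha y z hy hz => rw [mul_add, coeff_add, hy, hz, coeff_add]; ring
  | ht n d =>
    rw [term_mul_term, coeff_term, coeff_term]
    by_cases h : a + n = m
    · subst h
      simp
    · rw [if_neg h, if_neg (fun h' => h (by rw [h']; abel))]
      simp

/-- The set `M` may be larger than the support of `x`, so that the finite set of exponents of broken
lines can be used as index set. -/
theorem coeff_mul (x y : QTorus T v) (m : ℤ × ℤ) (M : Finset (ℤ × ℤ))
    (hM : ∀ m, m ∉ M → coeff x m = 0) :
    coeff (x * y) m =
      ∑ a ∈ M, coeff x a * coeff y (m - a) * ((v ^ pairing a (m - a) : Tˣ) : T) := by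
  conv_lhs => rw [eq_sum_term x M hM]
  rw [Finset.sum_mul, coeff_sum]
  refine Finset.sum_congr rfl fun a _ => ?_
  rw [smul_mul_assoc, coeff_smul, coeff_term_mul]
  ring

/-- The elements all of whose coefficients lie in the ideal `A` form `A • ⊤`. -/
theorem mem_smul_top {A : Ideal T} {x : QTorus T v} :
    x ∈ A • (⊤ : Submodule T (QTorus T v)) ↔ ∀ m, coeff x m ∈ A := by
  constructor
  · intro h m
    refine Submodule.smul_induction_on h ?_ ?_
    · intro c hc y _
      rw [coeff_smul]
      exact A.mul_mem_right _ hc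
    · intro y z hy hz
      rw [coeff_add]
      exact A.add_mem hy hz
  · intro h
    rw [eq_sum_term x (finite_coeff_ne_zero x).toFinset (by simp)]
    exact Submodule.sum_mem _ fun m _ =>
      Submodule.smul_mem_smul (h m) Submodule.mem_top

theorem mul_mem_smul_top_left {A : Ideal T} (x : QTorus T v) {y : QTorus T v}
    (h : y ∈ A • (⊤ : Submodule T (QTorus T v))) :
    x * y ∈ A • (⊤ : Submodule T (QTorus T v)) := by
  refine Submodule.smul_induction_on h ?_ ?_
  · intro c hc y _
    rw [mul_smul_comm]
    exact Submodule.smul_mem_smul hc Submodule.mem_top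
  · intro y z hy hz
    rw [mul_add]
    exact Submodule.add_mem _ hy hz

theorem mul_mem_smul_top_right {A : Ideal T} {x : QTorus T v} (y : QTorus T v)
    (h : x ∈ A • (⊤ : Submodule T (QTorus T v))) :
    x * y ∈ A • (⊤ : Submodule T (QTorus T v)) := by
  refine Submodule.smul_induction_on h ?_ ?_
  · intro c hc x _
    rw [smul_mul_assoc]
    exact Submodule.smul_mem_smul hc Submodule.mem_top
  · intro y z hy hz
    rw [add_mul]
    exact Submodule.add_mem _ hy hz

theorem eval_one (m : ℤ × ℤ) : (eval m 1 : QTorus T v) = 1 := by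
  rw [AddMonoidAlgebra.one_def, eval_single, zero_smul]
  rfl

theorem eval_sub (m : ℤ × ℤ) (g h : T[T;T⁻¹]) :
    (eval m (g - h) : QTorus T v) = eval m g - eval m h := by
  rw [eq_sub_iff_add_eq, ← eval_add, sub_add_cancel]

theorem eval_mem_smul_top {A : Ideal T} (m : ℤ × ℤ) (g : T[T;T⁻¹])
    (hg : ∀ a, g.coeff a ∈ A) :
    (eval m g : QTorus T v) ∈ A • (⊤ : Submodule T (QTorus T v)) := by
  unfold eval
  refine Submodule.sum_mem _ fun a _ => ?_
  rw [mem_smul_top]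
  intro n
  rw [coeff_term]
  split_ifs
  · exact hg a
  · exact A.zero_mem

/-- `x` is homogeneous of degree `b` for the grading `l` of the exponents. -/
def IsHomog (l : ℤ × ℤ →+ ℤ) (b : ℤ) (x : QTorus T v) : Prop :=
  ∀ m, l m ≠ b → coeff x m = 0

namespace IsHomog

variable {l : ℤ × ℤ →+ ℤ}

theorem mul {a b : ℤ} {x y : QTorus T v} (hx : IsHomog l a x) (hy : IsHomog l b y) :
    IsHomog l (a + b) (x * y) := by
  intro m hm
  rw [coeff_mul x y m (finite_coeff_ne_zero x).toFinset (by simp)]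
  refine Finset.sum_eq_zero fun n _ => ?_
  by_cases h : l n = a
  · rw [hy (m - n), mul_zero, zero_mul]
    rw [map_sub, h]
    omega
  · rw [hx n h, zero_mul, zero_mul]

theorem term (m : ℤ × ℤ) (c : T) : IsHomog l (l m) (term m c : QTorus T v) := by
  intro n hn
  rw [coeff_term, if_neg]
  rintro rfl
  exact hn rfl

theorem one : IsHomog l 0 (1 : QTorus T v) := by
  have := IsHomog.term (T := T) (v := v) (l := l) 0 1
  rwa [map_zero] at this

theorem pow {a : ℤ} {x : QTorus T v} (hx : IsHomog l a x) (n : ℕ) :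
    IsHomog l (n * a) (x ^ n) := by
  induction n with
  | zero => simpa using one
  | succ n ih =>
    rw [pow_succ]
    convert ih.mul hx using 1
    push_cast
    ring

theorem eval (m : ℤ × ℤ) (hm : l m = 0) (g : T[T;T⁻¹]) :
    IsHomog l 0 (eval m g : QTorus T v) := by
  intro n hn
  unfold QTorus.eval
  rw [Finsupp.sum, coeff_sum]
  refine Finset.sum_eq_zero fun a _ => ?_
  rw [coeff_term, if_neg]
  rintro rfl
  rw [map_zsmul, hm, smul_zero] at hn
  exact hn rfl

end IsHomog

theorem term_pow (m : ℤ × ℤ) (n : ℕ) :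
    (term m 1 : QTorus T v) ^ n = term ((n : ℤ) • m) 1 := by
  induction n with
  | zero => simp; rfl
  | succ n ih =>
    rw [pow_succ, ih, term_mul_term]
    have : pairing ((n : ℤ) • m) m = 0 := by simp [pairing]; ring
    rw [this]
    simp [add_smul]

end QTorus

/-! ### A normal form in the algebra of a ray -/

section RayAlgebra

variable {T : Type*} [CommRing T] {v : Tˣ} {κ : T} {D : ℤ} {fo fi : T[T;T⁻¹]}

variable (v κ D fo fi) in
/-- The image of a generator in the algebra of a ray. -/
def rayGen (x : RayGen) : RayAlgebra v κ D fo fi :=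
  RingQuot.mkAlgHom T _ (FreeAlgebra.ι T x)

theorem rayRel_eq {x y : FreeAlgebra T RayGen} (h : RayRel v κ D fo fi x y) :
    RingQuot.mkAlgHom T (RayRel v κ D fo fi) x = RingQuot.mkAlgHom T (RayRel v κ D fo fi) y :=
  RingQuot.mkAlgHom_rel T h

theorem psiMinus_rayGen (x : RayGen) :
    psiMinus v κ D fo fi (rayGen v κ D fo fi x) = psiMinusGen v κ D fo fi x := by
  simp [psiMinus, rayGen]

theorem psiPlus_rayGen (x : RayGen) :
    psiPlus v κ D fo fi (rayGen v κ D fo fi x) = psiPlusGen v κ D fo fi x := by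
  simp [psiPlus, rayGen]

variable (v κ D fo fi) in
/-- The invertible generator `X`. -/
def rayX : (RayAlgebra v κ D fo fi)ˣ where
  val := rayGen v κ D fo fi .X
  inv := rayGen v κ D fo fi .Xinv
  val_inv := by
    have := rayRel_eq (RayRel.inv_right (v := v) (κ := κ) (D := D) (fo := fo) (fi := fi))
    rwa [map_mul, map_one] at this
  inv_val := by
    have := rayRel_eq (RayRel.inv_left (v := v) (κ := κ) (D := D) (fo := fo) (fi := fi))
    rwa [map_mul, map_one] at this

variable (v κ D fo fi) in
/-- The monomials `X₊^b X^n`, `b ≥ 0`, and `X₋^{-b} X^n`, `b < 0`. -/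
def rayMonomial (m : ℤ × ℤ) : RayAlgebra v κ D fo fi :=
  (if 0 ≤ m.2 then rayGen v κ D fo fi .Xp ^ m.2.toNat
    else rayGen v κ D fo fi .Xm ^ (-m.2).toNat) * ((rayX v κ D fo fi ^ m.1 : _ˣ) : RayAlgebra v κ D fo fi)

/-- If `x y = w y x` with a unit `w` of the centre, then `x y^n = w^n y^n x`. -/
theorem mul_pow_of_mul_eq_smul {A : Type*} [Ring A] [Algebra T A] {x y : A} {w : Tˣ}
    (h : x * y = (w : T) • (y * x)) (n : ℕ) :
    x * y ^ n = ((w ^ n : Tˣ) : T) • (y ^ n * x) := by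
  induction n with
  | zero => simp
  | succ n ih =>
    rw [pow_succ, ← mul_assoc, ih, smul_mul_assoc, mul_assoc, h, mul_smul_comm, smul_smul,
      ← mul_assoc, ← pow_succ, pow_succ w, Units.val_mul]

theorem inv_mul_of_mul_eq_smul {A : Type*} [Ring A] [Algebra T A] (x : Aˣ) {y : A} {w : Tˣ}
    (h : (x : A) * y = (w : T) • (y * x)) :
    (↑x⁻¹ : A) * y = ((w⁻¹ : Tˣ) : T) • (y * ↑x⁻¹) := by
  have h1 : (y * (x : A)) = ((w⁻¹ : Tˣ) : T) • ((x : A) * y) := by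
    rw [h, smul_smul]; simp
  calc (↑x⁻¹ : A) * y = ↑x⁻¹ * (y * x) * ↑x⁻¹ := by simp [mul_assoc]
    _ = _ := by rw [h1, mul_smul_comm, smul_mul_assoc]; simp

variable (v κ D fo fi) in
/-- The span of the monomials. -/
def raySpan : Submodule T (RayAlgebra v κ D fo fi) :=
  Submodule.span T (Set.range (rayMonomial v κ D fo fi))

theorem rayMonomial_natCast (n : ℤ) (b : ℕ) :
    rayMonomial v κ D fo fi (n, b) =
      rayGen v κ D fo fi .Xp ^ b * ((rayX v κ D fo fi ^ n : _ˣ) : RayAlgebra v κ D fo fi) := by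
  simp [rayMonomial]

theorem rayMonomial_neg_natCast (n : ℤ) (b : ℕ) :
    rayMonomial v κ D fo fi (n, -b) =
      rayGen v κ D fo fi .Xm ^ b * ((rayX v κ D fo fi ^ n : _ˣ) : RayAlgebra v κ D fo fi) := by
  rcases Nat.eq_zero_or_pos b with rfl | hb
  · simp [rayMonomial]
  · simp only [rayMonomial]
    rw [if_neg (by omega)]
    simp

theorem rayMonomial_mem (m : ℤ × ℤ) : rayMonomial v κ D fo fi m ∈ raySpan v κ D fo fi :=
  Submodule.subset_span ⟨m, rfl⟩

variable (v κ D fo fi) in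
/-- The elements that map the span of the monomials to itself. -/
def raySpanStabilizer : Subalgebra T (RayAlgebra v κ D fo fi) where
  carrier := {x | ∀ w ∈ raySpan v κ D fo fi, x * w ∈ raySpan v κ D fo fi}
  mul_mem' := by
    intro x y hx hy w hw
    rw [mul_assoc]
    exact hx _ (hy _ hw)
  add_mem' := by
    intro x y hx hy w hw
    rw [add_mul]
    exact Submodule.add_mem _ (hx _ hw) (hy _ hw)
  algebraMap_mem' := by
    intro c w hw
    rw [← Algebra.smul_def]
    exact Submodule.smul_mem _ c hw

theorem mem_raySpanStabilizer {x : RayAlgebra v κ D fo fi}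
    (hp : ∀ (n : ℤ) (b : ℕ), x * rayMonomial v κ D fo fi (n, b) ∈ raySpan v κ D fo fi)
    (hm : ∀ (n : ℤ) (b : ℕ), x * rayMonomial v κ D fo fi (n, -b) ∈ raySpan v κ D fo fi) :
    x ∈ raySpanStabilizer v κ D fo fi := by
  have : raySpan v κ D fo fi ≤ (raySpan v κ D fo fi).comap (LinearMap.mulLeft T x) := by
    refine Submodule.span_le.2 ?_
    rintro _ ⟨⟨n, b⟩, rfl⟩
    rcases Int.eq_nat_or_neg b with ⟨k, rfl | rfl⟩
    · exact hp n k
    · exact hm n k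
  exact fun w hw => this hw

/-- A power of X commutes with X₊ and X₋ up to a unit, so it can be moved past X₊^b or X₋^b and
absorbed in Xⁿ. The cases e = 1 and e = -1 are used. -/
theorem unit_mem_raySpanStabilizer {x : (RayAlgebra v κ D fo fi)ˣ} {e : ℤ} {wp wm : Tˣ}
    (hx : x = rayX v κ D fo fi ^ e)
    (hp : x * rayGen v κ D fo fi .Xp = (wp : T) • (rayGen v κ D fo fi .Xp * x))
    (hm : x * rayGen v κ D fo fi .Xm = (wm : T) • (rayGen v κ D fo fi .Xm * x)) :
    (x : RayAlgebra v κ D fo fi) ∈ raySpanStabilizer v κ D fo fi := by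
  refine mem_raySpanStabilizer (fun n b => ?_) fun n b => ?_
  · rw [rayMonomial_natCast, ← mul_assoc, mul_pow_of_mul_eq_smul hp, smul_mul_assoc, mul_assoc,
      ← Units.val_mul, hx, ← zpow_add, ← rayMonomial_natCast]
    exact Submodule.smul_mem _ _ (rayMonomial_mem _)
  · rw [rayMonomial_neg_natCast, ← mul_assoc, mul_pow_of_mul_eq_smul hm, smul_mul_assoc,
      mul_assoc, ← Units.val_mul, hx, ← zpow_add, ← rayMonomial_neg_natCast]
    exact Submodule.smul_mem _ _ (rayMonomial_mem _)

theorem rayX_mul_rayGen_Xp : (rayX v κ D fo fi : RayAlgebra v κ D fo fi) *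
    rayGen v κ D fo fi .Xp = ((v ^ (2 : ℤ) : Tˣ) : T) •
      (rayGen v κ D fo fi .Xp * rayX v κ D fo fi) := by
  have := rayRel_eq (RayRel.comm_plus (v := v) (κ := κ) (D := D) (fo := fo) (fi := fi))
  rwa [map_mul, map_smul, map_mul] at this

theorem rayX_mul_rayGen_Xm : (rayX v κ D fo fi : RayAlgebra v κ D fo fi) *
    rayGen v κ D fo fi .Xm = ((v ^ (-2 : ℤ) : Tˣ) : T) •
      (rayGen v κ D fo fi .Xm * rayX v κ D fo fi) := by
  have := rayRel_eq (RayRel.comm_minus (v := v) (κ := κ) (D := D) (fo := fo) (fi := fi))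
  rwa [map_mul, map_smul, map_mul] at this

theorem laurentAt_mem {A : Type*} [Ring A] [Algebra T A] (B : Subalgebra T A) {x y : A}
    (hx : x ∈ B) (hy : y ∈ B) (g : T[T;T⁻¹]) : laurentAt x y g ∈ B := by
  unfold laurentAt
  refine Subalgebra.sum_mem _ fun a _ => B.smul_mem ?_ _
  split_ifs
  · exact B.pow_mem hx _
  · exact B.pow_mem hy _

theorem map_laurentAt {A B : Type*} [Ring A] [Algebra T A] [Ring B] [Algebra T B] (f : A →ₐ[T] B)
    (x y : A) (g : T[T;T⁻¹]) : f (laurentAt x y g) = laurentAt (f x) (f y) g := by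
  unfold laurentAt
  rw [Finsupp.sum, map_sum, Finsupp.sum]
  refine Finset.sum_congr rfl fun a _ => ?_
  rw [map_smul]
  split_ifs <;> rw [map_pow]

theorem rayX_mem : (rayX v κ D fo fi : RayAlgebra v κ D fo fi) ∈
    raySpanStabilizer v κ D fo fi :=
  unit_mem_raySpanStabilizer (e := 1) (zpow_one _).symm rayX_mul_rayGen_Xp rayX_mul_rayGen_Xm

theorem rayX_inv_mem : (↑(rayX v κ D fo fi)⁻¹ : RayAlgebra v κ D fo fi) ∈
    raySpanStabilizer v κ D fo fi :=
  unit_mem_raySpanStabilizer (e := -1) (zpow_neg_one _).symm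
    (inv_mul_of_mul_eq_smul _ rayX_mul_rayGen_Xp) (inv_mul_of_mul_eq_smul _ rayX_mul_rayGen_Xm)

/-- X₊ raises the exponent of X₊^b Xⁿ. In X₊ · X₋^(b+1) Xⁿ the product X₊X₋ is a Laurent polynomial
in X by the defining relation, and such polynomials already stabilize the span. X₋ is treated in the
same way. -/
theorem rayGen_mem (x : RayGen) : rayGen v κ D fo fi x ∈ raySpanStabilizer v κ D fo fi := by
  cases x with
  | X => exact rayX_mem
  | Xinv => exact rayX_inv_mem
  | Xp =>
    refine mem_raySpanStabilizer (fun n b => ?_) fun n b => ?_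
    · rw [rayMonomial_natCast, ← mul_assoc, ← pow_succ', ← rayMonomial_natCast]
      exact rayMonomial_mem _
    · rcases b with _ | b
      · rw [rayMonomial_neg_natCast, pow_zero, one_mul]
        have := rayMonomial_mem (v := v) (κ := κ) (D := D) (fo := fo) (fi := fi) (n, (1 : ℕ))
        rwa [rayMonomial_natCast, pow_one] at this
      · rw [rayMonomial_neg_natCast, pow_succ', mul_assoc, ← mul_assoc,
          ← rayMonomial_neg_natCast]
        have := rayRel_eq (RayRel.plus_minus (v := v) (κ := κ) (D := D) (fo := fo) (fi := fi))
        rw [map_mul, map_smul, map_laurentAt] at this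
        refine (?_ : _ ∈ raySpanStabilizer v κ D fo fi) _ (rayMonomial_mem _)
        refine this ▸ Subalgebra.smul_mem _ (laurentAt_mem _ rayX_mem rayX_inv_mem _) _
  | Xm =>
    refine mem_raySpanStabilizer (fun n b => ?_) fun n b => ?_
    · rcases b with _ | b
      · rw [rayMonomial_natCast, pow_zero, one_mul]
        have := rayMonomial_mem (v := v) (κ := κ) (D := D) (fo := fo) (fi := fi) (n, -(1 : ℕ))
        rwa [rayMonomial_neg_natCast, pow_one] at this
      · rw [rayMonomial_natCast, pow_succ', mul_assoc, ← mul_assoc, ← rayMonomial_natCast]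
        have := rayRel_eq (RayRel.minus_plus (v := v) (κ := κ) (D := D) (fo := fo) (fi := fi))
        rw [map_mul, map_smul, map_laurentAt] at this
        refine (?_ : _ ∈ raySpanStabilizer v κ D fo fi) _ (rayMonomial_mem _)
        refine this ▸ Subalgebra.smul_mem _ (laurentAt_mem _ rayX_mem rayX_inv_mem _) _
    · rw [rayMonomial_neg_natCast, ← mul_assoc, ← pow_succ', ← rayMonomial_neg_natCast]
      exact rayMonomial_mem _

/-- The stabilizer is a subalgebra containing the generators, hence is everything; apply it to 1,
which is the monomial of exponent (0, 0). -/
theorem raySpan_eq_top : raySpan v κ D fo fi = ⊤ := by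
  rw [eq_top_iff]
  rintro a -
  obtain ⟨x, rfl⟩ := RingQuot.mkAlgHom_surjective T (RayRel v κ D fo fi) a
  have h : RingQuot.mkAlgHom T (RayRel v κ D fo fi) x ∈ raySpanStabilizer v κ D fo fi := by
    induction x using FreeAlgebra.induction with
    | grade0 c => rw [AlgHom.commutes]; exact Subalgebra.algebraMap_mem _ c
    | grade1 g => exact rayGen_mem g
    | mul x y hx hy => rw [map_mul]; exact Subalgebra.mul_mem _ hx hy
    | add x y hx hy => rw [map_add]; exact Subalgebra.add_mem _ hx hy
  have h1 := h _ (rayMonomial_mem (0, (0 : ℕ)))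
  rwa [rayMonomial_natCast, pow_zero, zpow_zero, Units.val_one, mul_one, mul_one] at h1

theorem exists_rayMonomial_sum (a : RayAlgebra v κ D fo fi) :
    ∃ α : ℤ × ℤ →₀ T, a = ∑ m ∈ α.support, α m • rayMonomial v κ D fo fi m := by
  have h : a ∈ raySpan v κ D fo fi := by
    rw [raySpan_eq_top]
    exact Submodule.mem_top
  obtain ⟨α, hα⟩ := Finsupp.mem_span_range_iff_exists_finsupp.1 h
  exact ⟨α, hα.symm⟩

/-! ### The images of the monomials in the two quantum tori -/

theorem map_rayX_zpow (f : RayAlgebra v κ D fo fi →ₐ[T] QTorus T v) (m : ℤ × ℤ)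
    (h : f (rayGen v κ D fo fi .X) = QTorus.term m 1)
    (h' : f (rayGen v κ D fo fi .Xinv) = QTorus.term (-m) 1) (n : ℤ) :
    f ((rayX v κ D fo fi ^ n : _ˣ) : RayAlgebra v κ D fo fi) = QTorus.term (n • m) 1 := by
  rcases Int.eq_nat_or_neg n with ⟨k, rfl | rfl⟩
  · rw [zpow_natCast, Units.val_pow_eq_pow_val, map_pow]
    exact (congrArg (· ^ k) h).trans (QTorus.term_pow _ _)
  · rw [zpow_neg, zpow_natCast, ← inv_pow, Units.val_pow_eq_pow_val, map_pow]
    refine (congrArg (· ^ k) h').trans ((QTorus.term_pow _ _).trans ?_)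
    rw [smul_neg, neg_smul]

/-- On the half b ≥ 0 the map ψ₊ sends monomials to unit multiples of monomials; ψ₋ does so on the
half b ≤ 0. Together they replace a linear independence argument in the presented algebra. -/
theorem psiPlus_rayMonomial_natCast (n : ℤ) (b : ℕ) :
    psiPlus v κ D fo fi (rayMonomial v κ D fo fi (n, b)) =
      QTorus.term (n, (b : ℤ)) ((v ^ (-(n * b)) : Tˣ) : T) := by
  rw [rayMonomial_natCast, map_mul, map_pow, psiPlus_rayGen,
    map_rayX_zpow _ (1, 0) (psiPlus_rayGen _) (psiPlus_rayGen _)]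
  simp only [psiPlusGen]
  rw [QTorus.term_pow, QTorus.term_mul_term]
  simp [pairing]

theorem psiMinus_rayMonomial_neg_natCast (n : ℤ) (b : ℕ) :
    psiMinus v κ D fo fi (rayMonomial v κ D fo fi (n, -b)) =
      QTorus.term ((b : ℤ), n) ((v ^ (b * n) : Tˣ) : T) := by
  rw [rayMonomial_neg_natCast, map_mul, map_pow, psiMinus_rayGen,
    map_rayX_zpow _ (0, 1) (psiMinus_rayGen _) (psiMinus_rayGen _)]
  simp only [psiMinusGen]
  rw [QTorus.term_pow, QTorus.term_mul_term]
  simp [pairing]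

/-- The functions of X have degree 0 in the direction transverse to ρ, so the grading by the
exponent of X₊, with X₋ in degree -1, survives under ψ₊. Monomials with different b thus cannot
interfere. -/
theorem psiPlus_rayMonomial_isHomog (m : ℤ × ℤ) :
    QTorus.IsHomog (AddMonoidHom.snd ℤ ℤ) m.2
      (psiPlus v κ D fo fi (rayMonomial v κ D fo fi m)) := by
  obtain ⟨n, b⟩ := m
  rcases Int.eq_nat_or_neg b with ⟨k, rfl | rfl⟩
  · rw [psiPlus_rayMonomial_natCast]
    exact QTorus.IsHomog.term (n, (k : ℤ)) _
  · rw [rayMonomial_neg_natCast, map_mul, map_pow, psiPlus_rayGen,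
      map_rayX_zpow _ (1, 0) (psiPlus_rayGen _) (psiPlus_rayGen _)]
    simp only [psiPlusGen]
    convert ((((QTorus.IsHomog.eval _ ?_ _).mul (QTorus.IsHomog.term _ _)).mul
      (QTorus.IsHomog.eval _ ?_ _)).pow k).mul (QTorus.IsHomog.term _ _) using 1 <;> simp

theorem psiMinus_rayMonomial_isHomog (m : ℤ × ℤ) :
    QTorus.IsHomog (AddMonoidHom.fst ℤ ℤ) (-m.2)
      (psiMinus v κ D fo fi (rayMonomial v κ D fo fi m)) := by
  obtain ⟨n, b⟩ := m
  rcases Int.eq_nat_or_neg b with ⟨k, rfl | rfl⟩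
  · rw [rayMonomial_natCast, map_mul, map_pow, psiMinus_rayGen,
      map_rayX_zpow _ (0, 1) (psiMinus_rayGen _) (psiMinus_rayGen _)]
    simp only [psiMinusGen]
    convert ((((QTorus.IsHomog.eval _ ?_ _).mul (QTorus.IsHomog.term _ _)).mul
      (QTorus.IsHomog.eval _ ?_ _)).pow k).mul (QTorus.IsHomog.term _ _) using 1 <;> simp
  · rw [psiMinus_rayMonomial_neg_natCast]
    convert QTorus.IsHomog.term ((k : ℤ), n) _ using 1
    simp

theorem term_mem_smul_top {B : Ideal T} (m : ℤ × ℤ) {c : T} (hc : c ∈ B) :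
    (QTorus.term m c : QTorus T v) ∈ B • (⊤ : Submodule T (QTorus T v)) := by
  rw [QTorus.mem_smul_top]
  intro n
  rw [QTorus.coeff_term]
  split_ifs
  · exact hc
  · exact B.zero_mem

/-- For b < 0 at least one factor ψ₊(X₋) is present, and it contains κ. -/
theorem psiPlus_rayMonomial_mem {B : Ideal T} (hκ : κ ∈ B) {m : ℤ × ℤ} (hm : m.2 < 0) :
    psiPlus v κ D fo fi (rayMonomial v κ D fo fi m) ∈
      B • (⊤ : Submodule T (QTorus T v)) := by
  obtain ⟨n, b⟩ := m
  obtain ⟨k, rfl⟩ : ∃ k : ℕ, b = -((k + 1 : ℕ) : ℤ) := ⟨(-b - 1).toNat, by grind⟩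
  rw [rayMonomial_neg_natCast, map_mul, map_pow, psiPlus_rayGen, pow_succ]
  refine QTorus.mul_mem_smul_top_right _ (QTorus.mul_mem_smul_top_left _ ?_)
  exact QTorus.mul_mem_smul_top_right _ (QTorus.mul_mem_smul_top_left _ (term_mem_smul_top _ hκ))

theorem psiMinus_rayMonomial_mem {B : Ideal T} (hκ : κ ∈ B) {m : ℤ × ℤ} (hm : 0 < m.2) :
    psiMinus v κ D fo fi (rayMonomial v κ D fo fi m) ∈
      B • (⊤ : Submodule T (QTorus T v)) := by
  obtain ⟨n, b⟩ := m
  obtain ⟨k, rfl⟩ : ∃ k : ℕ, b = ((k + 1 : ℕ) : ℤ) := ⟨(b - 1).toNat, by grind⟩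
  rw [rayMonomial_natCast, map_mul, map_pow, psiMinus_rayGen, pow_succ]
  refine QTorus.mul_mem_smul_top_right _ (QTorus.mul_mem_smul_top_left _ ?_)
  exact QTorus.mul_mem_smul_top_right _ (QTorus.mul_mem_smul_top_left _ (term_mem_smul_top _ hκ))

/-! ### Recovering the coefficients of a combination of monomials from its two images -/

section Coefficients

variable (α : ℤ × ℤ →₀ T)

/-- Terms with another transverse degree do not reach (n, b) by homogeneity; those of degree b are
single monomials. -/
theorem coeff_psiPlus_sum (n : ℤ) (b : ℕ) :
    QTorus.coeff (psiPlus v κ D fo fi (∑ m ∈ α.support, α m • rayMonomial v κ D fo fi m))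
      (n, (b : ℤ)) = α (n, (b : ℤ)) * ((v ^ (-(n * b)) : Tˣ) : T) := by
  classical
  rw [map_sum, QTorus.coeff_sum, Finset.sum_eq_single (n, (b : ℤ))]
  · rw [map_smul, QTorus.coeff_smul, psiPlus_rayMonomial_natCast, QTorus.coeff_term, if_pos rfl]
  · rintro ⟨n', b'⟩ _ h
    rw [map_smul, QTorus.coeff_smul]
    by_cases hb : b' = b
    · subst hb
      rw [psiPlus_rayMonomial_natCast, QTorus.coeff_term, if_neg h, mul_zero]
    · rw [psiPlus_rayMonomial_isHomog _ _ (fun h' => hb h'.symm), mul_zero]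
  · intro h
    rw [Finsupp.notMem_support_iff.1 h, zero_smul, map_zero, QTorus.coeff_zero]

theorem coeff_psiMinus_sum (n : ℤ) (b : ℕ) :
    QTorus.coeff (psiMinus v κ D fo fi (∑ m ∈ α.support, α m • rayMonomial v κ D fo fi m))
      ((b : ℤ), n) = α (n, -(b : ℤ)) * ((v ^ (b * n) : Tˣ) : T) := by
  classical
  rw [map_sum, QTorus.coeff_sum, Finset.sum_eq_single (n, -(b : ℤ))]
  · rw [map_smul, QTorus.coeff_smul, psiMinus_rayMonomial_neg_natCast, QTorus.coeff_term,
      if_pos rfl]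
  · rintro ⟨n', b'⟩ _ h
    rw [map_smul, QTorus.coeff_smul]
    by_cases hb : b' = -b
    · subst hb
      rw [psiMinus_rayMonomial_neg_natCast, QTorus.coeff_term, if_neg, mul_zero]
      intro h'
      simp only [Prod.mk.injEq] at h'
      exact h (by rw [h'.2])
    · rw [psiMinus_rayMonomial_isHomog _ _ (fun h' => hb ?_), mul_zero]
      simp only [AddMonoidHom.coe_fst] at h'
      omega
  · intro h
    rw [Finsupp.notMem_support_iff.1 h, zero_smul, map_zero, QTorus.coeff_zero]

-- The nonnegative half of the coefficients is visible through ψ₊ and the nonpositive half through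
-- ψ₋, in both cases up to units.
variable {α} in
theorem coeff_mem_of_psi_mem {A : Ideal T}
    (hp : psiPlus v κ D fo fi (∑ m ∈ α.support, α m • rayMonomial v κ D fo fi m) ∈
      A • (⊤ : Submodule T (QTorus T v)))
    (hm : psiMinus v κ D fo fi (∑ m ∈ α.support, α m • rayMonomial v κ D fo fi m) ∈
      A • (⊤ : Submodule T (QTorus T v))) (m : ℤ × ℤ) : α m ∈ A := by
  obtain ⟨n, b⟩ := m
  rw [QTorus.mem_smul_top] at hp hm
  rcases Int.eq_nat_or_neg b with ⟨k, rfl | rfl⟩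
  · have := hp (n, (k : ℤ))
    rw [coeff_psiPlus_sum] at this
    exact (A.mul_unit_mem_iff_mem (Units.isUnit _)).1 this
  · have := hm ((k : ℤ), n)
    rw [coeff_psiMinus_sum] at this
    exact (A.mul_unit_mem_iff_mem (Units.isUnit _)).1 this

end Coefficients

/-- An element of the algebra of a ray is determined by its images in the two quantum tori. -/
theorem eq_zero_of_psi_eq_zero {a : RayAlgebra v κ D fo fi} (hp : psiPlus v κ D fo fi a = 0)
    (hm : psiMinus v κ D fo fi a = 0) : a = 0 := by
  obtain ⟨α, rfl⟩ := exists_rayMonomial_sum a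
  refine Finset.sum_eq_zero fun m _ => ?_
  have : α m ∈ (⊥ : Ideal T) := coeff_mem_of_psi_mem (by rw [hp]; exact Submodule.zero_mem _)
    (by rw [hm]; exact Submodule.zero_mem _) m
  rw [Ideal.mem_bot.1 this, zero_smul]

/-- Both sides are the coefficient of Xⁿ. This matches the functions on two adjacent cones along
their common ray. -/
theorem coeff_psiPlus_eq_coeff_psiMinus (a : RayAlgebra v κ D fo fi) (n : ℤ) :
    QTorus.coeff (psiPlus v κ D fo fi a) (n, 0) = QTorus.coeff (psiMinus v κ D fo fi a) (0, n) := by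
  obtain ⟨α, rfl⟩ := exists_rayMonomial_sum a
  have h1 := coeff_psiPlus_sum (v := v) (κ := κ) (D := D) (fo := fo) (fi := fi) α n 0
  have h2 := coeff_psiMinus_sum (v := v) (κ := κ) (D := D) (fo := fo) (fi := fi) α n 0
  simp only [Nat.cast_zero, neg_zero, mul_zero, zero_mul] at h1 h2
  rw [h1, h2]

/-- One factor in `A` comes from the coefficients of `a` and one in `B` from κ. So, to leading
order, a section of filtration level n has no exponents beyond ρ. -/
theorem coeff_psiPlus_mem_mul {A B : Ideal T} {a : RayAlgebra v κ D fo fi} (hκ : κ ∈ B)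
    (hp : psiPlus v κ D fo fi a ∈ A • (⊤ : Submodule T (QTorus T v)))
    (hm : psiMinus v κ D fo fi a ∈ A • (⊤ : Submodule T (QTorus T v)))
    {m : ℤ × ℤ} (hneg : m.2 < 0) :
    QTorus.coeff (psiPlus v κ D fo fi a) m ∈ A * B := by
  obtain ⟨α, rfl⟩ := exists_rayMonomial_sum a
  have hα := coeff_mem_of_psi_mem hp hm
  rw [map_sum, QTorus.coeff_sum]
  refine Ideal.sum_mem _ fun n _ => ?_
  rw [map_smul, QTorus.coeff_smul]
  refine Ideal.mul_mem_mul (hα n) ?_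
  by_cases h : n.2 = m.2
  · exact QTorus.mem_smul_top.1 (psiPlus_rayMonomial_mem hκ (h ▸ hneg)) m
  · rw [psiPlus_rayMonomial_isHomog n m (fun h' => h h'.symm)]
    exact B.zero_mem

theorem coeff_psiMinus_mem_mul {A B : Ideal T} {a : RayAlgebra v κ D fo fi} (hκ : κ ∈ B)
    (hp : psiPlus v κ D fo fi a ∈ A • (⊤ : Submodule T (QTorus T v)))
    (hm : psiMinus v κ D fo fi a ∈ A • (⊤ : Submodule T (QTorus T v)))
    {m : ℤ × ℤ} (hneg : m.1 < 0) :
    QTorus.coeff (psiMinus v κ D fo fi a) m ∈ A * B := by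
  obtain ⟨α, rfl⟩ := exists_rayMonomial_sum a
  have hα := coeff_mem_of_psi_mem hp hm
  rw [map_sum, QTorus.coeff_sum]
  refine Ideal.sum_mem _ fun n _ => ?_
  rw [map_smul, QTorus.coeff_smul]
  refine Ideal.mul_mem_mul (hα n) ?_
  by_cases h : -n.2 = m.1
  · exact QTorus.mem_smul_top.1 (psiMinus_rayMonomial_mem hκ (by omega)) m
  · rw [psiMinus_rayMonomial_isHomog n m (fun h' => h h'.symm)]
    exact B.zero_mem

end RayAlgebra

/-! ### Convergent sums of power series -/

section HSum

variable {R ι ι' : Type*} [CommRing R]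

theorem hasHSum_hSum {f : ι → PowerSeries R}
    (h : ∀ n, {x | PowerSeries.coeff n (f x) ≠ 0}.Finite) : HasHSum f (hSum f) :=
  fun n => ⟨h n, by simp [hSum]⟩

theorem HasHSum.hSum_eq {f : ι → PowerSeries R} {s : PowerSeries R} (h : HasHSum f s) :
    hSum f = s := by
  ext n
  rw [(h n).2]
  simp [hSum]

/-- Extension by zero turns sums over broken lines with a prescribed exponent into sums over one
fixed index type, where they can be added and multiplied. -/
theorem hasHSum_subtype_iff {p : ι → Prop} [DecidablePred p] {f : ι → PowerSeries R}
    {s : PowerSeries R} :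
    HasHSum (fun x : {x // p x} => f x) s ↔ HasHSum (fun x => if p x then f x else 0) s := by
  refine forall_congr' fun n => and_congr ?_ ?_
  · have h : {x | PowerSeries.coeff n (if p x then f x else 0) ≠ 0} =
        Subtype.val '' {x : {x // p x} | PowerSeries.coeff n (f x) ≠ 0} := by
      ext x
      by_cases hx : p x <;> simp [hx]
    rw [h, Set.finite_image_iff Subtype.val_injective.injOn]
  · have h : ∑ᶠ x : {x // p x}, PowerSeries.coeff n (f x.1) =
        ∑ᶠ x, PowerSeries.coeff n (if p x then f x else 0) := by
      refine (finsum_subtype_eq_finsum_cond (f := fun x => PowerSeries.coeff n (f x)) p).trans ?_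
      refine finsum_congr fun x => ?_
      by_cases hx : p x <;> simp [hx]
    rw [h]

theorem HasHSum.finset_sum {σ : Type*} (M : Finset σ) {f : σ → ι → PowerSeries R}
    {s : σ → PowerSeries R} (h : ∀ m ∈ M, HasHSum (f m) (s m)) :
    HasHSum (fun x => ∑ m ∈ M, f m x) (∑ m ∈ M, s m) := by
  intro n
  have hfin : ∀ m ∈ M, {x | PowerSeries.coeff n (f m x) ≠ 0}.Finite := fun m hm => (h m hm n).1
  constructor
  · refine (M.finite_toSet.biUnion hfin).subset fun x hx => ?_
    simp only [Set.mem_ofPred_eq, map_sum] at hx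
    obtain ⟨m, hm, hne⟩ := Finset.exists_ne_zero_of_sum_ne_zero hx
    exact Set.mem_biUnion (Finset.mem_coe.2 hm) hne
  · simp only [map_sum]
    rw [finsum_sum_comm M (fun x m => PowerSeries.coeff n (f m x)) hfin]
    exact Finset.sum_congr rfl fun m hm => (h m hm n).2

theorem HasHSum.mul_const {f : ι → PowerSeries R} {s : PowerSeries R} (h : HasHSum f s)
    (c : PowerSeries R) : HasHSum (fun x => f x * c) (s * c) := by
  intro n
  have hfin : ∀ m ∈ Finset.HasAntidiagonal.antidiagonal n,
      {x | PowerSeries.coeff m.1 (f x) * PowerSeries.coeff m.2 c ≠ 0}.Finite :=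
    fun m _ => (h m.1).1.subset fun x hx => left_ne_zero_of_mul hx
  simp only [PowerSeries.coeff_mul]
  constructor
  · refine ((Finset.HasAntidiagonal.antidiagonal n).finite_toSet.biUnion hfin).subset fun x hx => ?_
    obtain ⟨m, hm, hne⟩ := Finset.exists_ne_zero_of_sum_ne_zero hx
    exact Set.mem_biUnion (Finset.mem_coe.2 hm) hne
  · rw [finsum_sum_comm _ (fun x (m : ℕ × ℕ) =>
      PowerSeries.coeff m.1 (f x) * PowerSeries.coeff m.2 c) hfin]
    refine Finset.sum_congr rfl fun m _ => ?_
    rw [(h m.1).2, finsum_mul' _ _ (h m.1).1]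

theorem finsum_prod_mul {u : ι → R} {w : ι' → R} (hu : {x | u x ≠ 0}.Finite)
    (hw : {x | w x ≠ 0}.Finite) :
    {x : ι × ι' | u x.1 * w x.2 ≠ 0}.Finite ∧
      ∑ᶠ x : ι × ι', u x.1 * w x.2 = (∑ᶠ x, u x) * ∑ᶠ x, w x := by
  have hsub : {x : ι × ι' | u x.1 * w x.2 ≠ 0} ⊆ {x | u x ≠ 0} ×ˢ {x | w x ≠ 0} :=
    fun x hx => ⟨left_ne_zero_of_mul hx, right_ne_zero_of_mul hx⟩
  refine ⟨(hu.prod hw).subset hsub, ?_⟩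
  rw [finsum_eq_sum_of_support_subset u (s := hu.toFinset) (by simp [Function.support]),
    finsum_eq_sum_of_support_subset w (s := hw.toFinset) (by simp [Function.support]),
    finsum_eq_sum_of_support_subset (fun x : ι × ι' => u x.1 * w x.2)
      (s := hu.toFinset ×ˢ hw.toFinset) 
      (by rw [Finset.coe_product, hu.coe_toFinset, hw.coe_toFinset]; exact hsub),
    Finset.sum_product, Finset.sum_mul_sum]

/-- The coefficient of ħⁿ in a product involves only the finitely many coefficients of order at most
n in each factor, so it reduces to the product of two finite sums. -/
theorem HasHSum.mul {f : ι → PowerSeries R} {g : ι' → PowerSeries R} {s t : PowerSeries R}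
    (hf : HasHSum f s) (hg : HasHSum g t) :
    HasHSum (fun x : ι × ι' => f x.1 * g x.2) (s * t) := by
  intro n
  have key := fun m : ℕ × ℕ => finsum_prod_mul (hf m.1).1 (hg m.2).1
  simp only [PowerSeries.coeff_mul]
  constructor
  · refine ((Finset.HasAntidiagonal.antidiagonal n).finite_toSet.biUnion fun m _ => (key m).1).subset
      fun x hx => ?_
    obtain ⟨m, hm, hne⟩ := Finset.exists_ne_zero_of_sum_ne_zero hx
    exact Set.mem_biUnion (Finset.mem_coe.2 hm) hne
  · rw [finsum_sum_comm _ (fun (x : ι × ι') (m : ℕ × ℕ) =>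
      PowerSeries.coeff m.1 (f x.1) * PowerSeries.coeff m.2 (g x.2)) fun m _ => (key m).1]
    refine Finset.sum_congr rfl fun m _ => ?_
    rw [(key m).2, (hf m.1).2, (hg m.2).2]

end HSum

/-! ### Laurent polynomials congruent to `1` modulo an ideal -/

section Congruence

variable {T : Type*} [CommRing T]

/-- The Laurent polynomials congruent to `1` modulo `A`. -/
def laurentOneAdd (A : Ideal T) : Submonoid (T[T;T⁻¹]) :=
  MonoidHom.mker
    (AddMonoidAlgebra.mapRingHom ℤ (Ideal.Quotient.mk A) : (T[T;T⁻¹]) →* ((T ⧸ A)[T;T⁻¹]))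

theorem mem_laurentOneAdd {A : Ideal T} {f : T[T;T⁻¹]} :
    f ∈ laurentOneAdd A ↔ ∀ a, (f - 1).coeff a ∈ A := by
  have h : f ∈ laurentOneAdd A ↔
      AddMonoidAlgebra.mapRingHom ℤ (Ideal.Quotient.mk A) (f - 1) = 0 := by
    rw [map_sub, map_one, sub_eq_zero]
    exact MonoidHom.mem_mker
  rw [h, AddMonoidAlgebra.ext_iff, DFunLike.ext_iff]
  refine forall_congr' fun a => ?_
  rw [← Ideal.Quotient.eq_zero_iff_mem]
  rfl

theorem coeff_qScale (v : Tˣ) (n : ℤ) (g : T[T;T⁻¹]) (a : ℤ) :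
    (qScale v n g).coeff a = ((v ^ (2 * n * a) : Tˣ) : T) * g.coeff a := by
  induction g using AddMonoidAlgebra.induction_linear with
  | zero => simp [qScale]
  | add x y hx hy => rw [QTorus.qScale_add]; simp [mul_add, hx, hy]
  | single b c =>
    rw [QTorus.qScale_single, AddMonoidAlgebra.coeff_single, AddMonoidAlgebra.coeff_single]
    by_cases h : b = a
    · subst h; simp
    · simp [h]

theorem qScale_one (v : Tˣ) (n : ℤ) : qScale v n 1 = 1 := by
  rw [AddMonoidAlgebra.one_def, QTorus.qScale_single]
  simp

theorem qScale_mem_laurentOneAdd {A : Ideal T} (v : Tˣ) (n : ℤ) {g : T[T;T⁻¹]}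
    (hg : g ∈ laurentOneAdd A) : qScale v n g ∈ laurentOneAdd A := by
  rw [mem_laurentOneAdd] at hg ⊢
  intro a
  have h : qScale v n g - 1 = qScale v n (g - 1) := by
    have := QTorus.qScale_add (v := v) n (g - 1) 1
    rw [sub_add_cancel, qScale_one] at this
    rw [this, add_sub_cancel_right]
  rw [h, coeff_qScale]
  exact A.mul_mem_left _ (hg a)

theorem eval_sub_one_mem {A : Ideal T} {v : Tˣ} (m : ℤ × ℤ) {g : T[T;T⁻¹]}
    (hg : g ∈ laurentOneAdd A) :
    (QTorus.eval m g - 1 : QTorus T v) ∈ A • (⊤ : Submodule T (QTorus T v)) := by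
  rw [← QTorus.eval_one m, ← QTorus.eval_sub]
  exact QTorus.eval_mem_smul_top m _ (mem_laurentOneAdd.1 hg)

end Congruence

/-! ### The `J`-adic filtration of the coefficient rings -/

section Coefficients

variable {k : Type*} [Field k] {P : Type*} [AddCommMonoid P]

variable (k) in
/-- The ideal of `R_I` spanned by the monomials with exponent in `J`. -/
def monomialIdealRI (J I : AddSemigroupIdeal P) : Ideal (RI k I) :=
  (monomialIdeal k J).map (Ideal.Quotient.mk (monomialIdeal k I))

variable (k) in
/-- The ideal of `R_I⟦ħ⟧` of the power series with coefficients in `monomialIdealRI k J I`. -/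
def adicIdeal (J I : AddSemigroupIdeal P) : Ideal (RIh k I) :=
  RingHom.ker (PowerSeries.map (Ideal.Quotient.mk (monomialIdealRI k J I)))

variable {J I : AddSemigroupIdeal P}

theorem mem_adicIdeal {x : RIh k I} :
    x ∈ adicIdeal k J I ↔ ∀ n, PowerSeries.coeff n x ∈ monomialIdealRI k J I := by
  rw [adicIdeal, RingHom.mem_ker, PowerSeries.ext_iff]
  refine forall_congr' fun n => ?_
  rw [PowerSeries.coeff_map, map_zero, Ideal.Quotient.eq_zero_iff_mem]

/-- This inclusion suffices to transport nilpotence from R_I to R_I⟦ħ⟧. -/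
theorem coeff_mem_of_mem_adicIdeal_pow (m : ℕ) {x : RIh k I} (hx : x ∈ adicIdeal k J I ^ m)
    (n : ℕ) : PowerSeries.coeff n x ∈ monomialIdealRI k J I ^ m := by
  induction m generalizing x n with
  | zero => simp
  | succ m ih =>
    have hx' : x ∈ adicIdeal k J I ^ m * adicIdeal k J I := (pow_succ (adicIdeal k J I) m) ▸ hx
    clear hx
    rw [show monomialIdealRI k J I ^ (m + 1) = monomialIdealRI k J I ^ m * monomialIdealRI k J I
      from Submodule.pow_succ _]
    induction hx' using Submodule.mul_induction_on' with
    | mem_mul_mem a ha b hb =>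
      rw [PowerSeries.coeff_mul]
      exact Ideal.sum_mem _ fun c _ => Ideal.mul_mem_mul (ih ha _) (mem_adicIdeal.1 hb _)
    | add a _ b _ ha hb =>
      rw [map_add]
      exact Ideal.add_mem _ ha hb

theorem single_mem_monomialIdeal {u : P} (hu : u ∈ I) (c : k) :
    AddMonoidAlgebra.single u c ∈ monomialIdeal k I := by
  have h : AddMonoidAlgebra.single u c = c • AddMonoidAlgebra.single u (1 : k) := by simp
  rw [h, Algebra.smul_def]
  exact Ideal.mul_mem_left _ _ (Ideal.subset_span ⟨u, hu, rfl⟩)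

/-- The ideal of J lies in the radical of the ideal of I and is finitely generated, k[P] being
Noetherian; hence one of its powers lies in the ideal of I. -/
theorem exists_monomialIdealRI_pow_eq_bot [IsToricMonoid P] (hI : IsRadicalOf J I) :
    ∃ N, monomialIdealRI k J I ^ N = ⊥ := by
  have : AddMonoid.FG P := IsToricMonoid.fg
  have : IsNoetherianRing (AddMonoidAlgebra k P) :=
    Algebra.FiniteType.isNoetherianRing k _
  have hle : monomialIdeal k J ≤ (monomialIdeal k I).radical := by
    refine Ideal.span_le.2 ?_
    rintro _ ⟨u, hu, rfl⟩
    obtain ⟨n, -, hn⟩ := (hI u).1 hu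
    refine ⟨n, ?_⟩
    rw [AddMonoidAlgebra.single_pow, one_pow]
    exact single_mem_monomialIdeal hn 1
  obtain ⟨N, hN⟩ := Ideal.exists_pow_le_of_le_radical_of_fg hle (IsNoetherian.noetherian _)
  refine ⟨N, ?_⟩
  rw [monomialIdealRI, ← Ideal.map_pow, Ideal.map_eq_bot_iff_le_ker, Ideal.mk_ker]
  exact hN

theorem exists_adicIdeal_pow_eq_bot [IsToricMonoid P] (hI : IsRadicalOf J I) :
    ∃ N, adicIdeal k J I ^ N = ⊥ := by
  obtain ⟨N, hN⟩ := exists_monomialIdealRI_pow_eq_bot (k := k) hI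
  refine ⟨N, eq_bot_iff.2 fun x hx => ?_⟩
  rw [Ideal.mem_bot]
  ext n
  have := coeff_mem_of_mem_adicIdeal_pow N hx n
  rwa [hN, Ideal.mem_bot] at this

theorem single_mem_monomialIdealRI {u : P} (hu : u ∈ J) (c : k) :
    Ideal.Quotient.mk (monomialIdeal k I) (AddMonoidAlgebra.single u c) ∈
      monomialIdealRI k J I :=
  Ideal.mem_map_of_mem _ (single_mem_monomialIdeal hu c)

theorem zP_mem_adicIdeal {u : P} (hu : u ∈ J) : zP k I u ∈ adicIdeal k J I := by
  rw [mem_adicIdeal]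
  intro n
  rw [zP, PowerSeries.coeff_C]
  split_ifs
  · exact single_mem_monomialIdealRI hu 1
  · exact Ideal.zero_mem _

theorem zP_add (u w : P) : zP k I (u + w) = zP k I u * zP k I w := by
  rw [zP, zP, zP, ← map_mul, ← map_mul, AddMonoidAlgebra.single_mul_single, one_mul]

theorem zP_zero : zP k I 0 = 1 := by
  rw [zP, ← AddMonoidAlgebra.one_def, map_one, map_one]

theorem coeffRI_mk {u : P} (hu : u ∉ I) (x : AddMonoidAlgebra k P) :
    coeffRI I u (Ideal.Quotient.mk (monomialIdeal k I) x) = x.coeff u := by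
  simp only [coeffRI, hu, ↓reduceDIte]
  rfl

theorem coeffRIh_zero (w : P) : coeffRIh I w (0 : RIh k I) = 0 := by
  ext n
  simp [coeffRIh]

theorem finite_coeffRI_ne_zero (x : RI k I) : {u | u ∉ I ∧ coeffRI I u x ≠ 0}.Finite := by
  obtain ⟨y, rfl⟩ := Ideal.Quotient.mk_surjective x
  refine (Finsupp.hasFiniteSupport y.coeff).subset ?_
  rintro u ⟨hu, h⟩
  rwa [coeffRI_mk hu] at h

theorem mem_of_isRadicalOf (hI : IsRadicalOf J I) {u : P} (hu : u ∈ I) : u ∈ J :=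
  (hI u).2 ⟨1, one_pos, by rwa [one_smul]⟩

theorem mem_of_coeffRIh_ne_zero (hI : IsRadicalOf J I) {x : RIh k I} (hx : x ∈ adicIdeal k J I)
    {u : P} (h : coeffRIh I u x ≠ 0) : u ∈ J := by
  by_contra hu
  refine h ?_
  ext n
  rw [coeffRIh, PowerSeries.coeff_mk, map_zero]
  obtain ⟨y, hy, hyx⟩ := (Ideal.mem_map_iff_of_surjective _ Ideal.Quotient.mk_surjective).1
    (mem_adicIdeal.1 hx n)
  rw [← hyx, coeffRI_mk (fun h' => hu (mem_of_isRadicalOf hI h'))]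
  exact coeff_eq_zero_of_mem J hu hy

end Coefficients

/-! ### The functions attached to the rays -/

section Scattering

variable {k : Type*} [Field k] [CharZero k] {P : Type*} [AddCommMonoid P] {r : ℕ}

namespace QuantumRay

variable {i : k} {d : QuantumRay k P r} {J I : AddSemigroupIdeal P}

theorem fHat_eq_one (h : d.IsZeroMod I) : d.fHat i I = 1 := by
  have hlog : d.logF i I = 0 := by
    ext l : 1
    rw [logF, PowerSeries.coeff_mk, map_zero]
    refine mul_eq_zero_of_right _ ?_
    ext n : 1
    rw [PowerSeries.coeff_mk, map_zero]
    refine finsum_eq_zero_of_forall_eq_zero fun u => ?_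
    rw [Ideal.Quotient.eq_zero_iff_mem]
    by_cases hu : u ∈ I
    · exact single_mem_monomialIdeal hu _
    · rw [h l u hu, map_zero, AddMonoidAlgebra.single_zero]
      exact Ideal.zero_mem _
  ext l : 1
  rw [fHat, PowerSeries.coeff_mk, Finset.sum_eq_single 0]
  · simp
  · intro n _ hn
    rw [hlog, zero_pow hn, map_zero, mul_zero]
  · simp

/-- The logarithm vanishes in the quotient, so only the constant term of the exponential series
remains. -/
theorem map_fHat_eq_one (h : d.IsZeroMod J) :
    PowerSeries.map (Ideal.Quotient.mk (adicIdeal k J I)) (d.fHat i I) = 1 := by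
  have hlog : PowerSeries.map (Ideal.Quotient.mk (adicIdeal k J I)) (d.logF i I) = 0 := by
    ext l : 1
    rw [logF, PowerSeries.coeff_map, PowerSeries.coeff_mk, map_zero,
      Ideal.Quotient.eq_zero_iff_mem]
    refine Ideal.mul_mem_left _ _ (mem_adicIdeal.2 fun n => ?_)
    rw [PowerSeries.coeff_mk]
    refine finsum_induction (· ∈ monomialIdealRI k J I) (Ideal.zero_mem _)
      (fun _ _ => Ideal.add_mem _) fun u => ?_
    by_cases hu : u ∈ J
    · exact single_mem_monomialIdealRI hu _
    · rw [h l u hu, map_zero, AddMonoidAlgebra.single_zero, map_zero]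
      exact Ideal.zero_mem _
  ext l : 1
  rw [fHat, PowerSeries.coeff_map, PowerSeries.coeff_mk, map_sum, Finset.sum_eq_single 0]
  · rw [Nat.factorial_zero, Nat.cast_one, inv_one, map_one, one_mul, pow_zero,
      ← PowerSeries.coeff_map, map_one]
  · intro n _ hn
    have h0 : PowerSeries.map (Ideal.Quotient.mk (adicIdeal k J I)) (d.logF i I ^ n) = 0 := by
      rw [map_pow, hlog]
      exact zero_pow (M₀ := PowerSeries (RIh k I ⧸ adicIdeal k J I)) hn
    rw [map_mul, ← PowerSeries.coeff_map, h0, map_zero]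
    exact mul_zero (M₀ := RIh k I ⧸ adicIdeal k J I) _
  · simp

end QuantumRay

/-- A Laurent polynomial whose coefficients are those of a polynomial congruent to `1`. -/
theorem finsum_single_mem_laurentOneAdd {T : Type*} [CommRing T] {A : Ideal T} (e : ℕ → ℤ)
    (he : e 0 = 0) {f : PowerSeries T} (hf : ∃ N, ∀ l > N, PowerSeries.coeff l f = 0)
    (h : PowerSeries.map (Ideal.Quotient.mk A) f = 1) :
    ∑ᶠ l : ℕ, AddMonoidAlgebra.single (e l) (PowerSeries.coeff l f) ∈ laurentOneAdd A := by
  obtain ⟨N, hN⟩ := hf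
  have hc : ∀ l, PowerSeries.coeff l f - PowerSeries.coeff l 1 ∈ A := fun l => by
    rw [← Ideal.Quotient.eq_zero_iff_mem, map_sub, ← PowerSeries.coeff_map,
      ← PowerSeries.coeff_map, h, map_one (PowerSeries.map _), sub_self]
  have h1 : (1 : T[T;T⁻¹]) = ∑ l ∈ Finset.range (N + 1),
      AddMonoidAlgebra.single (e l) (PowerSeries.coeff l (1 : PowerSeries T)) := by
    rw [Finset.sum_eq_single 0]
    · rw [he, PowerSeries.coeff_zero_one, AddMonoidAlgebra.one_def]
    · intro l _ hl
      rw [PowerSeries.coeff_one, if_neg hl, AddMonoidAlgebra.single_zero]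
    · intro h0
      exact absurd (Finset.mem_range.2 (Nat.succ_pos N)) h0
  -- Polynomiality enters here: a `finsum` with infinite support would be 0 by convention.
  rw [finsum_eq_sum_of_support_subset _ (s := Finset.range (N + 1)), mem_laurentOneAdd]
  · intro a
    rw [h1, ← Finset.sum_sub_distrib]
    simp only [← AddMonoidAlgebra.single_sub]
    rw [AddMonoidAlgebra.coeff_sum, Finsupp.finsetSum_apply]
    refine Ideal.sum_mem _ fun l _ => ?_
    rw [AddMonoidAlgebra.coeff_single, Finsupp.single_apply]
    split_ifs
    · exact hc l
    · exact A.zero_mem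
  · intro l hl
    by_contra hl'
    rw [Finset.mem_coe, Finset.mem_range] at hl'
    rw [Function.mem_support, hN l (by omega)] at hl
    simp at hl

theorem finsum_single_one {T : Type*} [CommRing T] (e : ℕ → ℤ) (he : e 0 = 0) :
    ∑ᶠ l : ℕ, AddMonoidAlgebra.single (e l) (PowerSeries.coeff l (1 : PowerSeries T)) =
      (1 : T[T;T⁻¹]) := by
  rw [finsum_eq_single _ 0]
  · rw [he, PowerSeries.coeff_zero_one, AddMonoidAlgebra.one_def]
  · intro l hl
    rw [PowerSeries.coeff_one, if_neg hl, AddMonoidAlgebra.single_zero]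

/-! ### Wall-crossing functions of a scattering diagram -/

namespace QuantumScattering

variable {i : k} {κ : ZMod r → P} {J : AddSemigroupIdeal P}
  (S : QuantumScattering i κ J) (I : AddSemigroupIdeal P)

-- Polynomials are closed under products, and the default value 1 of `finprod` is itself a
-- polynomial.
variable {I} in
theorem wallSeries_polynomial (hI : IsRadicalOf J I) (j : ZMod r) (s : ℚ) (out : Bool) :
    ∃ N, ∀ l > N, PowerSeries.coeff l (S.wallSeries I j s out) = 0 := by
  have hpoly : ∀ f : PowerSeries (RIh k I), (∃ N, ∀ l > N, PowerSeries.coeff l f = 0) ↔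
      ∃ p : Polynomial (RIh k I), (p : PowerSeries (RIh k I)) = f := by
    intro f
    constructor
    · rintro ⟨N, hN⟩
      refine ⟨PowerSeries.trunc (N + 1) f, ?_⟩
      ext l : 1
      rw [Polynomial.coeff_coe, PowerSeries.coeff_trunc]
      split_ifs with h
      · rfl
      · exact (hN l (by omega)).symm
    · rintro ⟨p, rfl⟩
      refine ⟨p.natDegree, fun l hl => ?_⟩
      rw [Polynomial.coeff_coe]
      exact Polynomial.coeff_eq_zero_of_natDegree_lt hl
  rw [hpoly]
  refine finprod_mem_induction
    (fun f => ∃ p : Polynomial (RIh k I), (p : PowerSeries (RIh k I)) = f)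
    ⟨1, Polynomial.coe_one⟩ ?_ ?_
  · rintro _ _ ⟨p, rfl⟩ ⟨p', rfl⟩
    exact ⟨p * p', Polynomial.coe_mul _ _⟩
  · intro d hd
    exact (hpoly _).1 (S.polynomial d hd.1 I hI)

theorem map_wallSeries_eq_one (j : ZMod r) {s : ℚ} (hs : s ≠ 0) (out : Bool) :
    PowerSeries.map (Ideal.Quotient.mk (adicIdeal k J I)) (S.wallSeries I j s out) = 1 := by
  refine finprod_mem_induction
    (fun f => PowerSeries.map (Ideal.Quotient.mk (adicIdeal k J I)) f = 1) (map_one _) ?_ ?_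
  · intro f g hf hg
    rw [map_mul, hf, hg]
    exact one_mul (M := PowerSeries (RIh k I ⧸ adicIdeal k J I)) 1
  · rintro d ⟨hd, -, rfl, -⟩
    exact QuantumRay.map_fHat_eq_one (S.zero_mod d hd (Or.inl hs))

theorem wallSeries_eq_one {j : ZMod r} {s : ℚ} (hs : 0 < s) (h : s ∉ S.walls I j) (out : Bool) :
    S.wallSeries I j s out = 1 := by
  refine finprod_mem_eq_one_of_forall_eq_one ?_
  rintro d ⟨hd, hj, hs', -⟩
  refine QuantumRay.fHat_eq_one ?_
  by_contra hz
  exact h ⟨hs, d, hd, hj, hs', hz⟩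

-- For slope s ≠ 0 the Hamiltonians vanish modulo J. Rays supported on ρ_j are excluded: their
-- functions need not be trivial modulo J, and the kink takes over their role.
variable {I} in
theorem crossing_mem_laurentOneAdd (hI : IsRadicalOf J I) (j : ZMod r) {s : ℚ} (hs : s ≠ 0)
    (n : ℤ) : S.crossing I j s n ∈ laurentOneAdd (adicIdeal k J I) := by
  have ho : S.fOut I j s ∈ laurentOneAdd (adicIdeal k J I) :=
    finsum_single_mem_laurentOneAdd (fun l => -(l : ℤ)) (by simp)
      (S.wallSeries_polynomial hI j s true) (S.map_wallSeries_eq_one I j hs true)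
  have hi : S.fIn I j s ∈ laurentOneAdd (adicIdeal k J I) :=
    finsum_single_mem_laurentOneAdd (fun l => (l : ℤ)) (by simp)
      (S.wallSeries_polynomial hI j s false) (S.map_wallSeries_eq_one I j hs false)
  unfold crossing
  split_ifs <;>
  exact Submonoid.mul_mem _
    (Submonoid.prod_mem _ fun _ _ => qScale_mem_laurentOneAdd _ _ ho)
    (Submonoid.prod_mem _ fun _ _ => qScale_mem_laurentOneAdd _ _ hi)

theorem crossing_eq_one {j : ZMod r} {s : ℚ} (hs : 0 < s) (h : s ∉ S.walls I j) (n : ℤ) :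
    S.crossing I j s n = 1 := by
  have ho : S.fOut I j s = 1 := by
    rw [fOut, S.wallSeries_eq_one I hs h]
    exact finsum_single_one (fun l => -(l : ℤ)) (by simp)
  have hi : S.fIn I j s = 1 := by
    rw [fIn, S.wallSeries_eq_one I hs h]
    exact finsum_single_one (fun l => (l : ℤ)) (by simp)
  simp [crossing, ho, hi, qScale_one]

theorem crossing_zero (j : ZMod r) (s : ℚ) : S.crossing I j s 0 = 1 := by
  simp [crossing]

variable {I} in
theorem finite_walls (hI : IsRadicalOf J I) (j : ZMod r) : (S.walls I j).Finite := by
  refine ((S.finite I hI).image QuantumRay.slope).subset ?_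
  rintro s ⟨-, d, hd, -, hs, hz⟩
  exact ⟨d, ⟨hd, hz⟩, hs⟩

/-! ### The automorphisms modulo `J` -/

theorem sub_mem_of_forall_term {T : Type*} [CommRing T] {v : Tˣ} {A : Ideal T}
    (Θ : QTorus T v →ₐ[T] QTorus T v)
    (h : ∀ m, Θ (QTorus.term m 1) - QTorus.term m 1 ∈ A • (⊤ : Submodule T (QTorus T v)))
    (x : QTorus T v) : Θ x - x ∈ A • (⊤ : Submodule T (QTorus T v)) := by
  rw [QTorus.eq_sum_term x (QTorus.finite_coeff_ne_zero x).toFinset (by simp), map_sum,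
    ← Finset.sum_sub_distrib]
  refine Submodule.sum_mem _ fun m _ => ?_
  rw [map_smul, ← smul_sub]
  exact Submodule.smul_mem _ _ (h m)

-- Only the values on the monomials matter, by linearity. The default value, the identity, satisfies
-- the claim trivially, so the existence of the wall automorphism is not needed.
variable {I} in
theorem wallAut_sub_mem (hI : IsRadicalOf J I) (j : ZMod r) {s : ℚ} (hs : s ≠ 0)
    (x : RSigma i I) :
    S.wallAut I j s x - x ∈ adicIdeal k J I • (⊤ : Submodule (RIh k I) (RSigma i I)) := by
  unfold wallAut
  split_ifs with h
  · refine sub_mem_of_forall_term _ (fun m => ?_) x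
    have hE := eval_sub_one_mem (v := vI i I) (primGen s)
      (S.crossing_mem_laurentOneAdd hI j hs (pairing (primGen s) m))
    set Θ := h.choose
    set E : RSigma i I := QTorus.eval (primGen s) (S.crossing I j s (pairing (primGen s) m))
    obtain ⟨h1, h2⟩ := h.choose_spec m
    rcases le_or_gt (pairing (primGen s) m) 0 with hm | hm
    · have : Θ (QTorus.term m 1) - QTorus.term m 1 = QTorus.term m 1 * (E - 1) := by
        rw [h1 hm, mul_sub, mul_one]
      rw [this]
      exact QTorus.mul_mem_smul_top_left _ hE
    -- Here Θ(z^m) E = z^m; this form of the difference avoids inverting E.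
    · have : Θ (QTorus.term m 1) - QTorus.term m 1 = -(Θ (QTorus.term m 1) * (E - 1)) := by
        rw [mul_sub, h2 hm, mul_one, neg_sub]
      rw [this]
      exact Submodule.neg_mem _ (QTorus.mul_mem_smul_top_left _ hE)
  · rw [AlgHom.id_apply, sub_self]
    exact Submodule.zero_mem _

variable {I} in
theorem pathAut_sub_mem (hI : IsRadicalOf J I) (j : ZMod r) (A : Set ℚ) (x : RSigma i I) :
    S.pathAut I j A x - x ∈ adicIdeal k J I • (⊤ : Submodule (RIh k I) (RSigma i I)) := by
  unfold pathAut
  split_ifs with h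
  · have key : ∀ (l : List ℚ) (Θ : RSigma i I →ₐ[RIh k I] RSigma i I), (∀ s ∈ l, s ≠ 0) →
        Θ x - x ∈ adicIdeal k J I • (⊤ : Submodule (RIh k I) (RSigma i I)) →
        l.foldl (fun Θ s => (S.wallAut I j s).comp Θ) Θ x - x ∈
          adicIdeal k J I • (⊤ : Submodule (RIh k I) (RSigma i I)) := by
      intro l
      induction l with
      | nil => exact fun Θ _ h => h
      | cons s l ih =>
        intro Θ hl hΘ
        refine ih _ (fun s' hs' => hl s' (List.mem_cons_of_mem _ hs')) ?_
        have := S.wallAut_sub_mem hI j (hl s List.mem_cons_self) (Θ x)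
        have h' := Submodule.add_mem _ this hΘ
        rwa [sub_add_sub_cancel] at h'
    refine key _ _ ?_ ?_
    · intro s hs
      rw [Finset.mem_sort, Set.Finite.mem_toFinset] at hs
      exact hs.1.1.ne'
    · rw [AlgHom.id_apply, sub_self]
      exact Submodule.zero_mem _
  · rw [AlgHom.id_apply, sub_self]
    exact Submodule.zero_mem _

variable {I} in
/-- A path automorphism is the identity on each graded piece of the `J`-adic filtration. -/
theorem pathAut_sub_mem_pow (hI : IsRadicalOf J I) (j : ZMod r) (A : Set ℚ) (n : ℕ)
    {x : RSigma i I}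
    (hx : x ∈ adicIdeal k J I ^ n • (⊤ : Submodule (RIh k I) (RSigma i I))) :
    S.pathAut I j A x - x ∈
      adicIdeal k J I ^ (n + 1) • (⊤ : Submodule (RIh k I) (RSigma i I)) := by
  refine Submodule.smul_induction_on hx ?_ ?_
  · intro c hc y _
    rw [map_smul, ← smul_sub]
    have h := Submodule.smul_mem_smul hc (S.pathAut_sub_mem hI j A y)
    rw [← Submodule.mul_smul] at h
    exact pow_succ (adicIdeal k J I) n ▸ h
  · intro y z hy hz
    rw [map_add, add_sub_add_comm]
    exact Submodule.add_mem _ hy hz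

theorem pathAut_congr {j : ZMod r} {A B : Set ℚ} (h : S.walls I j ∩ A = S.walls I j ∩ B) :
    S.pathAut I j A = S.pathAut I j B := by
  unfold pathAut
  split_ifs with h1 h2 h2
  · have : h1.toFinset = h2.toFinset := by rw [← Finset.coe_inj]; simpa using h
    rw [this]
  · exact absurd (h ▸ h1) h2
  · exact absurd (h.symm ▸ h2) h1
  · rfl

theorem pathAut_empty {j : ZMod r} {A : Set ℚ} (h : S.walls I j ∩ A = ∅) :
    S.pathAut I j A = AlgHom.id _ _ := by
  unfold pathAut
  simp [h]

end QuantumScattering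

end Scattering

/-! ### Finitely many chains -/

/-- If every element has finitely many successors, there are finitely many chains of a given
length that start in a given finite set. -/
theorem finite_chains {α : Type*} {G : α → α → Prop} (hG : ∀ x, {y | G x y}.Finite) (n : ℕ)
    {F : Set α} (hF : F.Finite) :
    {l : List α | l.length = n ∧ l.IsChain G ∧ ∀ x ∈ l.head?, x ∈ F}.Finite := by
  induction n generalizing F with
  | zero =>
    refine (Set.finite_singleton []).subset ?_
    rintro l ⟨hl, -, -⟩
    exact List.length_eq_zero_iff.1 hl
  | succ n ih =>
    -- The tail of a chain with head `x` starts in the finite set of successors of `x`.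
    refine (hF.biUnion fun x _ => (ih (hG x)).image (List.cons x)).subset ?_
    rintro (_ | ⟨x, l⟩) ⟨hl, hc, hx⟩
    · simp at hl
    · rw [List.isChain_cons] at hc
      simp only [Set.mem_iUnion]
      exact ⟨x, hx x (by simp), l, ⟨by simpa using hl, hc.2, hc.1⟩, rfl⟩

section Scattering

variable {k : Type*} [Field k] [CharZero k] {P : Type*} [AddCommMonoid P] {r : ℕ}

namespace QuantumScattering

variable {i : k} {κ : ZMod r → P} {J : AddSemigroupIdeal P}
  {S : QuantumScattering i κ J} {D : ZMod r → ℤ} {I : AddSemigroupIdeal P}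

/-! ### Bends -/

theorem coeff_one_of_ne_zero {T : Type*} [CommRing T] {a : ℤ} (ha : a ≠ 0) :
    (1 : T[T;T⁻¹]).coeff a = 0 := by
  rw [AddMonoidAlgebra.one_def, AddMonoidAlgebra.coeff_single, Finsupp.single_apply,
    if_neg ha.symm]

theorem Bends.mem_walls {j : ZMod r} {s : ℚ} {m : ℤ × ℤ} {A B : Mono k P}
    (h : S.Bends I j s m A B) (hs : 0 < s) : s ∈ S.walls I j := by
  obtain ⟨a, w, c, ha, -, hc, hc', -⟩ := h
  by_contra hw
  rw [S.crossing_eq_one I hs hw, coeff_one_of_ne_zero ha, coeffRIh_zero] at hc'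
  exact hc hc'

/-- A direction parallel to the ray picks up an empty product of functions, which has no nonconstant
term. -/
theorem Bends.pairing_ne_zero {j : ZMod r} {s : ℚ} {m : ℤ × ℤ} {A B : Mono k P}
    (h : S.Bends I j s m A B) : pairing m A.dir ≠ 0 := by
  obtain ⟨a, w, c, ha, -, hc, hc', -⟩ := h
  intro h0
  rw [h0, S.crossing_zero, coeff_one_of_ne_zero ha, coeffRIh_zero] at hc'
  exact hc hc'

/-- A bend uses a term of exponent a ≠ 0 of a function congruent to 1, so the coefficient lies in
the ideal of J. -/
theorem Bends.exists_deg (hI : IsRadicalOf J I) {j : ZMod r} {s : ℚ} {m : ℤ × ℤ}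
    {A B : Mono k P} (h : S.Bends I j s m A B) (hs : s ≠ 0) :
    ∃ w ∈ J, B.deg = A.deg + w := by
  obtain ⟨a, w, c, ha, -, hc, rfl, rfl⟩ := h
  refine ⟨w, mem_of_coeffRIh_ne_zero hI ?_ hc, rfl⟩
  have := mem_laurentOneAdd.1
    (S.crossing_mem_laurentOneAdd hI j hs (pairing m A.dir)) a
  rwa [AddMonoidAlgebra.coeff_sub, Finsupp.sub_apply, coeff_one_of_ne_zero ha, sub_zero] at this

theorem Bends.coeff_dvd {j : ZMod r} {s : ℚ} {m : ℤ × ℤ} {A B : Mono k P}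
    (h : S.Bends I j s m A B) : A.coeff ∣ B.coeff := by
  obtain ⟨a, w, c, -, -, -, -, rfl⟩ := h
  exact (Dvd.intro _ rfl).mul_right _

/-- A series over R_I may involve infinitely many monomials of P in total, but only finitely many in
each power of ħ. Truncation at ħ^(n+1) is therefore needed for finiteness. -/
theorem finite_bends (j : ZMod r) (s : ℚ) (m : ℤ × ℤ) (A : Mono k P) (n : ℕ) :
    {B | S.Bends I j s m A B ∧ ¬ PowerSeries.X ^ (n + 1) ∣ B.coeff}.Finite := by
  set f := S.crossing I j s (pairing m A.dir) with hf
  have hfin : ∀ a : ℤ, (⋃ n' ∈ Finset.range (n + 1),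
      {w | w ∉ I ∧ coeffRI I w (PowerSeries.coeff n' (f.coeff a)) ≠ 0}).Finite := fun a =>
    (Finset.range (n + 1)).finite_toSet.biUnion fun n' _ => finite_coeffRI_ne_zero _
  refine ((Finsupp.hasFiniteSupport f.coeff).biUnion fun a _ => (hfin a).image fun w =>
    (⟨A.dir + a • m, A.deg + w, A.coeff * coeffRIh I w (f.coeff a) *
      ((qUnit i ^ pairing A.dir (a • m) : (PowerSeries k)ˣ) : PowerSeries k)⟩ :
        Mono k P)).subset ?_
  rintro _ ⟨⟨a, w, c, -, hw, hc, rfl, rfl⟩, hB⟩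
  rw [← hf] at hc hB ⊢
  have hc' : ¬ PowerSeries.X ^ (n + 1) ∣ coeffRIh I w (f.coeff a) :=
    fun h => hB ((h.mul_left _).mul_right _)
  rw [PowerSeries.X_pow_dvd_iff] at hc'
  push Not at hc'
  obtain ⟨n', hn', hne⟩ := hc'
  rw [coeffRIh, PowerSeries.coeff_mk] at hne
  refine Set.mem_biUnion (x := a) ?_ ⟨w, ?_, rfl⟩
  · intro h0
    rw [h0, map_zero, map_zero] at hne
    exact hne rfl
  · exact Set.mem_biUnion (x := n') (Finset.mem_coe.2 (Finset.mem_range.2 hn')) ⟨hw, hne⟩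

/-- The new direction depends only on the exponent in a Laurent polynomial, so no truncation in ħ is
needed here. -/
theorem finite_bends_dir (j : ZMod r) (s : ℚ) (m d : ℤ × ℤ) :
    {e | ∃ A B : Mono k P, S.Bends I j s m A B ∧ A.dir = d ∧ B.dir = e}.Finite := by
  refine ((Finsupp.hasFiniteSupport (S.crossing I j s (pairing m d)).coeff).image
    fun a => d + a • m).subset ?_
  rintro _ ⟨A, _, ⟨a, w, c, -, hw, hc, rfl, rfl⟩, rfl, rfl⟩
  refine ⟨a, fun h0 => hc ?_, rfl⟩
  rw [h0, coeffRIh_zero]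

/-! ### Steps -/

theorem nsmul_mem_of_pos {u : P} (hu : u ∈ J) {n : ℤ} (hn : 0 < n) : n.toNat • u ∈ J := by
  obtain ⟨l, hl⟩ : ∃ l, n.toNat = l + 1 := ⟨n.toNat - 1, by omega⟩
  rw [hl, succ_nsmul]
  exact AddSemigroupIdeal.add_mem J _ hu

theorem exists_deg_of_eq_or_bends {j : ZMod r} {s : ℚ} {m : ℤ × ℤ} {A M : Mono k P}
    (hM : M = A ∨ S.Bends I j s m A M) : ∃ w, M.deg = A.deg + w := by
  rcases hM with rfl | ⟨a, w, c, -, -, -, -, rfl⟩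
  · exact ⟨0, (add_zero _).symm⟩
  · exact ⟨w, rfl⟩

theorem coeff_dvd_of_eq_or_bends {j : ZMod r} {s : ℚ} {m : ℤ × ℤ} {A M : Mono k P}
    (hM : M = A ∨ S.Bends I j s m A M) : A.coeff ∣ M.coeff := by
  rcases hM with rfl | hM
  · exact dvd_rfl
  · exact hM.coeff_dvd

/-- An interior step gains degree in J from the bend; a crossing of ρ_l gains a positive multiple of
κ_l even if there is no bend. -/
theorem Step.exists_deg (hI : IsRadicalOf J I) (hκ : ∀ j, κ j ∈ J) {A B : Piece k P r}
    (h : S.Step D I A B) : ∃ w ∈ J, B.mono.deg = A.mono.deg + w := by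
  cases h with
  | interior s hs _ _ _ hm _ => exact hm.exists_deg hI hs.ne'
  | anticlockwise _ _ _ M hM hdir hm _ =>
    obtain ⟨w, hw⟩ := exists_deg_of_eq_or_bends hM
    rw [hm]
    exact ⟨_, AddSemigroupIdeal.add_mem J w (nsmul_mem_of_pos (hκ _) hdir),
      by rw [hw, add_assoc]⟩
  | clockwise _ _ _ M hM hdir hm _ =>
    obtain ⟨w, hw⟩ := exists_deg_of_eq_or_bends hM
    rw [hm]
    exact ⟨_, AddSemigroupIdeal.add_mem J w (nsmul_mem_of_pos (hκ _) hdir),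
      by rw [hw, add_assoc]⟩

theorem Step.coeff_dvd {A B : Piece k P r} (h : S.Step D I A B) :
    A.mono.coeff ∣ B.mono.coeff := by
  cases h with
  | interior s hs _ _ _ hm _ => exact hm.coeff_dvd
  | anticlockwise _ _ _ M hM hdir hm _ =>
    have h := coeff_dvd_of_eq_or_bends hM
    rwa [hm]
  | clockwise _ _ _ M hM hdir hm _ =>
    have h := coeff_dvd_of_eq_or_bends hM
    rwa [hm]

theorem eq_of_smul_primGen_eq {s s' : ℚ} {a a' : ℤ} (ha : a ≠ 0)
    (h : a • primGen s = a' • primGen s') : s = s' := by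
  simp only [primGen, Prod.smul_mk, smul_eq_mul, Prod.mk.injEq] at h
  obtain ⟨h1, h2⟩ := h
  have h1' : (a : ℚ) * s.den = a' * s'.den := by exact_mod_cast h1
  have h2' : (a : ℚ) * s.num = a' * s'.num := by exact_mod_cast h2
  have hd : (s.den : ℚ) ≠ 0 := by exact_mod_cast s.den_nz
  have hd' : (s'.den : ℚ) ≠ 0 := by exact_mod_cast s'.den_nz
  have ha' : (a : ℚ) ≠ 0 := by exact_mod_cast ha
  have e : s * s.den = s.num := Rat.mul_den_eq_num s
  have e' : s' * s'.den = s'.num := Rat.mul_den_eq_num s'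
  rw [← e, ← e'] at h2'
  have : (a * s.den : ℚ) * (s - s') = 0 := by
    linear_combination h2' - s' * h1'
  rcases mul_eq_zero.1 this with h0 | h0
  · exact absurd h0 (mul_ne_zero ha' hd)
  · exact sub_eq_zero.1 h0

/-- The change of direction is a nonzero multiple of m_𝔡, which determines the slope of the wall. -/
theorem eq_of_bends_of_bends {j : ZMod r} {s s' : ℚ} {A B : Mono k P}
    (h : S.Bends I j s (primGen s) A B) (h' : S.Bends I j s' (primGen s') A B) : s = s' := by
  obtain ⟨a, w, c, ha, -, -, -, hB⟩ := h
  obtain ⟨a', w', c', -, -, -, -, hB'⟩ := h'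
  refine eq_of_smul_primGen_eq ha (a' := a') ?_
  have := congrArg Mono.dir (hB.symm.trans hB')
  exact add_left_cancel this

/-- A bend at a ray makes the direction transverse to the ray. -/
theorem Bends.dir_ne {j : ZMod r} {s : ℚ} {A B : Mono k P}
    (h : S.Bends I j s (primGen s) A B) : (B.dir.2 : ℝ) - s * B.dir.1 ≠ 0 := by
  intro h0
  refine h.pairing_ne_zero ?_
  obtain ⟨a, w, c, -, -, -, -, rfl⟩ := h
  simp only [primGen, pairing, Prod.snd_add, Prod.fst_add, Prod.smul_mk, smul_eq_mul] at h0 ⊢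
  have e : (s : ℝ) * s.den = s.num := by exact_mod_cast Rat.mul_den_eq_num s
  -- Adding a multiple of m_𝔡 does not change the pairing with m_𝔡, so tangency after the bend means
  -- tangency before it.
  have hr : ((s.den * A.dir.2 - A.dir.1 * s.num : ℤ) : ℝ) = 0 := by
    push_cast at h0 ⊢
    linear_combination (s.den : ℝ) * h0 + (A.dir.1 + a * s.den : ℝ) * e
  exact_mod_cast hr

theorem one_ne_zero_and_two_ne_zero (hr : 3 ≤ r) :
    (1 : ZMod r) ≠ 0 ∧ (1 : ZMod r) + 1 ≠ 0 := by
  constructor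
  · have : ((1 : ℕ) : ZMod r) ≠ 0 := by
      rw [Ne, ZMod.natCast_eq_zero_iff]
      exact fun h => absurd (Nat.le_of_dvd one_pos h) (by omega)
    simpa using this
  · have : ((2 : ℕ) : ZMod r) ≠ 0 := by
      rw [Ne, ZMod.natCast_eq_zero_iff]
      exact fun h => absurd (Nat.le_of_dvd two_pos h) (by omega)
    rwa [Nat.cast_ofNat, ← one_add_one_eq_two] at this

theorem ne_add_one (hr : 3 ≤ r) (a : ZMod r) : a ≠ a + 1 := fun h =>
  (one_ne_zero_and_two_ne_zero hr).1 (left_eq_add.1 h)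

theorem ne_sub_one (hr : 3 ≤ r) (a : ZMod r) : a ≠ a - 1 := fun h =>
  (one_ne_zero_and_two_ne_zero hr).1 (sub_eq_self.1 h.symm)

theorem add_one_ne_sub_one (hr : 3 ≤ r) (a : ZMod r) : a + 1 ≠ a - 1 := fun h =>
  (one_ne_zero_and_two_ne_zero hr).2 (by linear_combination h)

/-- The endpoint of a piece of a broken line is determined by the next piece. -/
theorem Step.endPt_eq (hr : 3 ≤ r) {A A' B : Piece k P r} (h : S.Step D I A B)
    (h' : S.Step D I A' B) (hc : A.cone = A'.cone) (hm : A.mono = A'.mono) :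
    A.endPt = A'.endPt := by
  -- As r ≥ 3, the change of cone (0, 1 or -1) determines the kind of step, which removes the mixed
  -- cases. In the others the backward line of `B` meets the wall transversally, hence at one point
  -- only.
  rcases h with ⟨s, hs, h1, h2, hcB, hmB, τ, hτ, hpos, -⟩ |
    ⟨h1, h2, hcB, M, hM, hdir, hmB, τ, hτ, hpos, -⟩ |
    ⟨h1, h2, hcB, M, hM, hdir, hmB, τ, hτ, hpos, -⟩ <;>
  rcases h' with ⟨s', hs', h1', h2', hcB', hmB', τ', hτ', hpos', -⟩ |
    ⟨h1', h2', hcB', M', hM', hdir', hmB', τ', hτ', hpos', -⟩ |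
    ⟨h1', h2', hcB', M', hM', hdir', hmB', τ', hτ', hpos', -⟩
  · rw [← hc, ← hm] at hmB'
    obtain rfl := eq_of_bends_of_bends hmB hmB'
    have hne := hmB.dir_ne
    rw [← hpos, ← hpos']
    rw [← hpos] at h2
    rw [← hpos'] at h2'
    simp only [Piece.pos] at h2 h2'
    have : (τ - τ') * ((B.mono.dir.2 : ℝ) - s * B.mono.dir.1) = 0 := by
      linear_combination h2 - h2'
    rcases mul_eq_zero.1 this with h0 | h0
    · rw [sub_eq_zero.1 h0]
    · exact absurd h0 hne
  · exact absurd (hcB.symm.trans (hcB'.trans (by rw [hc]))) (ne_add_one hr _)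
  · exact absurd (hcB.symm.trans (hcB'.trans (by rw [hc]))) (ne_sub_one hr _)
  · exact absurd (hcB'.symm.trans (hcB.trans (by rw [hc]))) (ne_add_one hr _)
  · have hne : (B.mono.dir.2 : ℝ) < 0 := by
      rw [hmB]
      exact_mod_cast neg_neg_of_pos hdir
    have e : (A.endPt.2, (0 : ℝ)) = (A'.endPt.2, 0) := by
      rw [← hpos, ← hpos']
      have e1 := congrArg Prod.snd hpos
      have e2 := congrArg Prod.snd hpos'
      simp only [Piece.pos] at e1 e2
      have : (τ - τ') * (B.mono.dir.2 : ℝ) = 0 := by linear_combination e1 - e2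
      rcases mul_eq_zero.1 this with h0 | h0
      · rw [sub_eq_zero.1 h0]
      · exact absurd h0 hne.ne
    exact Prod.ext (h1.trans h1'.symm) (congrArg Prod.fst e)
  · exact absurd (hcB.symm.trans (hcB'.trans (by rw [hc]))) (add_one_ne_sub_one hr _)
  · exact absurd (hcB'.symm.trans (hcB.trans (by rw [hc]))) (ne_sub_one hr _)
  · exact absurd (hcB'.symm.trans (hcB.trans (by rw [hc]))) (add_one_ne_sub_one hr _)
  · have hne : (B.mono.dir.1 : ℝ) < 0 := by
      rw [hmB]
      exact_mod_cast neg_neg_of_pos hdir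
    have e : ((0 : ℝ), A.endPt.1) = (0, A'.endPt.1) := by
      rw [← hpos, ← hpos']
      have e1 := congrArg Prod.fst hpos
      have e2 := congrArg Prod.fst hpos'
      simp only [Piece.pos] at e1 e2
      have : (τ - τ') * (B.mono.dir.1 : ℝ) = 0 := by linear_combination e1 - e2
      rcases mul_eq_zero.1 this with h0 | h0
      · rw [sub_eq_zero.1 h0]
      · exact absurd h0 hne.ne
    exact Prod.ext (congrArg Prod.snd e) (h2.trans h2'.symm)

/-- The piece without its endpoint. -/
def pieceKey (A : Piece k P r) : ZMod r × Mono k P := (A.cone, A.mono)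

/-- A broken line is rebuilt from its endpoint backwards: given the cones and monomials, each piece
determines where the previous one ends. This reduces counting broken lines to counting lists of
discrete data. -/
theorem eq_of_pieceKey_eq (hr : 3 ≤ r) {l l' : List (Piece k P r)} {B B' : Piece k P r}
    (hl : (l ++ [B]).IsChain (S.Step D I)) (hl' : (l' ++ [B']).IsChain (S.Step D I))
    (hkey : (l ++ [B]).map pieceKey = (l' ++ [B']).map pieceKey) (hB : B.endPt = B'.endPt) :
    l ++ [B] = l' ++ [B'] := by
  have hext : ∀ A A' : Piece k P r, pieceKey A = pieceKey A' → A.endPt = A'.endPt → A = A' := by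
    rintro ⟨_, _, _⟩ ⟨_, _, _⟩ h h'
    simp only [pieceKey, Prod.mk.injEq] at h
    obtain ⟨rfl, rfl⟩ := h
    cases h'
    rfl
  induction l generalizing l' with
  | nil =>
    cases l' with
    | nil =>
      simp only [List.nil_append, List.map_cons, List.map_nil, List.cons.injEq, and_true] at hkey
      rw [hext B B' hkey hB]
    | cons A' l' => simp at hkey
  | cons A l ih =>
    cases l' with
    | nil => simp at hkey
    | cons A' l' =>
      rw [List.cons_append, List.isChain_cons] at hl hl'
      rw [List.cons_append, List.cons_append, List.map_cons, List.map_cons,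
        List.cons.injEq] at hkey
      have htail := ih hl.2 hl'.2 hkey.2
      rw [List.cons_append, List.cons_append, htail]
      congr 1
      obtain ⟨C, hC⟩ : ∃ C, C ∈ (l' ++ [B']).head? := by
        cases l' <;> simp
      have hs := hl.1 C (htail ▸ hC)
      have hs' := hl'.1 C hC
      have hk := hkey.1
      simp only [pieceKey, Prod.mk.injEq] at hk
      exact hext A A' hkey.1 (hs.endPt_eq hr hs' hk.1 hk.2)

end QuantumScattering

end Scattering

section Scattering

variable {k : Type*} [Field k] [CharZero k] {P : Type*} [AddCommMonoid P] {r : ℕ}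

namespace QuantumScattering

variable {i : k} {κ : ZMod r → P} {J : AddSemigroupIdeal P}
  {S : QuantumScattering i κ J} {D : ZMod r → ℤ} {I : AddSemigroupIdeal P}

/-! ### Finiteness of the set of broken lines -/

theorem exists_mem_head? {α : Type*} (l : List α) (B : α) : ∃ C, C ∈ (l ++ [B]).head? := by
  cases l <;> simp

/-- Every step multiplies by a monomial of J. The exponent `n` at the head is left free for the
induction. -/
theorem zP_deg_mem_pow (hI : IsRadicalOf J I) (hκ : ∀ j, κ j ∈ J) {l : List (Piece k P r)}
    {B : Piece k P r} (hl : (l ++ [B]).IsChain (S.Step D I)) (n : ℕ)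
    (h : ∀ A ∈ (l ++ [B]).head?, zP k I A.mono.deg ∈ adicIdeal k J I ^ n) :
    zP k I B.mono.deg ∈ adicIdeal k J I ^ (n + l.length) := by
  induction l generalizing n with
  | nil => exact h B (by simp)
  | cons A l ih =>
    rw [List.cons_append, List.isChain_cons] at hl
    have := ih hl.2 (n + 1) fun C hC => by
      obtain ⟨w, hw, hdeg⟩ := (hl.1 C hC).exists_deg hI hκ
      rw [hdeg, zP_add, Submodule.pow_succ]
      exact Ideal.mul_mem_mul (h A (by simp)) (zP_mem_adicIdeal hw)
    rwa [List.length_cons, Nat.add_comm l.length, ← Nat.add_assoc]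

namespace BrokenLine

variable {p : IntPoint r} {j : ZMod r} {z : ℝ × ℝ}

theorem ext {γ γ' : S.BrokenLine D I p j z} (h : γ.init ++ [γ.last] = γ'.init ++ [γ'.last]) :
    γ = γ' := by
  obtain ⟨l, B, _, _, _, _⟩ := γ
  obtain ⟨l', B', _, _, _, _⟩ := γ'
  obtain ⟨rfl, h'⟩ := List.append_inj' h rfl
  cases h'
  rfl

theorem mono_of_mem_head? (γ : S.BrokenLine D I p j z) {A : Piece k P r}
    (hA : A ∈ (γ.init ++ [γ.last]).head?) : A.mono = ⟨p.coords A.cone, 0, 1⟩ := by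
  rcases γ.start with ⟨hp, hinit, hlast⟩ | ⟨-, h⟩
  · rw [hinit] at hA
    simp only [List.nil_append, List.head?_cons, Option.mem_some_iff] at hA
    subst hA
    rw [hlast]
    have h0 : p.coords γ.last.cone = 0 := by simp [IntPoint.coords, hp _]
    rw [h0]
  · exact (h A hA).2.1

theorem c_mem_pow (hI : IsRadicalOf J I) (hκ : ∀ j, κ j ∈ J) (γ : S.BrokenLine D I p j z) :
    γ.c ∈ adicIdeal k J I ^ γ.init.length := by
  refine Ideal.mul_mem_left _ _ ?_
  have := zP_deg_mem_pow hI hκ γ.chain 0 fun A hA => by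
    rw [γ.mono_of_mem_head? hA, zP_zero]
    simp
  rwa [Nat.zero_add] at this

theorem length_lt_of_c_ne_zero (hI : IsRadicalOf J I) (hκ : ∀ j, κ j ∈ J) {N : ℕ}
    (hN : adicIdeal k J I ^ N = ⊥) (γ : S.BrokenLine D I p j z) (hc : γ.c ≠ 0) :
    γ.init.length < N := by
  by_contra h
  refine hc ?_
  have := Ideal.pow_le_pow_right (not_lt.1 h) (γ.c_mem_pow hI hκ)
  rwa [hN, Ideal.mem_bot] at this

theorem not_dvd_of_coeff_c_ne_zero (γ : S.BrokenLine D I p j z) {n : ℕ}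
    (h : PowerSeries.coeff n γ.c ≠ 0) :
    ¬ PowerSeries.X ^ (n + 1) ∣ γ.last.mono.coeff := by
  rintro ⟨y, hy⟩
  refine h (PowerSeries.X_pow_dvd_iff.1 (?_ : PowerSeries.X ^ (n + 1) ∣ γ.c) n (Nat.lt_succ_self n))
  rw [c, hy, map_mul, map_pow, toRIh, PowerSeries.map_X]
  exact (Dvd.intro _ rfl).mul_right _

end BrokenLine

/-- Coefficients divide one another along a broken line, so if the last is nonzero modulo ħ^(n+1),
so are all the earlier ones. -/
theorem isChain_pieceKey {n : ℕ} {l : List (Piece k P r)} {B : Piece k P r}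
    (hl : (l ++ [B]).IsChain (S.Step D I)) (hB : ¬ PowerSeries.X ^ (n + 1) ∣ B.mono.coeff) :
    ((l ++ [B]).map pieceKey).IsChain (fun x y : ZMod r × Mono k P =>
      (∃ A A', S.Step D I A A' ∧ pieceKey A = x ∧ pieceKey A' = y) ∧
        ¬ PowerSeries.X ^ (n + 1) ∣ y.2.coeff) ∧
    ∀ A ∈ (l ++ [B]).head?, ¬ PowerSeries.X ^ (n + 1) ∣ A.mono.coeff := by
  induction l with
  | nil => simpa using hB
  | cons A l ih =>
    rw [List.cons_append, List.isChain_cons] at hl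
    obtain ⟨ih1, ih2⟩ := ih hl.2
    obtain ⟨C, hC⟩ := exists_mem_head? l B
    refine ⟨?_, ?_⟩
    · rw [List.cons_append, List.map_cons, List.isChain_cons]
      refine ⟨?_, ih1⟩
      intro y hy
      rw [List.head?_map, Option.mem_map] at hy
      obtain ⟨C', hC', rfl⟩ := hy
      exact ⟨⟨A, C', hl.1 C' hC', rfl, rfl⟩, ih2 C' hC'⟩
    · intro A' hA'
      simp only [List.cons_append, List.head?_cons, Option.mem_some_iff] at hA'
      subst hA'
      exact fun h => ih2 C hC (h.trans (hl.1 C hC).coeff_dvd)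

theorem finite_step_key (hI : IsRadicalOf J I) (n : ℕ) (x : ZMod r × Mono k P) :
    {y : ZMod r × Mono k P | (∃ A A', S.Step D I A A' ∧ pieceKey A = x ∧ pieceKey A' = y) ∧
        ¬ PowerSeries.X ^ (n + 1) ∣ y.2.coeff}.Finite := by
  have h1 := (S.finite_walls hI x.1).biUnion fun s _ =>
    finite_bends (S := S) (I := I) x.1 s (primGen s) x.2 n
  have h2 := (Set.finite_singleton x.2).union
    (finite_bends (S := S) (I := I) (x.1 + 1) 0 (0, 1) x.2 n)
  have h3 := (Set.finite_singleton x.2).union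
    (finite_bends (S := S) (I := I) x.1 0 (1, 0) x.2 n)
  refine (((h1.image fun M => (x.1, M)).union
    (h2.image fun M : Mono k P => (x.1 + 1, (⟨(M.dir.2 - D (x.1 + 1) * M.dir.1, -M.dir.1),
        M.deg + M.dir.1.toNat • κ (x.1 + 1), M.coeff⟩ : Mono k P)))).union
    (h3.image fun M : Mono k P => (x.1 - 1, (⟨(-M.dir.2, M.dir.1 - D x.1 * M.dir.2),
        M.deg + M.dir.2.toNat • κ x.1, M.coeff⟩ : Mono k P)))).subset ?_
  rintro _ ⟨⟨A, B, hs, rfl, rfl⟩, hX⟩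
  cases hs with
  | interior s hs _ _ hc hm _ =>
    refine Or.inl (Or.inl ⟨B.mono, ?_, ?_⟩)
    · exact Set.mem_biUnion (hm.mem_walls hs) ⟨hm, hX⟩
    · simp [pieceKey, hc]
  | anticlockwise _ _ hc M hM hdir hm _ =>
    refine Or.inl (Or.inr ⟨M, ?_, ?_⟩)
    · rcases hM with hM | hM
      · exact Or.inl hM
      · refine Or.inr ⟨hM, ?_⟩
        simp only [pieceKey, hm] at hX
        exact hX
    · simp [pieceKey, hc, hm]
  | clockwise _ _ hc M hM hdir hm _ =>
    refine Or.inr ⟨M, ?_, ?_⟩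
    · rcases hM with hM | hM
      · exact Or.inl hM
      · refine Or.inr ⟨hM, ?_⟩
        simp only [pieceKey, hm] at hX
        exact hX
    · simp [pieceKey, hc, hm]

/-- The cone and the direction of a piece. -/
def pieceDir (A : Piece k P r) : ZMod r × (ℤ × ℤ) := (A.cone, A.mono.dir)

theorem finite_step_dir (hI : IsRadicalOf J I) (x : ZMod r × (ℤ × ℤ)) :
    {y : ZMod r × (ℤ × ℤ) |
      ∃ A A', S.Step D I A A' ∧ pieceDir A = x ∧ pieceDir A' = y}.Finite := by
  have h1 := (S.finite_walls hI x.1).biUnion fun s _ =>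
    finite_bends_dir (S := S) (I := I) x.1 s (primGen s) x.2
  have h2 := (Set.finite_singleton x.2).union
    (finite_bends_dir (S := S) (I := I) (x.1 + 1) 0 (0, 1) x.2)
  have h3 := (Set.finite_singleton x.2).union
    (finite_bends_dir (S := S) (I := I) x.1 0 (1, 0) x.2)
  refine (((h1.image fun d => (x.1, d)).union
    (h2.image fun d => (x.1 + 1, (d.2 - D (x.1 + 1) * d.1, -d.1)))).union
    (h3.image fun d => (x.1 - 1, (-d.2, d.1 - D x.1 * d.2)))).subset ?_
  rintro _ ⟨A, B, hs, rfl, rfl⟩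
  cases hs with
  | interior s hs _ _ hc hm _ =>
    refine Or.inl (Or.inl ⟨B.mono.dir, ?_, ?_⟩)
    · exact Set.mem_biUnion (hm.mem_walls hs) ⟨_, _, hm, rfl, rfl⟩
    · simp [pieceDir, hc]
  | anticlockwise _ _ hc M hM hdir hm _ =>
    refine Or.inl (Or.inr ⟨M.dir, ?_, ?_⟩)
    · rcases hM with hM | hM
      · exact Or.inl (by rw [hM]; rfl)
      · exact Or.inr ⟨_, _, hM, rfl, rfl⟩
    · simp [pieceDir, hc, hm]
  | clockwise _ _ hc M hM hdir hm _ =>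
    refine Or.inr ⟨M.dir, ?_, ?_⟩
    · rcases hM with hM | hM
      · exact Or.inl (by rw [hM]; rfl)
      · exact Or.inr ⟨_, _, hM, rfl, rfl⟩
    · simp [pieceDir, hc, hm]

/-! ### Convergence of the sums over broken lines -/

section Finiteness

variable [IsToricMonoid P] (p : IntPoint r) (j : ZMod r) (z : ℝ × ℝ)

/-- Each power of `ħ` occurs in finitely many final monomials only. -/
theorem finite_coeff_c_ne_zero (hr : 3 ≤ r) (hκ : ∀ j, κ j ∈ J) (hI : IsRadicalOf J I) (n : ℕ) :
    {γ : S.BrokenLine D I p j z | PowerSeries.coeff n γ.c ≠ 0}.Finite := by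
  have : NeZero r := ⟨by omega⟩
  obtain ⟨N, hN⟩ := exists_adicIdeal_pow_eq_bot (k := k) hI
  -- A broken line with nonzero contribution has fewer than N pieces before the last one, hence at
  -- most N in all. Its first monomial is z^p in one of the r cones.
  have hfin := (Finset.range (N + 1)).finite_toSet.biUnion fun L _ =>
    finite_chains (finite_step_key (S := S) (D := D) hI n) L
      (Set.finite_range fun l : ZMod r => (l, (⟨p.coords l, 0, 1⟩ : Mono k P)))
  refine Set.Finite.of_finite_image (f := fun γ => (γ.init ++ [γ.last]).map pieceKey)
    (hfin.subset ?_) ?_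
  · rintro _ ⟨γ, hγ, rfl⟩
    have hlen := γ.length_lt_of_c_ne_zero hI hκ hN (fun h => hγ (by rw [h, map_zero]))
    refine Set.mem_biUnion (x := γ.init.length + 1)
      (Finset.mem_coe.2 (Finset.mem_range.2 (by omega))) ⟨by simp, ?_, ?_⟩
    · exact (isChain_pieceKey γ.chain (γ.not_dvd_of_coeff_c_ne_zero hγ)).1
    · intro x hx
      rw [List.head?_map, Option.mem_map] at hx
      obtain ⟨A, hA, rfl⟩ := hx
      exact ⟨A.cone, by simp [pieceKey, γ.mono_of_mem_head? hA]⟩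
  · intro γ _ γ' _ h
    exact BrokenLine.ext (eq_of_pieceKey_eq hr γ.chain γ'.chain h
      (γ.last_endPt.trans γ'.last_endPt.symm))

/-- Finitely many exponents occur in the final monomials. -/
theorem finite_s (hr : 3 ≤ r) (hκ : ∀ j, κ j ∈ J) (hI : IsRadicalOf J I) :
    {m | ∃ γ : S.BrokenLine D I p j z, γ.c ≠ 0 ∧ γ.s = m}.Finite := by
  have : NeZero r := ⟨by omega⟩
  obtain ⟨N, hN⟩ := exists_adicIdeal_pow_eq_bot (k := k) hI
  have hfin := (Finset.range (N + 1)).finite_toSet.biUnion fun L _ =>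
    finite_chains (finite_step_dir (S := S) (D := D) hI) L
      (Set.finite_range fun l : ZMod r => (l, p.coords l))
  refine (hfin.image fun l => (l.getLast?.getD (0, 0)).2).subset ?_
  rintro _ ⟨γ, hγ, rfl⟩
  have hlen := γ.length_lt_of_c_ne_zero hI hκ hN hγ
  refine ⟨(γ.init ++ [γ.last]).map pieceDir, ?_, ?_⟩
  · refine Set.mem_biUnion (x := γ.init.length + 1)
      (Finset.mem_coe.2 (Finset.mem_range.2 (by omega))) ⟨by simp, ?_, ?_⟩
    · rw [List.isChain_map]
      exact γ.chain.imp fun A B h => ⟨A, B, h, rfl, rfl⟩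
    · intro x hx
      rw [List.head?_map, Option.mem_map] at hx
      obtain ⟨A, hA, rfl⟩ := hx
      exact ⟨A.cone, by simp [pieceDir, γ.mono_of_mem_head? hA]⟩
  · simp [pieceDir, BrokenLine.s]

/-- By `finite_s` the outer sum in the definition of the lift is a genuine finite sum and not a
default value. -/
theorem coeff_lift (hr : 3 ≤ r) (hκ : ∀ j, κ j ∈ J) (hI : IsRadicalOf J I) (m : ℤ × ℤ) :
    QTorus.coeff (S.lift D I p j z) m =
      hSum fun γ : {γ : S.BrokenLine D I p j z // γ.s = m} => γ.1.c := by
  have hzero : ∀ m, (∀ γ : S.BrokenLine D I p j z, γ.s = m → γ.c = 0) →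
      (hSum fun γ : {γ : S.BrokenLine D I p j z // γ.s = m} => γ.1.c) = 0 := by
    intro m h
    ext n : 1
    rw [hSum, PowerSeries.coeff_mk, map_zero]
    refine finsum_eq_zero_of_forall_eq_zero fun γ => ?_
    rw [h γ.1 γ.2, map_zero]
  have hfin := finite_s (S := S) (D := D) p j z hr hκ hI
  have hout : ∀ m ∉ hfin.toFinset,
      (hSum fun γ : {γ : S.BrokenLine D I p j z // γ.s = m} => γ.1.c) = 0 := by
    intro m hm
    refine hzero m fun γ hγ => ?_
    by_contra hc
    exact hm (hfin.mem_toFinset.2 ⟨γ, hc, hγ⟩)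
  rw [lift, finsum_eq_sum_of_support_subset _ (s := hfin.toFinset), QTorus.coeff_sum]
  · simp only [QTorus.coeff_term, Finset.sum_ite_eq']
    split_ifs with h
    · rfl
    · exact (hout m h).symm
  · intro m hm
    by_contra h
    refine hm ?_
    beta_reduce
    rw [hout m h, QTorus.term_zero]

end Finiteness

/-! ### Straight broken lines -/

section Straight

variable {p : IntPoint r} {j : ZMod r} {z : ℝ × ℝ}

theorem cone_of_init_eq_nil (γ : S.BrokenLine D I p j z) (h : γ.init = []) :
    γ.last = ⟨j, ⟨p.coords j, 0, 1⟩, z⟩ ∧ p.InCone j := by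
  have hmono := γ.mono_of_mem_head? (A := γ.last) (by simp [h])
  rw [γ.last_cone] at hmono
  have h1 : γ.last = ⟨γ.last.cone, γ.last.mono, γ.last.endPt⟩ := rfl
  rw [hmono, γ.last_cone, γ.last_endPt] at h1
  refine ⟨h1, ?_⟩
  rcases γ.start with ⟨hp, -, -⟩ | ⟨-, hs⟩
  · exact fun l _ _ => hp l
  · have := (hs γ.last (by simp [h])).1
    rwa [γ.last_cone] at this

variable (S D I) in
/-- The broken line without bends that stays in one cone. -/
def straight (hp : p.InCone j) (h1 : 0 < z.1) (h2 : 0 < z.2) : S.BrokenLine D I p j z where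
  init := []
  last := ⟨j, ⟨p.coords j, 0, 1⟩, z⟩
  start := by
    by_cases h0 : p.IsOrigin
    · refine Or.inl ⟨h0, rfl, ?_⟩
      have : p.coords j = 0 := by simp [IntPoint.coords, h0 _]
      rw [this]
    · refine Or.inr ⟨h0, fun A hA => ?_⟩
      simp only [List.nil_append, List.head?_cons, Option.mem_some_iff] at hA
      subst hA
      refine ⟨hp, rfl, fun t ht => ?_⟩
      simp only [Piece.pos, IntPoint.coords, Int.cast_natCast]
      exact ⟨by positivity, by positivity⟩
  chain := by simp
  last_cone := rfl
  last_endPt := rfl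

-- For a given exponent there is at most one straight broken line, and it exists exactly when the
-- charge lies in the cone and equals the exponent. The indicator form serves both for exact
-- computations and for those modulo J.
open Classical in
theorem hSum_straight (h1 : 0 < z.1) (h2 : 0 < z.2) (m : ℤ × ℤ) (n : ℕ) :
    {γ : {γ : S.BrokenLine D I p j z // γ.s = m} | PowerSeries.coeff n
      (if γ.1.init = [] then 1 else 0 : RIh k I) ≠ 0}.Finite ∧
    ∑ᶠ γ : {γ : S.BrokenLine D I p j z // γ.s = m},
      PowerSeries.coeff n (if γ.1.init = [] then 1 else 0 : RIh k I) =
        PowerSeries.coeff n (if p.InCone j ∧ p.coords j = m then 1 else 0 : RIh k I) := by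
  have huniq : ∀ γ γ' : {γ : S.BrokenLine D I p j z // γ.s = m}, γ.1.init = [] →
      γ'.1.init = [] → γ = γ' := by
    intro γ γ' h h'
    refine Subtype.ext (BrokenLine.ext ?_)
    rw [h, h', (cone_of_init_eq_nil γ.1 h).1, (cone_of_init_eq_nil γ'.1 h').1]
  constructor
  · refine Set.Subsingleton.finite fun γ hγ γ' hγ' => huniq γ γ' ?_ ?_
    · by_contra h
      rw [Set.mem_ofPred_eq, if_neg h, map_zero] at hγ
      exact hγ rfl
    · by_contra h
      rw [Set.mem_ofPred_eq, if_neg h, map_zero] at hγ'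
      exact hγ' rfl
  · split_ifs with h
    · rw [finsum_eq_single _ ⟨straight S D I h.1 h1 h2, h.2⟩]
      · exact congrArg _ (if_pos rfl)
      · intro γ hγ
        rw [if_neg (fun h' => hγ (huniq _ _ h' rfl)), map_zero]
    · rw [map_zero]
      refine finsum_eq_zero_of_forall_eq_zero fun γ => ?_
      rw [if_neg, map_zero]
      intro h'
      obtain ⟨h3, h4⟩ := cone_of_init_eq_nil γ.1 h'
      refine h ⟨h4, ?_⟩
      have := γ.2
      rwa [BrokenLine.s, h3] at this

theorem c_of_init_eq_nil (γ : S.BrokenLine D I p j z) (h : γ.init = []) : γ.c = 1 := by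
  rw [BrokenLine.c, (cone_of_init_eq_nil γ h).1, map_one, zP_zero, one_mul]

variable [IsToricMonoid P]

open Classical in
theorem coeff_lift_of_forall_straight (hr : 3 ≤ r) (hκ : ∀ j, κ j ∈ J) (hI : IsRadicalOf J I)
    (h1 : 0 < z.1) (h2 : 0 < z.2) {m : ℤ × ℤ}
    (h : ∀ γ : S.BrokenLine D I p j z, γ.s = m → γ.init = []) :
    QTorus.coeff (S.lift D I p j z) m = if p.InCone j ∧ p.coords j = m then 1 else 0 := by
  rw [coeff_lift p j z hr hκ hI]
  ext n : 1
  rw [← (hSum_straight (S := S) (D := D) h1 h2 m n).2, hSum, PowerSeries.coeff_mk]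
  refine finsum_congr fun γ => ?_
  rw [if_pos (h γ.1 γ.2), c_of_init_eq_nil γ.1 (h γ.1 γ.2)]

open Classical in
/-- Modulo `J`, only straight broken lines contribute. -/
theorem coeff_lift_sub_mem (hr : 3 ≤ r) (hκ : ∀ j, κ j ∈ J) (hI : IsRadicalOf J I)
    (h1 : 0 < z.1) (h2 : 0 < z.2) (m : ℤ × ℤ) :
    QTorus.coeff (S.lift D I p j z) m - (if p.InCone j ∧ p.coords j = m then 1 else 0) ∈
      adicIdeal k J I := by
  rw [mem_adicIdeal]
  intro n
  have hs := hSum_straight (S := S) (D := D) (I := I) (p := p) (j := j) h1 h2 m n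
  have hf : {γ : {γ : S.BrokenLine D I p j z // γ.s = m} |
      PowerSeries.coeff n γ.1.c ≠ 0}.Finite :=
    (finite_coeff_c_ne_zero (S := S) (D := D) p j z hr hκ hI n).preimage
      Subtype.val_injective.injOn
  rw [map_sub, ← hs.2, coeff_lift p j z hr hκ hI, hSum, PowerSeries.coeff_mk,
    ← finsum_sub_distrib hf hs.1]
  refine finsum_induction (· ∈ monomialIdealRI k J I) (Ideal.zero_mem _)
    (fun _ _ => Ideal.add_mem _) fun γ => ?_
  rw [← map_sub]
  refine mem_adicIdeal.1 ?_ n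
  split_ifs with h
  · rw [c_of_init_eq_nil γ.1 h, sub_self]
    exact Ideal.zero_mem _
  · rw [sub_zero]
    -- A broken line that is not straight has at least one step, so its coefficient lies in the
    -- first power of the ideal.
    exact Ideal.pow_le_self (fun h' => h (List.length_eq_zero_iff.1 h')) (γ.1.c_mem_pow hI hκ)

theorem lift_eq_one (hr : 3 ≤ r) (hκ : ∀ j, κ j ∈ J) (hI : IsRadicalOf J I)
    (h1 : 0 < z.1) (h2 : 0 < z.2) (hp : p.IsOrigin) : S.lift D I p j z = 1 := by
  classical
  refine QTorus.ext fun m => ?_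
  rw [coeff_lift_of_forall_straight hr hκ hI h1 h2]
  · change _ = QTorus.coeff (QTorus.term 0 1) m
    rw [QTorus.coeff_term]
    have hc : p.coords j = 0 := by simp [IntPoint.coords, hp _]
    have hin : p.InCone j := fun l _ _ => hp l
    simp [hc, hin]
  · intro γ _
    rcases γ.start with ⟨-, h, -⟩ | ⟨h, -⟩
    · exact h
    · exact absurd hp h

end Straight

end QuantumScattering

end Scattering

/-! ### Integral points -/

namespace IntPoint

variable {r : ℕ}

theorem ext_of_inCone {p p' : IntPoint r} {j : ZMod r} (hp : p.InCone j) (hp' : p'.InCone j)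
    (h : p.coords j = p'.coords j) : p = p' := by
  simp only [coords, Prod.mk.injEq, Nat.cast_inj] at h
  refine Subtype.ext (funext fun l => ?_)
  by_cases h1 : l = j
  · rw [h1, h.1]
  · by_cases h2 : l = j + 1
    · rw [h2, h.2]
    · rw [hp l h1 h2, hp' l h1 h2]

theorem exists_coords_eq (hr : 3 ≤ r) (j : ZMod r) {m : ℤ × ℤ} (h1 : 0 ≤ m.1) (h2 : 0 ≤ m.2) :
    ∃ p : IntPoint r, p.InCone j ∧ p.coords j = m := by
  classical
  have hne : j + 1 ≠ j := (QuantumScattering.ne_add_one hr j).symm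
  have hin : ∀ l, l ≠ j → l ≠ j + 1 →
      (if l = j then m.1.toNat else if l = j + 1 then m.2.toNat else 0) = 0 := by
    intro l hl hl'
    rw [if_neg hl, if_neg hl']
  refine ⟨⟨fun l => if l = j then m.1.toNat else if l = j + 1 then m.2.toNat else 0, j, hin⟩,
    hin, ?_⟩
  simp only [coords, if_neg hne, if_true]
  exact Prod.ext (Int.toNat_of_nonneg h1) (Int.toNat_of_nonneg h2)

/-- Functions on the cones that agree along the rays agree at integral points. -/
theorem sub_mem_of_inCone {T : Type*} [CommRing T] {A : Ideal T} (hr : 3 ≤ r)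
    {G : ZMod r → ℤ × ℤ → T} (hG : ∀ j n, G (j + 1) (n, 0) - G j (0, n) ∈ A) (p : IntPoint r)
    {j l : ZMod r} (hj : p.InCone j) (hl : p.InCone l) :
    G j (p.coords j) - G l (p.coords l) ∈ A := by
  have : NeZero r := ⟨by omega⟩
  have h11 := (QuantumScattering.one_ne_zero_and_two_ne_zero hr).2
  have hadj : ∀ j, p.InCone j → p.InCone (j + 1) →
      G (j + 1) (p.coords (j + 1)) - G j (p.coords j) ∈ A := by
    intro j hj hl
    have e1 : p.1 j = 0 := hl j (QuantumScattering.ne_add_one hr j) fun h =>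
      h11 (by linear_combination -h)
    have e2 : p.1 (j + 1 + 1) = 0 := hj _ (fun h => h11 (by linear_combination h))
      (QuantumScattering.ne_add_one hr _).symm
    simp only [coords, e1, e2, Nat.cast_zero]
    exact hG j _
  by_cases h1 : j = l
  · rw [h1, sub_self]
    exact A.zero_mem
  by_cases h2 : j = l + 1
  · subst h2
    exact hadj l hl hj
  by_cases h3 : l = j + 1
  · subst h3
    rw [← neg_sub]
    exact A.neg_mem (hadj j hj hl)
  -- Cones that neither coincide nor are adjacent meet only in the origin; there the values are
  -- compared by going round the cycle.
  have hz : ∀ x, p.1 x = 0 := by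
    intro x
    by_cases hx : x = j
    · exact hl x (hx ▸ h1) (hx ▸ h2)
    · by_cases hx' : x = j + 1
      · refine hl x (fun h => h3 (h.symm.trans hx')) fun h => h1 ?_
        exact add_right_cancel (hx'.symm.trans h)
      · exact hj x hx hx'
  have hconst : ∀ n : ℕ, G n 0 - G 0 0 ∈ A := by
    intro n
    induction n with
    | zero => simp
    | succ n ih =>
      have := A.add_mem (hG n 0) ih
      rw [← Prod.zero_eq_mk, sub_add_sub_cancel] at this
      rwa [Nat.cast_succ]
  have hc : ∀ j : ZMod r, p.coords j = 0 := fun j => by simp [coords, hz]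
  rw [hc, hc]
  have := A.sub_mem (hconst j.val) (hconst l.val)
  simpa using this

end IntPoint

section Scattering

variable {k : Type*} [Field k] [CharZero k] {P : Type*} [AddCommMonoid P] {r : ℕ}

namespace QuantumScattering

variable {i : k} {κ : ZMod r → P} {J : AddSemigroupIdeal P}
  {S : QuantumScattering i κ J} {D : ZMod r → ℤ} {I : AddSemigroupIdeal P}

/-! ### Generic points -/

theorem exists_nearFirst (hI : IsRadicalOf J I) (j : ZMod r) {b : ℝ} (hb : 0 < b) :
    ∃ z, S.NearFirst I j z ∧ z.2 / z.1 < b := by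
  have hev : ∀ᶠ y : ℝ in nhdsWithin 0 (Set.Ioi 0), y < b ∧ ∀ s ∈ S.walls I j, y < s := by
    refine Filter.Eventually.filter_mono nhdsWithin_le_nhds (Filter.Eventually.and ?_ ?_)
    · exact eventually_lt_nhds hb
    · refine (Filter.eventually_all_finite (S.finite_walls hI j)).2 fun s hs => ?_
      exact eventually_lt_nhds (by exact_mod_cast hs.1)
  obtain ⟨u, hu, hsub⟩ := mem_nhdsGT_iff_exists_Ioo_subset.1 hev
  obtain ⟨y, hy, h0, hyu⟩ := exists_irrational_btwn (Set.mem_Ioi.1 hu)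
  obtain ⟨h1, h2⟩ := hsub ⟨h0, hyu⟩
  exact ⟨(1, y), ⟨⟨one_pos, h0, by simpa using hy⟩, fun s hs => by simpa using h2 s hs⟩,
    by simpa using h1⟩

theorem exists_nearSecond (hI : IsRadicalOf J I) (j : ZMod r) {b : ℝ} (hb : 0 < b) :
    ∃ z, S.NearSecond I j z ∧ b < z.2 / z.1 := by
  have hev : ∀ᶠ y : ℝ in Filter.atTop, b < y ∧ ∀ s ∈ S.walls I j, (s : ℝ) < y := by
    refine (Filter.eventually_gt_atTop b).and ?_
    exact (Filter.eventually_all_finite (S.finite_walls hI j)).2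
      fun s hs => Filter.eventually_gt_atTop _
  obtain ⟨u, hu⟩ := Filter.eventually_atTop.1 hev
  obtain ⟨y, hy, hyu, -⟩ := exists_irrational_btwn (lt_add_one u)
  obtain ⟨h1, h2⟩ := hu y hyu.le
  exact ⟨(1, y), ⟨⟨one_pos, hb.trans h1, by simpa using hy⟩, fun s hs => by simpa using h2 s hs⟩,
    by simpa using h1⟩

/-- The point (x, y x) has slope y, which may be chosen irrational. Approaching from above keeps
both coordinates positive even if a or b is 0. -/
theorem exists_isGeneric_near (a b : ℕ) {ε : ℝ} (hε : 0 < ε) :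
    ∃ z : ℝ × ℝ, IsGeneric z ∧ |z.1 - a| < ε ∧ |z.2 - b| < ε := by
  obtain ⟨x, hx1, hx2⟩ := exists_rat_btwn (show (a : ℝ) < a + ε by linarith)
  have ha : (0 : ℝ) ≤ a := a.cast_nonneg
  have hb : (0 : ℝ) ≤ b := b.cast_nonneg
  have hx : (0 : ℝ) < x := ha.trans_lt hx1
  obtain ⟨y, hy, hy1, hy2⟩ := exists_irrational_btwn
    (div_lt_div_of_pos_right (show (b : ℝ) < b + ε by linarith) hx)
  rw [div_lt_iff₀ hx] at hy1
  rw [lt_div_iff₀ hx] at hy2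
  refine ⟨(x, y * x), ⟨hx, hb.trans_lt hy1, ?_⟩, ?_, ?_⟩
  · rwa [mul_div_cancel_right₀ _ hx.ne']
  · rw [abs_lt]
    constructor <;> simp only <;> linarith
  · rw [abs_lt]
    constructor <;> simp only <;> linarith

theorem NearFirst.lt {j : ZMod r} {z : ℝ × ℝ} (h : S.NearFirst I j z) {s : ℚ}
    (hs : s ∈ S.walls I j) : z.2 / z.1 < s :=
  (div_lt_iff₀ h.1.1).2 (h.2 s hs)

theorem NearSecond.lt {j : ZMod r} {z : ℝ × ℝ} (h : S.NearSecond I j z) {s : ℚ}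
    (hs : s ∈ S.walls I j) : s < z.2 / z.1 :=
  (lt_div_iff₀ h.1.1).2 (h.2 s hs)

/-! ### Consistency -/

section Consistency

variable {p : IntPoint r}

/-- `Lift_z(p)` is the same for two points in one chamber. -/
theorem lift_eq_of_disjoint (hS : S.IsConsistent D) (hI : IsRadicalOf J I) (hp : ¬ p.IsOrigin)
    {j : ZMod r} {z z' : ℝ × ℝ} (hz : IsGeneric z) (hz' : IsGeneric z')
    (h : ∀ s ∈ S.walls I j, (z.2 / z.1 < s ↔ z'.2 / z'.1 < s)) :
    S.lift D I p j z = S.lift D I p j z' := by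
  have key : ∀ z z' : ℝ × ℝ, IsGeneric z → IsGeneric z' → z.2 / z.1 ≤ z'.2 / z'.1 →
      (∀ s ∈ S.walls I j, (z.2 / z.1 < s ↔ z'.2 / z'.1 < s)) →
      S.lift D I p j z = S.lift D I p j z' := by
    intro z z' hz hz' hle h
    rw [(hS I hI p hp).1 j z z' hz hz' hle, S.pathAut_empty, AlgHom.id_apply]
    refine Set.eq_empty_of_forall_notMem ?_
    rintro s ⟨hs, h1, h2⟩
    exact lt_asymm h2 ((h s hs).1 h1)
  rcases le_total (z.2 / z.1) (z'.2 / z'.1) with hle | hle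
  · exact key z z' hz hz' hle h
  · exact (key z' z hz' hz hle fun s hs => (h s hs).symm).symm

theorem lift_eq_of_nearFirst (hS : S.IsConsistent D) (hI : IsRadicalOf J I)
    (hp : ¬ p.IsOrigin) {j : ZMod r} {z z' : ℝ × ℝ} (hz : S.NearFirst I j z)
    (hz' : S.NearFirst I j z') : S.lift D I p j z = S.lift D I p j z' :=
  lift_eq_of_disjoint hS hI hp hz.1 hz'.1 fun _ hs => iff_of_true (hz.lt hs) (hz'.lt hs)

theorem lift_eq_of_nearSecond (hS : S.IsConsistent D) (hI : IsRadicalOf J I)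
    (hp : ¬ p.IsOrigin) {j : ZMod r} {z z' : ℝ × ℝ} (hz : S.NearSecond I j z)
    (hz' : S.NearSecond I j z') : S.lift D I p j z = S.lift D I p j z' :=
  lift_eq_of_disjoint hS hI hp hz.1 hz'.1 fun _ hs =>
    iff_of_false (hz.lt hs).not_gt (hz'.lt hs).not_gt

/-- `Lift_z(p)` is obtained from the lift near the first ray of the cone. -/
theorem pathAut_lift (hS : S.IsConsistent D) (hI : IsRadicalOf J I) (hp : ¬ p.IsOrigin)
    {j : ZMod r} {z z' : ℝ × ℝ} (hz : S.NearFirst I j z) (hz' : IsGeneric z') :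
    S.pathAut I j {s | (s : ℝ) < z'.2 / z'.1} (S.lift D I p j z) = S.lift D I p j z' := by
  -- Consistency compares points in increasing order of slope, so z is replaced by a point of its
  -- chamber with slope below that of z'.
  obtain ⟨w, hw, hlt⟩ := exists_nearFirst (S := S) hI j (div_pos hz'.2.1 hz'.1)
  rw [lift_eq_of_nearFirst hS hI hp hz hw, (hS I hI p hp).1 j w z' hw.1 hz' hlt.le]
  congr 1
  refine S.pathAut_congr I ?_
  ext s
  exact ⟨fun h => ⟨h.1, hw.lt h.1, h.2⟩, fun h => ⟨h.1, h.2.2⟩⟩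

/-! ### Theta functions -/

variable (S D I) in
/-- The restriction of a global section to the chamber after `ρ_j`. -/
def chartP (j : ZMod r) : S.globalSections D I →ₐ[RIh k I] RSigma i I :=
  (S.psiP D I j).comp ((Pi.evalAlgHom (RIh k I) (fun j => S.RRho D I j) j).comp
    (S.globalSections D I).val)

variable (S D I) in
/-- The restriction of a global section to the chamber before `ρ_j`. -/
def chartM (j : ZMod r) : S.globalSections D I →ₐ[RIh k I] RSigma i I :=
  (S.psiM D I j).comp ((Pi.evalAlgHom (RIh k I) (fun j => S.RRho D I j) j).comp
    (S.globalSections D I).val)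

variable (S D I) in
/-- The restriction of a global section to the chamber of a generic point of `σ_j`. -/
def chartAt (j : ZMod r) (z : ℝ × ℝ) : S.globalSections D I →ₐ[RIh k I] RSigma i I :=
  (S.pathAut I j {s | (s : ℝ) < z.2 / z.1}).comp (chartP S D I j)

theorem chartP_apply (j : ZMod r) (a : S.globalSections D I) :
    chartP S D I j a = S.psiP D I j (a.1 j) := rfl

theorem chartM_apply (j : ZMod r) (a : S.globalSections D I) :
    chartM S D I j a = S.psiM D I j (a.1 j) := rfl

theorem pathAut_chartP (j : ZMod r) (a : S.globalSections D I) :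
    S.pathAut I j Set.univ (chartP S D I j a) = chartM S D I (j + 1) a := a.2 j

theorem eq_of_chart_eq {a b : S.globalSections D I}
    (hP : ∀ j, chartP S D I j a = chartP S D I j b)
    (hM : ∀ j, chartM S D I j a = chartM S D I j b) : a = b := by
  refine Subtype.ext (funext fun j => ?_)
  rw [← sub_eq_zero]
  refine eq_zero_of_psi_eq_zero ?_ ?_
  · have := sub_eq_zero.2 (hP j)
    rwa [chartP_apply, chartP_apply, ← map_sub] at this
  · have := sub_eq_zero.2 (hM j)
    rwa [chartM_apply, chartM_apply, ← map_sub] at this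

/-- Consistency across ρ_j provides the local element, and consistency inside σ_j, from its first
chamber to its last, is the gluing condition. -/
theorem exists_isTheta (hS : S.IsConsistent D) (hI : IsRadicalOf J I) (p : IntPoint r) :
    ∃ a : S.globalSections D I, S.IsTheta D I p a := by
  by_cases hp : p.IsOrigin
  · exact ⟨1, Or.inl ⟨hp, rfl⟩⟩
  -- The bound 1 separates the slopes of z_j and w_j, so that they are ordered even if σ_j contains
  -- no walls.
  choose z hz using fun j => exists_nearFirst (S := S) hI j one_pos
  choose w hw using fun j => exists_nearSecond (S := S) hI j one_pos
  choose a ha using fun j => (hS I hI p hp).2 j (w (j - 1)) (z j) (hw _).1 (hz j).1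
  refine ⟨⟨a, fun j => ?_⟩, Or.inr ⟨hp, fun j => ⟨fun z' hz' => ?_, fun z' hz' => ?_⟩⟩⟩
  · rw [(ha j).2, (ha (j + 1)).1, add_sub_cancel_right,
      (hS I hI p hp).1 j (z j) (w j) (hz j).1.1 (hw j).1.1 ((hz j).2.trans (hw j).2).le]
    congr 1
    refine S.pathAut_congr I ?_
    ext s
    exact ⟨fun h => ⟨h.1, (hz j).1.lt h.1, (hw j).1.lt h.1⟩, fun h => ⟨h.1, trivial⟩⟩
  · rw [(ha j).1]
    exact lift_eq_of_nearSecond hS hI hp (hw _).1 hz'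
  · rw [(ha j).2]
    exact lift_eq_of_nearFirst hS hI hp (hz j).1 hz'

theorem IsTheta.unique (hI : IsRadicalOf J I) {a b : S.globalSections D I}
    (ha : S.IsTheta D I p a) (hb : S.IsTheta D I p b) : a = b := by
  rcases ha with ⟨hp, rfl⟩ | ⟨hp, ha⟩ <;> rcases hb with ⟨hp', rfl⟩ | ⟨hp', hb⟩
  · rfl
  · exact absurd hp hp'
  · exact absurd hp' hp
  · refine eq_of_chart_eq (fun j => ?_) fun j => ?_
    · obtain ⟨z, hz, -⟩ := exists_nearFirst (S := S) hI j one_pos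
      exact ((ha j).2 z hz).trans ((hb j).2 z hz).symm
    · obtain ⟨z, hz, -⟩ := exists_nearSecond (S := S) hI (j - 1) one_pos
      exact ((ha j).1 z hz).trans ((hb j).1 z hz).symm

variable [IsToricMonoid P]

theorem IsTheta.chartP_eq (hr : 3 ≤ r) (hκ : ∀ j, κ j ∈ J) (hI : IsRadicalOf J I)
    {a : S.globalSections D I} (ha : S.IsTheta D I p a) {j : ZMod r} {z : ℝ × ℝ}
    (hz : S.NearFirst I j z) : chartP S D I j a = S.lift D I p j z := by
  rcases ha with ⟨hp, rfl⟩ | ⟨hp, ha⟩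
  · rw [map_one, lift_eq_one hr hκ hI hz.1.1 hz.1.2.1 hp]
  · exact (ha j).2 z hz

theorem IsTheta.chartAt_eq (hr : 3 ≤ r) (hκ : ∀ j, κ j ∈ J) (hS : S.IsConsistent D)
    (hI : IsRadicalOf J I) {a : S.globalSections D I} (ha : S.IsTheta D I p a) {j : ZMod r}
    {z : ℝ × ℝ} (hz : IsGeneric z) : chartAt S D I j z a = S.lift D I p j z := by
  rcases ha with ⟨hp, rfl⟩ | ⟨hp, ha⟩
  · rw [map_one, lift_eq_one hr hκ hI hz.1 hz.2.1 hp]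
  · obtain ⟨w, hw, -⟩ := exists_nearFirst (S := S) hI j one_pos
    rw [chartAt, AlgHom.comp_apply, chartP_apply, (ha j).2 w hw]
    exact pathAut_lift hS hI hp hw hz

end Consistency

end QuantumScattering

end Scattering

section Scattering

variable {k : Type*} [Field k] [CharZero k] {P : Type*} [AddCommMonoid P] {r : ℕ}

namespace QuantumScattering

variable {i : k} {κ : ZMod r → P} {J : AddSemigroupIdeal P}
  {S : QuantumScattering i κ J} {D : ZMod r → ℤ} {I : AddSemigroupIdeal P}

/-! ### Broken lines that end near an integral point -/

/-- The line through a generic point close to `m` in the direction `m` meets the ray of slope `s`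
only in negative time. -/
theorem not_mem_ray_of_near {z m : ℝ × ℝ} {s : ℚ} {ε τ : ℝ} (hz : IsGeneric z) (hs : 0 < s)
    (h1 : |z.1 - m.1| < ε) (h2 : |z.2 - m.2| < ε)
    (hε : m.2 - s * m.1 ≠ 0 → ε * (1 + s) < |m.2 - s * m.1|) (hτ : 0 < τ) :
    z.2 + τ * m.2 ≠ s * (z.1 + τ * m.1) := by
  intro h
  have hs' : (0 : ℝ) < s := by exact_mod_cast hs
  -- If m lies on the line of slope s, a meeting point would force z onto it, against irrationality.
  -- Otherwise the linear form y - s x has the sign of its value at m along the whole half-line,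
  -- since z is close to m.
  by_cases hd : m.2 - s * m.1 = 0
  · refine hz.2.2 ⟨s, ?_⟩
    rw [eq_div_iff hz.1.ne']
    linear_combination -h + τ * hd
  · have he : (z.2 - m.2) - s * (z.1 - m.1) = -((1 + τ) * (m.2 - s * m.1)) := by
      linear_combination h
    have h3 : |(z.2 - m.2) - s * (z.1 - m.1)| ≤ |z.2 - m.2| + s * |z.1 - m.1| := by
      refine (abs_sub _ _).trans ?_
      rw [abs_mul, abs_of_pos hs']
    rw [he, abs_neg, abs_mul, abs_of_pos (by linarith)] at h3
    have h4 := hε hd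
    have h5 : 0 < |m.2 - s * m.1| := abs_pos.2 hd
    have h6 := mul_lt_mul_of_pos_left h1 hs'
    nlinarith [mul_pos hτ h5]

/-- Backwards from z the last piece moves in the direction p. It misses the finitely many walls
modulo I by the choice of ε, and its coordinates stay positive, so it never comes from a ray of the
fan. The bound ε does not involve the charge p'. -/
theorem exists_near (hr : 3 ≤ r) (hI : IsRadicalOf J I) (p : IntPoint r) :
    ∃ ε : ℝ, 0 < ε ∧ ∀ (j : ZMod r) (z : ℝ × ℝ), IsGeneric z →
      |z.1 - p.1 j| < ε → |z.2 - p.1 (j + 1)| < ε →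
      ∀ (p' : IntPoint r) (γ : S.BrokenLine D I p' j z), γ.s = p.coords j → γ.init = [] := by
  have : NeZero r := ⟨by omega⟩
  have hev : ∀ᶠ ε : ℝ in nhdsWithin 0 (Set.Ioi 0), ∀ j, ∀ s ∈ S.walls I j,
      (p.1 (j + 1) : ℝ) - s * p.1 j ≠ 0 →
        ε * (1 + s) < |(p.1 (j + 1) : ℝ) - s * p.1 j| := by
    refine Filter.Eventually.filter_mono nhdsWithin_le_nhds (Filter.eventually_all.2 fun j =>
      (Filter.eventually_all_finite (S.finite_walls hI j)).2 fun s hs => ?_)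
    by_cases hd : (p.1 (j + 1) : ℝ) - s * p.1 j = 0
    · exact Filter.Eventually.of_forall fun ε h => absurd hd h
    · have hc : Filter.Tendsto (fun ε : ℝ => ε * (1 + s)) (nhds 0) (nhds (0 * (1 + s))) :=
        (continuous_mul_const _).tendsto _
      rw [zero_mul] at hc
      exact (hc.eventually (eventually_lt_nhds (abs_pos.2 hd))).mono fun ε h _ => h
  obtain ⟨ε, hε, hpos⟩ := (hev.and self_mem_nhdsWithin).exists
  refine ⟨ε, hpos, fun j z hz h1 h2 p' γ hγ => ?_⟩
  by_contra hne
  obtain ⟨l, A, hl⟩ : ∃ l A, γ.init = l ++ [A] :=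
    ⟨_, _, (List.dropLast_append_getLast hne).symm⟩
  have hstep : S.Step D I A γ.last := by
    have := γ.chain
    rw [hl, List.append_assoc, List.singleton_append, List.isChain_split,
      List.isChain_pair] at this
    exact this.2
  have hdir : γ.last.mono.dir = p.coords j := hγ
  have hpt : ∀ t, γ.last.pos t = (z.1 + t * p.1 j, z.2 + t * p.1 (j + 1)) := by
    intro t
    rw [Piece.pos, hdir, γ.last_endPt]
    simp [IntPoint.coords]
  have hz1 := hz.1
  have hz2 := hz.2.1
  cases hstep with
  | interior s hs _ h4 hc hm hB =>
    obtain ⟨τ, hτ, hx, -⟩ := hB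
    rw [hpt] at hx
    rw [← hx] at h4
    rw [← hc, γ.last_cone] at hm
    exact not_mem_ray_of_near (m := (p.1 j, p.1 (j + 1))) hz hs h1 h2
      (hε j s (hm.mem_walls hs)) hτ h4
  | anticlockwise _ _ _ M _ _ _ hB =>
    obtain ⟨τ, hτ, hx, -⟩ := hB
    rw [hpt] at hx
    have := congrArg Prod.snd hx
    simp only at this
    have : 0 < z.2 + τ * p.1 (j + 1) := by positivity
    linarith
  | clockwise _ _ _ M _ _ _ hB =>
    obtain ⟨τ, hτ, hx, -⟩ := hB
    rw [hpt] at hx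
    have := congrArg Prod.fst hx
    simp only at this
    have : 0 < z.1 + τ * p.1 j := by positivity
    linarith

/-- The path automorphism across σ_j preserves the filtration, so it is enough to control the
chamber following each ρ_j. -/
theorem chartM_mem {n : ℕ} (hI : IsRadicalOf J I) {a : S.globalSections D I} {j : ZMod r}
    (h : chartP S D I j a ∈ adicIdeal k J I ^ n • (⊤ : Submodule (RIh k I) (RSigma i I))) :
    chartM S D I (j + 1) a ∈
      adicIdeal k J I ^ n • (⊤ : Submodule (RIh k I) (RSigma i I)) := by
  rw [← pathAut_chartP]
  have h1 := Submodule.smul_mono_left (Ideal.pow_le_pow_right n.le_succ)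
    (S.pathAut_sub_mem_pow hI j Set.univ n h)
  have h2 := Submodule.add_mem _ h1 h
  rwa [sub_add_cancel] at h2

variable [IsToricMonoid P]

open Classical in
/-- Near `p`, the monomial `z^p` occurs in the lift of `p` only. -/
theorem exists_near_coeff_lift (hr : 3 ≤ r) (hκ : ∀ j, κ j ∈ J) (hI : IsRadicalOf J I)
    (p : IntPoint r) :
    ∃ ε : ℝ, 0 < ε ∧ ∀ (j : ZMod r) (z : ℝ × ℝ), p.InCone j → IsGeneric z →
      |z.1 - p.1 j| < ε → |z.2 - p.1 (j + 1)| < ε →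
      ∀ p' : IntPoint r, QTorus.coeff (S.lift D I p' j z) (p.coords j) =
        if p' = p then 1 else 0 := by
  obtain ⟨ε, hε, h⟩ := exists_near (S := S) (D := D) hr hI p
  refine ⟨ε, hε, fun j z hp hz h1 h2 p' => ?_⟩
  rw [coeff_lift_of_forall_straight hr hκ hI hz.1 hz.2.1 (h j z hz h1 h2 p')]
  have : (p'.InCone j ∧ p'.coords j = p.coords j) ↔ p' = p := by
    constructor
    · rintro ⟨h3, h4⟩
      exact IntPoint.ext_of_inCone h3 hp h4
    · rintro rfl
      exact ⟨hp, rfl⟩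
  simp only [this]

/-! ### Theta functions generate -/

section Generation

variable {θ : IntPoint r → S.globalSections D I}

/-- One step of the approximation of a global section by theta functions. -/
theorem exists_approx (hr : 3 ≤ r) (hκ : ∀ j, κ j ∈ J) (hI : IsRadicalOf J I)
    (hθ : ∀ p, S.IsTheta D I p (θ p)) (n : ℕ) (a : S.globalSections D I)
    (ha : ∀ j, chartP S D I j a ∈
      adicIdeal k J I ^ n • (⊤ : Submodule (RIh k I) (RSigma i I))) :
    ∃ c : IntPoint r →₀ RIh k I, ∀ j, chartP S D I j (a - c.sum fun p x => x • θ p) ∈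
      adicIdeal k J I ^ (n + 1) • (⊤ : Submodule (RIh k I) (RSigma i I)) := by
  classical
  have : NeZero r := ⟨by omega⟩
  set A := adicIdeal k J I with hA
  have hAs : A ^ (n + 1) = A ^ n * A := Submodule.pow_succ _
  have haM : ∀ j, chartM S D I j a ∈
      A ^ n • (⊤ : Submodule (RIh k I) (RSigma i I)) := fun j => by
    have := chartM_mem hI (ha (j - 1))
    rwa [sub_add_cancel] at this
  set G : ZMod r → ℤ × ℤ → RIh k I := fun j m => QTorus.coeff (chartP S D I j a) m with hG
  have hPM : ∀ j m, QTorus.coeff (chartM S D I (j + 1) a) m - G j m ∈ A ^ (n + 1) := by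
    intro j m
    have := QTorus.mem_smul_top.1 (S.pathAut_sub_mem_pow hI j Set.univ n (ha j)) m
    rwa [QTorus.coeff_sub, pathAut_chartP] at this
  have hκA : ∀ j, zP k I (κ j) ∈ A := fun j => zP_mem_adicIdeal (hκ j)
  -- An exponent beyond ρ_j is handled in the chart of ρ_j; one beyond ρ_{j+1} in the chart of
  -- ρ_{j+1}, after crossing σ_j, which changes nothing to this order.
  have hneg : ∀ j (m : ℤ × ℤ), ¬ (0 ≤ m.1 ∧ 0 ≤ m.2) → G j m ∈ A ^ (n + 1) := by
    intro j m hm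
    by_cases h2 : m.2 < 0
    · rw [hAs]
      exact coeff_psiPlus_mem_mul (hκA j) (ha j) (haM j) h2
    · have h1 : m.1 < 0 := by
        by_contra h1
        exact hm ⟨not_lt.1 h1, not_lt.1 h2⟩
      have h3 : QTorus.coeff (chartM S D I (j + 1) a) m ∈ A ^ (n + 1) := by
        rw [hAs]
        exact coeff_psiMinus_mem_mul (hκA (j + 1)) (ha (j + 1)) (haM (j + 1)) h1
      have h4 := Ideal.sub_mem _ h3 (hPM j m)
      rwa [sub_sub_cancel] at h4
  have hglue : ∀ j b, G (j + 1) (b, 0) - G j (0, b) ∈ A ^ (n + 1) := by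
    intro j b
    have : G (j + 1) (b, 0) = QTorus.coeff (chartM S D I (j + 1) a) (0, b) :=
      coeff_psiPlus_eq_coeff_psiMinus _ b
    rw [this]
    exact hPM j (0, b)
  -- A point may lie in several cones. One is chosen for each point; by `hglue` the choice does not
  -- matter modulo the next power.
  choose l hl using fun p : IntPoint r => p.2
  have hfin : {p | G (l p) (p.coords (l p)) ≠ 0}.Finite := by
    have hS : (⋃ j, (fun m => (j, m)) '' {m | G j m ≠ 0}).Finite :=
      Set.finite_iUnion fun j => (QTorus.finite_coeff_ne_zero _).image _
    refine Set.Finite.of_finite_image (f := fun p => (l p, p.coords (l p))) (hS.subset ?_) ?_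
    · rintro _ ⟨p, hp, rfl⟩
      exact Set.mem_iUnion.2 ⟨l p, _, hp, rfl⟩
    · intro p _ p' _ h
      simp only [Prod.mk.injEq] at h
      refine IntPoint.ext_of_inCone (hl p) (h.1 ▸ hl p') ?_
      rw [h.2, h.1]
  let c : IntPoint r →₀ RIh k I :=
    Finsupp.ofSupportFinite (fun p => G (l p) (p.coords (l p))) hfin
  have hc : ∀ p, c p = G (l p) (p.coords (l p)) := fun p => rfl
  refine ⟨c, fun j => QTorus.mem_smul_top.2 fun m => ?_⟩
  obtain ⟨z, hz, -⟩ := exists_nearFirst (S := S) hI j one_pos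
  -- The error splits in two: the leading coefficients, which cancel to order n + 1, and the
  -- non-straight part of the lifts, a product of an element of A^n and one of A.
  have hcoeff : QTorus.coeff (chartP S D I j (a - c.sum fun p x => x • θ p)) m =
      (G j m - ∑ p ∈ c.support, c p * (if p.InCone j ∧ p.coords j = m then 1 else 0)) -
        ∑ p ∈ c.support, c p * (QTorus.coeff (S.lift D I p j z) m -
          (if p.InCone j ∧ p.coords j = m then 1 else 0)) := by
    have hsub : ∀ x y, chartP S D I j (x - y) = chartP S D I j x - chartP S D I j y :=
      map_sub (chartP S D I j)
    rw [hsub, QTorus.coeff_sub, Finsupp.sum, map_sum, QTorus.coeff_sum, sub_sub,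
      ← Finset.sum_add_distrib]
    congr 1
    refine Finset.sum_congr rfl fun p _ => ?_
    rw [map_smul, QTorus.coeff_smul, (hθ p).chartP_eq hr hκ hI hz]
    ring
  rw [hcoeff]
  refine Ideal.sub_mem _ ?_ (Ideal.sum_mem _ fun p _ => ?_)
  · by_cases hm : 0 ≤ m.1 ∧ 0 ≤ m.2
    · obtain ⟨q, hq, hqm⟩ := IntPoint.exists_coords_eq hr j hm.1 hm.2
      have hiff : ∀ p : IntPoint r, (p.InCone j ∧ p.coords j = m) ↔ p = q := by
        intro p
        constructor
        · rintro ⟨h1, h2⟩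
          exact IntPoint.ext_of_inCone h1 hq (h2.trans hqm.symm)
        · rintro rfl
          exact ⟨hq, hqm⟩
      have hsum : ∑ p ∈ c.support, c p * (if p.InCone j ∧ p.coords j = m then 1 else 0) =
          c q := by
        simp only [hiff, mul_ite, mul_one, mul_zero, Finset.sum_ite_eq']
        split_ifs with h
        · rfl
        · exact (Finsupp.notMem_support_iff.1 h).symm
      rw [hsum, hc, ← hqm]
      exact IntPoint.sub_mem_of_inCone hr hglue q hq (hl q)
    · rw [Finset.sum_eq_zero, sub_zero]
      · exact hneg j m hm
      · intro p _
        rw [if_neg, mul_zero]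
        rintro ⟨-, rfl⟩
        exact hm ⟨Int.natCast_nonneg _, Int.natCast_nonneg _⟩
  · rw [hAs]
    refine Ideal.mul_mem_mul ?_ (coeff_lift_sub_mem hr hκ hI hz.1.1 hz.1.2.1 m)
    exact QTorus.mem_smul_top.1 (ha (l p)) _

/-- The approximation is iterated until the power of the ideal is zero; then all restrictions of the
remainder vanish. The expansion is finite because finitely many finite sums are added. -/
theorem exists_expansion (hr : 3 ≤ r) (hκ : ∀ j, κ j ∈ J) (hI : IsRadicalOf J I)
    (hθ : ∀ p, S.IsTheta D I p (θ p)) (a : S.globalSections D I) :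
    ∃ c : IntPoint r →₀ RIh k I, a = c.sum fun p x => x • θ p := by
  classical
  have happrox : ∀ n, ∃ c : IntPoint r →₀ RIh k I, ∀ j,
      chartP S D I j (a - c.sum fun p x => x • θ p) ∈
        adicIdeal k J I ^ n • (⊤ : Submodule (RIh k I) (RSigma i I)) := by
    intro n
    induction n with
    | zero =>
      refine ⟨0, fun j => ?_⟩
      rw [Submodule.pow_zero, Ideal.one_eq_top, Submodule.top_smul]
      exact Submodule.mem_top
    | succ n ih =>
      obtain ⟨c, hc⟩ := ih
      obtain ⟨c', hc'⟩ := exists_approx hr hκ hI hθ n _ hc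
      refine ⟨c + c', fun j => ?_⟩
      have hadd : ((c + c').sum fun p x => x • θ p) =
          (c.sum fun p x => x • θ p) + c'.sum fun p x => x • θ p :=
        Finsupp.sum_add_index' (fun p => zero_smul (RIh k I) (θ p))
          (fun p x y => add_smul x y (θ p))
      rw [hadd, show ∀ x y : S.globalSections D I, a - (x + y) = a - x - y from
        fun x y => (sub_sub a x y).symm]
      exact hc' j
  obtain ⟨N, hN⟩ := exists_adicIdeal_pow_eq_bot (k := k) hI
  obtain ⟨c, hc⟩ := happrox N
  have hzero : ∀ x : RSigma i I,
      x ∈ adicIdeal k J I ^ N • (⊤ : Submodule (RIh k I) (RSigma i I)) → x = 0 := by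
    intro x hx
    rw [hN, Submodule.bot_smul] at hx
    exact (Submodule.mem_bot _).1 hx
  refine ⟨c, sub_eq_zero.1 (eq_of_chart_eq (fun j => ?_) fun j => ?_)⟩
  · rw [map_zero]
    exact hzero _ (hc j)
  · rw [map_zero]
    have := chartM_mem hI (hc (j - 1))
    rw [sub_add_cancel] at this
    exact hzero _ this

/-- The coefficients of an expansion are read off near the integral points. -/
theorem coeff_chartAt_sum (hr : 3 ≤ r) (hκ : ∀ j, κ j ∈ J) (hS : S.IsConsistent D)
    (hI : IsRadicalOf J I) (hθ : ∀ p, S.IsTheta D I p (θ p)) (c : IntPoint r →₀ RIh k I)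
    {p : IntPoint r} {j : ZMod r} {z : ℝ × ℝ} (hz : IsGeneric z)
    (h : ∀ p' : IntPoint r, p' ≠ p → QTorus.coeff (S.lift D I p' j z) (p.coords j) = 0)
    (h1 : QTorus.coeff (S.lift D I p j z) (p.coords j) = 1) :
    QTorus.coeff (chartAt S D I j z (c.sum fun p x => x • θ p)) (p.coords j) = c p := by
  classical
  rw [Finsupp.sum, map_sum, QTorus.coeff_sum, Finset.sum_eq_single p]
  · rw [map_smul, QTorus.coeff_smul, (hθ p).chartAt_eq hr hκ hS hI hz, h1, mul_one]
  · intro p' _ hp'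
    rw [map_smul, QTorus.coeff_smul, (hθ p').chartAt_eq hr hκ hS hI hz, h p' hp', mul_zero]
  · intro hp
    rw [Finsupp.notMem_support_iff.1 hp, map_smul, QTorus.coeff_smul, zero_mul]

end Generation

/-! ### Products of lifts -/

/-- The pairs are sorted by the exponent of the first broken line, of which only finitely many
values carry nonzero coefficients. For each value the contribution is a product of two convergent
sums times a power of q^{1/2}. -/
theorem hasHSum_coeff_lift_mul (hr : 3 ≤ r) (hκ : ∀ j, κ j ∈ J) (hI : IsRadicalOf J I)
    (p₁ p₂ : IntPoint r) (j : ZMod r) (z : ℝ × ℝ) (m : ℤ × ℤ) :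
    HasHSum
      (fun γ : {γ : S.BrokenLine D I p₁ j z × S.BrokenLine D I p₂ j z //
          γ.1.s + γ.2.s = m} =>
        γ.1.1.c * γ.1.2.c * ((vI i I ^ pairing γ.1.1.s γ.1.2.s : (RIh k I)ˣ) : RIh k I))
      (QTorus.coeff (S.lift D I p₁ j z * S.lift D I p₂ j z) m) := by
  classical
  have hL : ∀ (p : IntPoint r) (n : ℤ × ℤ),
      HasHSum (fun γ : S.BrokenLine D I p j z => if γ.s = n then γ.c else 0)
        (QTorus.coeff (S.lift D I p j z) n) := by
    intro p n
    rw [← hasHSum_subtype_iff (f := fun γ : S.BrokenLine D I p j z => γ.c),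
      coeff_lift p j z hr hκ hI]
    exact hasHSum_hSum fun a => (finite_coeff_c_ne_zero (S := S) (D := D) p j z hr hκ hI
      a).preimage Subtype.val_injective.injOn
  have hfin := finite_s (S := S) (D := D) p₁ j z hr hκ hI
  have hM : ∀ n, n ∉ hfin.toFinset → ∀ γ : S.BrokenLine D I p₁ j z, γ.s = n → γ.c = 0 := by
    intro n hn γ hγ
    by_contra h
    exact hn (hfin.mem_toFinset.2 ⟨γ, h, hγ⟩)
  have hout : ∀ n, n ∉ hfin.toFinset → QTorus.coeff (S.lift D I p₁ j z) n = 0 := by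
    intro n hn
    rw [← (hL p₁ n).hSum_eq]
    ext a : 1
    rw [hSum, PowerSeries.coeff_mk, map_zero]
    refine finsum_eq_zero_of_forall_eq_zero fun γ => ?_
    split_ifs with h
    · rw [hM n hn γ h, map_zero]
    · rw [map_zero]
  rw [QTorus.coeff_mul _ _ m hfin.toFinset hout]
  have key := HasHSum.finset_sum hfin.toFinset fun n _ => ((hL p₁ n).mul (hL p₂ (m - n))).mul_const
    ((vI i I ^ pairing n (m - n) : (RIh k I)ˣ) : RIh k I)
  refine (hasHSum_subtype_iff (p := fun γ : S.BrokenLine D I p₁ j z × S.BrokenLine D I p₂ j z =>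
    γ.1.s + γ.2.s = m) (f := fun γ => γ.1.c * γ.2.c *
      ((vI i I ^ pairing γ.1.s γ.2.s : (RIh k I)ˣ) : RIh k I))).2 ?_
  convert key using 2 with γ
  by_cases hγ : γ.1.s ∈ hfin.toFinset
  · rw [Finset.sum_eq_single γ.1.s]
    · rw [if_pos rfl]
      by_cases h : γ.1.s + γ.2.s = m
      · have h' : γ.2.s = m - γ.1.s := by rw [← h]; abel
        rw [if_pos h, if_pos h', h']
      · have h' : γ.2.s ≠ m - γ.1.s := fun h' => h (by rw [h']; abel)
        rw [if_neg h, if_neg h', mul_zero, zero_mul]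
    · intro n _ hn
      rw [if_neg hn.symm, zero_mul, zero_mul]
    · exact fun h => absurd hγ h
  · rw [Finset.sum_eq_zero]
    · split_ifs
      · rw [hM _ hγ γ.1 rfl, zero_mul, zero_mul]
      · rfl
    · intro n hn
      rw [if_neg (fun h : γ.1.s = n => hγ (h ▸ hn)), zero_mul, zero_mul]

end QuantumScattering

end Scattering

end QuantumTheta

end

/-! ### The multiplication rule for quantum theta functions -/

theorem mainTheorem6 {k : Type*} [Field k] [IsAlgClosed k] [CharZero k] (i : k) (hi : i ^ 2 = -1)
    {P : Type*} [AddCommMonoid P] [QuantumTheta.IsToricMonoid P]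
    {r : ℕ} (hr : 3 ≤ r) (D : ZMod r → ℤ) (κ : ZMod r → P)
    (J : AddSemigroupIdeal P) (hJ : QuantumTheta.IsRadicalOf J J) (hκ : ∀ j, κ j ∈ J)
    (S : QuantumTheta.QuantumScattering i κ J) (hS : S.IsConsistent D)
    (I : AddSemigroupIdeal P) (hI : QuantumTheta.IsRadicalOf J I) :
    (∃! θ : QuantumTheta.IntPoint r → S.globalSections D I, ∀ p, S.IsTheta D I p (θ p)) ∧
    ∀ θ : QuantumTheta.IntPoint r → S.globalSections D I, (∀ p, S.IsTheta D I p (θ p)) →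
      ∃ C : QuantumTheta.IntPoint r → QuantumTheta.IntPoint r →
          QuantumTheta.IntPoint r →₀ QuantumTheta.RIh k I,
        (∀ p₁ p₂ (c : QuantumTheta.IntPoint r →₀ QuantumTheta.RIh k I),
          θ p₁ * θ p₂ = (c.sum fun p a => a • θ p) ↔ c = C p₁ p₂) ∧
        ∀ p : QuantumTheta.IntPoint r, ∃ ε : ℝ, 0 < ε ∧
          ∀ (j : ZMod r) (z : ℝ × ℝ), p.InCone j → QuantumTheta.IsGeneric z →
            |z.1 - p.1 j| < ε → |z.2 - p.1 (j + 1)| < ε →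
            ∀ p₁ p₂ : QuantumTheta.IntPoint r,
              QuantumTheta.HasHSum
                (fun γ : {γ : S.BrokenLine D I p₁ j z × S.BrokenLine D I p₂ j z //
                    γ.1.s + γ.2.s = p.coords j} =>
                  γ.1.1.c * γ.1.2.c *
                    ((QuantumTheta.vI i I ^ QuantumTheta.pairing γ.1.1.s γ.1.2.s :
                      (QuantumTheta.RIh k I)ˣ) : QuantumTheta.RIh k I))
                (C p₁ p₂ p) := by
  open QuantumTheta QuantumTheta.QuantumScattering in
  constructor
  · choose θ hθ using exists_isTheta (I := I) hS hI
    exact ⟨θ, hθ, fun θ' hθ' => funext fun p => (hθ' p).unique hI (hθ p)⟩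
  · intro θ hθ
    choose C hC using fun p₁ p₂ => exists_expansion hr hκ hI hθ (θ p₁ * θ p₂)
    choose ε hε hnear using exists_near_coeff_lift (S := S) (D := D) hr hκ hI
    have hcoeff : ∀ (c : IntPoint r →₀ RIh k I) (p : IntPoint r) (j : ZMod r) (z : ℝ × ℝ),
        p.InCone j → IsGeneric z → |z.1 - p.1 j| < ε p → |z.2 - p.1 (j + 1)| < ε p →
        QTorus.coeff (chartAt S D I j z (c.sum fun p x => x • θ p)) (p.coords j) = c p := by
      intro c p j z hp hz h1 h2
      refine coeff_chartAt_sum hr hκ hS hI hθ c hz (fun p' hp' => ?_) ?_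
      · rw [hnear p j z hp hz h1 h2, if_neg hp']
      · rw [hnear p j z hp hz h1 h2, if_pos rfl]
    refine ⟨C, fun p₁ p₂ c => ⟨fun h => Finsupp.ext fun p => ?_, ?_⟩, fun p =>
      ⟨ε p, hε p, fun j z hp hz h1 h2 p₁ p₂ => ?_⟩⟩
    · obtain ⟨j, hj⟩ := p.2
      obtain ⟨z, hz, h1, h2⟩ := exists_isGeneric_near (p.1 j) (p.1 (j + 1)) (hε p)
      -- Both coefficients at p equal the coefficient of z^p in the restriction of the same section
      -- near p.
      rw [← hcoeff c p j z hj hz h1 h2, ← h, hC p₁ p₂, hcoeff (C p₁ p₂) p j z hj hz h1 h2]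
    · rintro rfl
      exact hC p₁ p₂
    -- Restriction to the chamber of z is multiplicative and turns theta functions into lifts at z.
    · rw [← hcoeff (C p₁ p₂) p j z hp hz h1 h2, ← hC p₁ p₂, map_mul,
        (hθ p₁).chartAt_eq hr hκ hS hI hz, (hθ p₂).chartAt_eq hr hκ hS hI hz]
      exact hasHSum_coeff_lift_mul hr hκ hI p₁ p₂ j z _
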